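/- Let $k$ be a field and let $X$ be a regular irreducible scheme of finite type and of dimension $2$ over $k$. Let $\mathcal F$ be a quasicoherent sheaf on $X$ which is flat, that is, all stalks $\mathcal F_x$ are flat $\mathcal O_{X,x}$-modules. For a set $S$ of flags $(\eta_0,\dots,\eta_p)$ of points of $X$ (each $\eta_{i+1}$ lies in the closure of $\eta_i$ and differs from it) let $\mathbf A_X(S,\cdot)$ be the Beilinson–Huber adele functor from quasicoherent sheaves to abelian groups. It commutes with filtered colimits, and for a coherent sheaf $\mathcal G$ it is given by $$\mathbf A_X(S,\mathcal G)=\prod_{\eta\in S}\varprojlim_l \mathcal G_\eta/\mathfrak m_\eta^l\mathcal G_\eta\quad(p=0),\qquad \mathbf A_X(S,\mathcal G)=\prod_{\eta\in X}\varprojlim_l \mathbf A_X\bigl({}_\eta S,[\mathcal G_\eta/\mathfrak m_\eta^l\mathcal G_\eta]_\eta\bigr)\quad(p>0),$$ where ${}_\eta S=\{(\eta_1,\dots,\eta_p):(\eta,\eta_1,\dots,\eta_p)\in S\}$ and $[M]_\eta$ denotes the pushforward to $X$ of the sheaf on $\operatorname{Spec}\mathcal O_{X,\eta}$ associated with $M$.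 For a non-empty subset $I=\{i_0<\dots<i_p\}$ of $\{0,1,2\}$ put $\mathbf A_X(I,\mathcal F)=\mathbf A_X(S(I),\mathcal F)$, where $S(I)$ is the set of all flags $(\eta_0,\dots,\eta_p)$ such that the closure of $\eta_j$ has codimension $i_j$ in $X$ for all $j$; put $\mathbf A_X(\varnothing,\mathcal F)=\mathcal F(X)$. For $I\subset J$ let $\varphi_{IJ}\colon\mathbf A_X(I,\mathcal F)\to\mathbf A_X(J,\mathcal F)$ be the canonical map, the composite of the boundary maps on adelic groups which insert into flags the members with codimensions in $J\setminus I$; these are induced by the natural maps $\mathcal G\to[\mathcal G_\eta/\mathfrak m_\eta^l\mathcal G_\eta]_\eta$. Then for all subsets $I\subset J\subset\{0,1,2\}$ the map $\varphi_{IJ}\colon\mathbf A_X(I,\mathcal F)\to\mathbf A_X(J,\mathcal F)$ is injective. -/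

import Mathlib

open CategoryTheory Limits AlgebraicGeometry Opposite

universe u

noncomputable section

namespace BeilinsonAdeles

variable {X : Scheme.{u}}

/-! ### Sheaves of modules -/

/-- Coherent sheaves on a Noetherian scheme: quasi-coherent sheaves of modules whose module of
sections over each affine open is finitely generated. -/
def isCoherent (X : Scheme.{u}) : ObjectProperty X.Modules := fun M =>
  M.IsQuasicoherent ∧ ∀ U : X.Opens, IsAffineOpen U → Module.Finite Γ(X, U) Γ(M, U)

/-- The stalk of a sheaf of modules is a module over the local ring. -/
instance stalkModule (F : X.Modules) (x : X) :
    Module (X.presheaf.stalk x) ↑(TopCat.Presheaf.stalk F.presheaf x) :=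
  letI M : PresheafOfModules (X.presheaf ⋙ forget₂ CommRingCat RingCat) := F.val
  inferInstanceAs (Module (X.presheaf.stalk x) ↑(TopCat.Presheaf.stalk M.presheaf x))

/-- A sheaf of modules is flat if all its stalks are flat over the local rings of the scheme. -/
def IsFlat (F : X.Modules) : Prop :=
  ∀ x : X, Module.Flat (X.presheaf.stalk x) ↑(TopCat.Presheaf.stalk F.presheaf x)

/-- Global sections, with values in the larger universe in which adeles are formed. -/
def globalSections (X : Scheme.{u}) : X.Modules ⥤ AddCommGrpCat.{u + 1} :=
  Scheme.Modules.toPresheaf X ⋙ (evaluation _ _).obj (op ⊤) ⋙ AddCommGrpCat.uliftFunctor.{u + 1, u}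

/-- The closed subscheme `Spec (𝒪_{X,η} / 𝔪_η ^ l)` of the spectrum of the local ring. -/
abbrev thickening (η : X) (l : ℕ) : Scheme.{u} :=
  Spec (.of (X.presheaf.stalk η ⧸ IsLocalRing.maximalIdeal (X.presheaf.stalk η) ^ l))

/-- The canonical morphism `Spec (𝒪_{X,η} / 𝔪_η ^ l) ⟶ X`. -/
def thickeningι (η : X) (l : ℕ) : thickening η l ⟶ X :=
  Spec.map (CommRingCat.ofHom (Ideal.Quotient.mk _)) ≫ X.fromSpecStalk η

/-- The morphism `Spec (𝒪_{X,η} / 𝔪_η ^ l) ⟶ Spec (𝒪_{X,η} / 𝔪_η ^ (l + 1))` over `X`. -/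
def thickeningSucc (η : X) (l : ℕ) : thickening η l ⟶ thickening η (l + 1) :=
  Spec.map (CommRingCat.ofHom (Ideal.Quotient.factor (Ideal.pow_le_pow_right (Nat.le_succ l))))

lemma thickeningSucc_ι (η : X) (l : ℕ) :
    thickeningSucc η l ≫ thickeningι η (l + 1) = thickeningι η l := by
  unfold thickeningSucc thickeningι
  rw [← Spec.map_comp_assoc]
  congr 2

section PullPush

variable {Z Z' : Scheme.{u}}

/-- The functor `F ↦ f_* f^* F`. -/
abbrev pullPush (f : Z ⟶ X) : X.Modules ⥤ X.Modules :=
  Scheme.Modules.pullback f ⋙ Scheme.Modules.pushforward f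

/-- The adjunction unit `F ⟶ f_* f^* F`. -/
def pullPushUnit (f : Z ⟶ X) : 𝟭 X.Modules ⟶ pullPush f :=
  (Scheme.Modules.pullbackPushforwardAdjunction f).unit

/-- For `f = g ≫ f'`, the canonical isomorphism `f_* ≅ f'_* g_*`. -/
def pushFactor (g : Z ⟶ Z') (f' : Z' ⟶ X) (f : Z ⟶ X) (h : g ≫ f' = f) :
    Scheme.Modules.pushforward g ⋙ Scheme.Modules.pushforward f' ≅ Scheme.Modules.pushforward f :=
  Scheme.Modules.pushforwardComp g f' ≪≫ Scheme.Modules.pushforwardCongr h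

/-- For `f = g ≫ f'`, the canonical map `f'_* f'^* F ⟶ f_* f^* F`: it is `f'_*` of the map
`f'^* F ⟶ g_* f^* F` which is adjoint to the unit `F ⟶ f_* f^* F = f'_* g_* f^* F`. -/
def pullPushTrans (g : Z ⟶ Z') (f' : Z' ⟶ X) (f : Z ⟶ X) (h : g ≫ f' = f) (F : X.Modules) :
    (pullPush f').obj F ⟶ (pullPush f).obj F :=
  (Scheme.Modules.pushforward f').map
    (((Scheme.Modules.pullbackPushforwardAdjunction f').homEquiv F
      ((Scheme.Modules.pushforward g).obj ((Scheme.Modules.pullback f).obj F))).symm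
        ((pullPushUnit f).app F ≫ (pushFactor g f' f h).inv.app _)) ≫
    (pushFactor g f' f h).hom.app _

lemma pullPushTrans_naturality (g : Z ⟶ Z') (f' : Z' ⟶ X) (f : Z ⟶ X) (h : g ≫ f' = f)
    {F G : X.Modules} (a : F ⟶ G) :
    (pullPush f').map a ≫ pullPushTrans g f' f h G =
      pullPushTrans g f' f h F ≫ (pullPush f).map a := by
  have e1 := (pushFactor g f' f h).hom.naturality ((Scheme.Modules.pullback f).map a)
  have e2 := (pushFactor g f' f h).inv.naturality ((Scheme.Modules.pullback f).map a)
  have e3 := (pullPushUnit f).naturality a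
  dsimp only [pullPushTrans, pullPush, Functor.comp_map, Functor.comp_obj, Functor.id_map,
    Functor.id_obj] at e1 e2 e3 ⊢
  rw [Category.assoc, ← e1, ← Category.assoc, ← Category.assoc, ← Functor.map_comp,
    ← Functor.map_comp]
  congr 2
  rw [← Adjunction.homEquiv_naturality_left_symm, ← Adjunction.homEquiv_naturality_right_symm,
    Category.assoc, ← e2, ← Category.assoc, e3, Category.assoc]

lemma pullPushUnit_trans (g : Z ⟶ Z') (f' : Z' ⟶ X) (f : Z ⟶ X) (h : g ≫ f' = f)
    (F : X.Modules) :
    (pullPushUnit f').app F ≫ pullPushTrans g f' f h F = (pullPushUnit f).app F := by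
  unfold pullPushTrans
  have := ((Scheme.Modules.pullbackPushforwardAdjunction f').homEquiv_unit
    (f := ((Scheme.Modules.pullbackPushforwardAdjunction f').homEquiv F
      ((Scheme.Modules.pushforward g).obj ((Scheme.Modules.pullback f).obj F))).symm
        ((pullPushUnit f).app F ≫ (pushFactor g f' f h).inv.app _)))
  rw [Equiv.apply_symm_apply] at this
  refine (Category.assoc _ _ _).symm.trans ?_
  refine (congrArg (· ≫ (pushFactor g f' f h).hom.app _) this.symm).trans ?_
  refine (Category.assoc _ _ _).trans ?_
  rw [Iso.inv_hom_id_app]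
  exact Category.comp_id _

end PullPush

/-- The quasi-coherent sheaf `[F_η / 𝔪_η ^ l F_η]_η` (constant on the closure of `η`), realised as
`i_* i^* F` for the canonical morphism `i : Spec (𝒪_{X,η} / 𝔪_η ^ l) ⟶ X`. -/
def jet (η : X) (l : ℕ) : X.Modules ⥤ X.Modules := pullPush (thickeningι η l)

/-- The canonical map `F ⟶ [F_η / 𝔪_η ^ l F_η]_η`. -/
def toJet (η : X) (l : ℕ) : 𝟭 X.Modules ⟶ jet η l := pullPushUnit (thickeningι η l)

/-- The transition map `[F_η / 𝔪_η ^ (l + 1) F_η]_η ⟶ [F_η / 𝔪_η ^ l F_η]_η`. -/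
def jetTrans (η : X) (l : ℕ) : jet η (l + 1) ⟶ jet η l where
  app F := pullPushTrans (thickeningSucc η l) _ _ (thickeningSucc_ι η l) F
  naturality _ _ a := pullPushTrans_naturality _ _ _ _ a

lemma toJet_trans (η : X) (l : ℕ) (F : X.Modules) :
    (toJet η (l + 1)).app F ≫ (jetTrans η l).app F = (toJet η l).app F :=
  pullPushUnit_trans _ _ _ _ F

/-! ### Extension of functors from coherent sheaves -/

/-- The extension of a functor on coherent sheaves: its value at `F` is the colimit of the `A G`
over all coherent sheaves `G` with a map `G ⟶ F`. For quasi-coherent `F` on a Noetherian scheme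
this is the unique extension of `A` commuting with filtered colimits. -/
def cohExtend (A : (isCoherent X).FullSubcategory ⥤ AddCommGrpCat.{u + 1}) :
    X.Modules ⥤ AddCommGrpCat.{u + 1} :=
  (isCoherent X).ι.pointwiseLeftKanExtension A

/-- The canonical map from a functor on coherent sheaves to its extension. -/
def cohExtendUnit (A : (isCoherent X).FullSubcategory ⥤ AddCommGrpCat.{u + 1}) :
    A ⟶ (isCoherent X).ι ⋙ cohExtend A :=
  (isCoherent X).ι.pointwiseLeftKanExtensionUnit A

/-- The transformation out of an extended functor given by a transformation on coherent sheaves. -/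
def cohExtendDesc {A : (isCoherent X).FullSubcategory ⥤ AddCommGrpCat.{u + 1}}
    {H : X.Modules ⥤ AddCommGrpCat.{u + 1}} (α : A ⟶ (isCoherent X).ι ⋙ H) : cohExtend A ⟶ H :=
  ((isCoherent X).ι.pointwiseLeftKanExtension A).descOfIsLeftKanExtension
    ((isCoherent X).ι.pointwiseLeftKanExtensionUnit A) H α

/-- The structure sheaf as a sheaf of modules. -/
def structureSheaf (X : Scheme.{u}) : X.Modules := SheafOfModules.unit X.ringCatSheaf

section Free

variable {C : Type*} [Category* C] {A : C}

def isoOfCofanUnique {c : Cofan fun _ : PUnit.{u + 1} => A} (hc : IsColimit c) : A ≅ c.pt where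
  hom := c.inj PUnit.unit
  inv := Cofan.IsColimit.desc hc fun _ => 𝟙 _
  inv_hom_id := Cofan.IsColimit.hom_ext hc _ _ (by simp)

def biprodIsoOfCofan [HasZeroMorphisms C] [HasBinaryBiproduct A A]
    {c : Cofan fun _ : ULift.{u} Bool => A} (hc : IsColimit c) : A ⊞ A ≅ c.pt where
  hom := biprod.desc (c.inj ⟨true⟩) (c.inj ⟨false⟩)
  inv := Cofan.IsColimit.desc hc fun b => if b.down then biprod.inl else biprod.inr
  hom_inv_id := by ext <;> simp
  inv_hom_id := Cofan.IsColimit.hom_ext hc _ _ (by rintro ⟨_ | _⟩ <;> simp)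

end Free

lemma free_isQuasicoherent (I : Type u) :
    (SheafOfModules.freeCofan (R := X.ringCatSheaf) I).pt.IsQuasicoherent :=
  inferInstanceAs (SheafOfModules.isQuasicoherent X.ringCatSheaf (SheafOfModules.free I))

lemma structureSheaf_isQuasicoherent : (structureSheaf X).IsQuasicoherent :=
  (SheafOfModules.isQuasicoherent X.ringCatSheaf).prop_of_iso
    (isoOfCofanUnique (SheafOfModules.isColimitFreeCofan PUnit.{u + 1})).symm
    (free_isQuasicoherent _)

lemma isCoherent_structureSheaf : isCoherent X (structureSheaf X) := by
  refine ⟨structureSheaf_isQuasicoherent, fun U _ => ?_⟩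
  exact inferInstanceAs (Module.Finite Γ(X, U) Γ(X, U))

lemma isCoherent_biprod : isCoherent X (structureSheaf X ⊞ structureSheaf X) := by
  refine ⟨(SheafOfModules.isQuasicoherent X.ringCatSheaf).prop_of_iso
    (biprodIsoOfCofan (SheafOfModules.isColimitFreeCofan (ULift.{u} Bool))).symm
    (free_isQuasicoherent _),
    fun U _ => ?_⟩
  let inl : structureSheaf X ⟶ structureSheaf X ⊞ structureSheaf X := biprod.inl
  let inr : structureSheaf X ⟶ structureSheaf X ⊞ structureSheaf X := biprod.inr
  let fst : structureSheaf X ⊞ structureSheaf X ⟶ structureSheaf X := biprod.fst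
  let snd : structureSheaf X ⊞ structureSheaf X ⟶ structureSheaf X := biprod.snd
  have total : fst ≫ inl + snd ≫ inr = 𝟙 _ := biprod.total
  have : Module.Finite Γ(X, U) Γ(structureSheaf X, U) :=
    isCoherent_structureSheaf.2 U ‹_›
  let m (f : structureSheaf X ⟶ structureSheaf X ⊞ structureSheaf X) :
      Γ(structureSheaf X, U) →ₗ[Γ(X, U)] Γ(structureSheaf X ⊞ structureSheaf X, U) :=
    { toFun := f.app U
      map_add' := map_add _
      map_smul' := fun r x => f.app_smul r x }
  refine Module.Finite.of_surjective ((m inl).coprod (m inr)) fun x => ?_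
  refine ⟨(fst.app U x, snd.app U x), ?_⟩
  have h := congrArg (fun f => Scheme.Modules.Hom.app f U x) total
  exact h

/-- A global section of `F` as a compatible family of sections. -/
def toSections {F : X.Modules} (s : Γ(F, ⊤)) : SheafOfModules.sections (R := X.ringCatSheaf) F :=
  PresheafOfModules.sectionsMk (M := F.val)
    (fun U => F.presheaf.map (homOfLE (le_top : U.unop ≤ ⊤)).op s) (by
      intro U V f
      refine (ConcreteCategory.comp_apply (F.presheaf.map _) (F.presheaf.map f) s).symm.trans ?_
      rw [← F.presheaf.map_comp]
      rfl)

/-- The morphism `𝒪_X ⟶ F` sending `1` to a given global section of `F`. -/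
def ofSection {F : X.Modules} (s : Γ(F, ⊤)) : structureSheaf X ⟶ F :=
  (SheafOfModules.unitHomEquiv (R := X.ringCatSheaf) F).symm (toSections s)

/-- The global section `1` of the structure sheaf. -/
def oneSection (X : Scheme.{u}) : Γ(structureSheaf X, ⊤) := (1 : Γ(X, ⊤))

lemma ofSection_app_one {F : X.Modules} (s : Γ(F, ⊤)) :
    (ofSection s).app ⊤ (oneSection X) = s := by
  have h := (SheafOfModules.unitHomEquiv (R := X.ringCatSheaf) F).apply_symm_apply (toSections s)
  refine (congrArg (fun t => t.val (op ⊤)) h).trans ?_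
  exact congrArg (fun g => g s) (F.presheaf.map_id (op ⊤))

lemma hom_ext_one {F : X.Modules} {f g : structureSheaf X ⟶ F}
    (h : f.app ⊤ (oneSection X) = g.app ⊤ (oneSection X)) : f = g := by
  refine (SheafOfModules.unitHomEquiv (R := X.ringCatSheaf) F).injective ?_
  refine PresheafOfModules.sections_ext _ _ fun U => ?_
  have e (k : structureSheaf X ⟶ F) := PresheafOfModules.sections_property
    ((SheafOfModules.unitHomEquiv (R := X.ringCatSheaf) F) k)
      (homOfLE (le_top : U.unop ≤ ⊤)).op
  exact (e f).symm.trans ((congrArg (F.val.map (homOfLE (le_top : U.unop ≤ ⊤)).op) h).trans (e g))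

lemma ofSection_comp {F G : X.Modules} (s : Γ(F, ⊤)) (f : F ⟶ G) :
    ofSection s ≫ f = ofSection (f.app ⊤ s) := by
  refine hom_ext_one ?_
  rw [ofSection_app_one]
  exact congrArg (f.app ⊤) (ofSection_app_one s)

/-- `𝒪_X` as an object of the category of coherent sheaves. -/
def cohO (X : Scheme.{u}) : (isCoherent X).FullSubcategory := ⟨_, isCoherent_structureSheaf⟩

/-- `𝒪_X ⊕ 𝒪_X` as an object of the category of coherent sheaves. -/
def cohO2 (X : Scheme.{u}) : (isCoherent X).FullSubcategory := ⟨_, isCoherent_biprod⟩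

section Apply

variable {C : Type*} [Category* C] {B B' : C ⥤ AddCommGrpCat.{u + 1}}

lemma map_map_apply (B : C ⥤ AddCommGrpCat.{u + 1}) {F G K : C} (f : F ⟶ G) (g : G ⟶ K)
    (x : B.obj F) : B.map g (B.map f x) = B.map (f ≫ g) x := by
  rw [B.map_comp, ConcreteCategory.comp_apply]

lemma app_map_apply (β : B ⟶ B') {F G : C} (f : F ⟶ G) (x : B.obj F) :
    β.app G (B.map f x) = B'.map f (β.app F x) := by
  rw [← ConcreteCategory.comp_apply, β.naturality, ConcreteCategory.comp_apply]

end Apply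

section GlobalSections

variable {H : X.Modules ⥤ AddCommGrpCat.{u + 1}}

/-- The image of a global section `s` of `F` under the extension to all sheaves of a
transformation `α` from global sections defined on coherent sheaves: `F` receives the map
`𝒪_X ⟶ F`, `1 ↦ s`, from a coherent sheaf. -/
def globalSectionsDescFun (α : (isCoherent X).ι ⋙ globalSections X ⟶ (isCoherent X).ι ⋙ H)
    (F : X.Modules) (s : (globalSections X).obj F) : H.obj F :=
  H.map (ofSection s.down) (α.app (cohO X) ⟨oneSection X⟩)

lemma globalSectionsDescFun_map
    (α : (isCoherent X).ι ⋙ globalSections X ⟶ (isCoherent X).ι ⋙ H)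
    {F G : X.Modules} (f : F ⟶ G) (s : (globalSections X).obj F) :
    globalSectionsDescFun α G ((globalSections X).map f s) =
      H.map f (globalSectionsDescFun α F s) := by
  refine Eq.trans ?_ (map_map_apply H (ofSection s.down) f _).symm
  exact congrArg (fun k => H.map k (α.app (cohO X) ⟨oneSection X⟩)) (ofSection_comp s.down f).symm

/-- On coherent sheaves the extension agrees with the given transformation. -/
lemma globalSectionsDescFun_coh
    (α : (isCoherent X).ι ⋙ globalSections X ⟶ (isCoherent X).ι ⋙ H)
    (G : (isCoherent X).FullSubcategory) (s : (globalSections X).obj G.obj) :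
    globalSectionsDescFun α G.obj s = α.app G s := by
  let f : cohO X ⟶ G := ObjectProperty.homMk (ofSection s.down)
  have h := congrArg (fun k => k ⟨oneSection X⟩) (α.naturality f)
  refine Eq.trans h.symm ?_
  refine congrArg (α.app G) ?_
  exact ULift.ext _ _ (ofSection_app_one s.down)

lemma globalSectionsDescFun_add
    (α : (isCoherent X).ι ⋙ globalSections X ⟶ (isCoherent X).ι ⋙ H)
    (F : X.Modules) (s t : (globalSections X).obj F) :
    globalSectionsDescFun α F (s + t) =
      globalSectionsDescFun α F s + globalSectionsDescFun α F t := by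
  let p : (cohO2 X).obj ⟶ F := biprod.desc (ofSection s.down) (ofSection t.down)
  let inl : (cohO X).obj ⟶ (cohO2 X).obj := biprod.inl
  let inr : (cohO X).obj ⟶ (cohO2 X).obj := biprod.inr
  have hl : inl ≫ p = ofSection s.down := biprod.inl_desc _ _
  have hr : inr ≫ p = ofSection t.down := biprod.inr_desc _ _
  let a : (globalSections X).obj (cohO2 X).obj := (globalSections X).map inl ⟨oneSection X⟩
  let b : (globalSections X).obj (cohO2 X).obj := (globalSections X).map inr ⟨oneSection X⟩
  have ha : (globalSections X).map p a = s := by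
    refine (map_map_apply _ _ _ _).trans ?_
    rw [hl]
    exact ULift.ext _ _ (ofSection_app_one s.down)
  have hb : (globalSections X).map p b = t := by
    refine (map_map_apply _ _ _ _).trans ?_
    rw [hr]
    exact ULift.ext _ _ (ofSection_app_one t.down)
  have hab : (globalSections X).map p (a + b) = s + t := by rw [map_add, ha, hb]
  rw [← hab]
  conv_rhs => rw [← ha, ← hb]
  rw [globalSectionsDescFun_map, globalSectionsDescFun_map, globalSectionsDescFun_map, ← map_add]
  congr 1
  rw [globalSectionsDescFun_coh α (cohO2 X), globalSectionsDescFun_coh α (cohO2 X),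
    globalSectionsDescFun_coh α (cohO2 X)]
  exact map_add (α.app (cohO2 X)).hom a b

/-- The unique extension to all sheaves of a transformation from global sections which is
defined on coherent sheaves. -/
def globalSectionsDesc (α : (isCoherent X).ι ⋙ globalSections X ⟶ (isCoherent X).ι ⋙ H) :
    globalSections X ⟶ H where
  app F := AddCommGrpCat.ofHom
    (AddMonoidHom.mk' (globalSectionsDescFun α F) (globalSectionsDescFun_add α F))
  naturality F G f := by
    ext s
    exact globalSectionsDescFun_map α f s

end GlobalSections

/-! ### Adeles -/

/-- The flags `(η_1, …, η_n)` such that `(η, η_1, …, η_n)` lies in `S`. -/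
def residual {n : ℕ} (S : Set (Fin (n + 1) → X)) (η : X) : Set (Fin n → X) :=
  {Δ | Fin.cons η Δ ∈ S}

/-- The subgroup `lim_l B ([F_η / 𝔪_η ^ l F_η]_η)` of the product over all `l`. -/
def jetLimit (η : X) (B : X.Modules ⥤ AddCommGrpCat.{u + 1}) (F : X.Modules) :
    AddSubgroup (∀ l : ℕ, B.obj ((jet η l).obj F)) where
  carrier := {a | ∀ l, B.map ((jetTrans η l).app F) (a (l + 1)) = a l}
  zero_mem' _ := map_zero _
  add_mem' ha hb l := (map_add _ _ _).trans (congrArg₂ (· + ·) (ha l) (hb l))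
  neg_mem' ha l := (map_neg _ _).trans (congrArg Neg.neg (ha l))

/-- The map on limits induced by a morphism of sheaves. -/
def jetLimitMap (η : X) (B : X.Modules ⥤ AddCommGrpCat.{u + 1}) {F G : X.Modules} (f : F ⟶ G) :
    jetLimit η B F →+ jetLimit η B G where
  toFun a := ⟨fun l => B.map ((jet η l).map f) (a.1 l), fun l => by
    have h : B.map ((jetTrans η l).app F) (a.1 (l + 1)) = a.1 l := a.2 l
    dsimp only
    rw [← h, map_map_apply, map_map_apply, (jetTrans η l).naturality]⟩
  map_zero' := by ext l; simp
  map_add' a b := by ext l; simp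

/-- The map on limits induced by a transformation of functors. -/
def jetLimitApp (η : X) {B B' : X.Modules ⥤ AddCommGrpCat.{u + 1}} (β : B ⟶ B') (F : X.Modules) :
    jetLimit η B F →+ jetLimit η B' F where
  toFun a := ⟨fun l => β.app _ (a.1 l), fun l => by
    have h : B.map ((jetTrans η l).app F) (a.1 (l + 1)) = a.1 l := a.2 l
    dsimp only
    rw [← h, ← app_map_apply]⟩
  map_zero' := by ext l; simp
  map_add' a b := by ext l; simp

/-- The map into the limit induced by the maps `F ⟶ [F_η / 𝔪_η ^ l F_η]_η`. -/
def toJetLimit (η : X) (B : X.Modules ⥤ AddCommGrpCat.{u + 1}) (F : X.Modules) :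
    B.obj F →+ jetLimit η B F where
  toFun a := ⟨fun l => B.map ((toJet η l).app F) a, fun l =>
    (map_map_apply B _ _ _).trans (congrArg (fun f => B.map f a) (toJet_trans η l F))⟩
  map_zero' := by ext l; exact map_zero _
  map_add' a b := by ext l; exact map_add _ _ _

/-- The functor `F ↦ ∏_η lim_l B_η ([F_η / 𝔪_η ^ l F_η]_η)`, where `η` runs over the points of
`X` which are the first member of a flag in `S`. -/
def adeleStep {n : ℕ} (S : Set (Fin (n + 1) → X)) (B : X → X.Modules ⥤ AddCommGrpCat.{u + 1}) :
    X.Modules ⥤ AddCommGrpCat.{u + 1} where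
  obj F := AddCommGrpCat.of (∀ η : {η : X // (residual S η).Nonempty}, jetLimit η.1 (B η) F)
  map f := AddCommGrpCat.ofHom
    (AddMonoidHom.mk' (fun a η => jetLimitMap η.1 (B η) f (a η))
      fun a b => funext fun η => map_add (jetLimitMap η.1 (B η) f) (a η) (b η))
  map_id F := by
    ext a η l
    change (B η.1).map ((jet η.1 l).map (𝟙 F)) ((a η).1 l) = (a η).1 l
    rw [(jet η.1 l).map_id, (B η.1).map_id]
    rfl
  map_comp {F G K} f g := by
    ext a η l
    change (B η.1).map ((jet η.1 l).map (f ≫ g)) ((a η).1 l) =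
      (B η.1).map ((jet η.1 l).map g) ((B η.1).map ((jet η.1 l).map f) ((a η).1 l))
    rw [map_map_apply, Functor.map_comp]

/-- The group of adeles `A(S, F)` of a sheaf `F` for a set `S` of flags with `n` members:
* for `n = 0` (no condition), the group of global sections of `F`;
* for coherent `F` and `n > 0`, `A(S, F) = ∏_η lim_l A(_η S, [F_η / 𝔪_η ^ l F_η]_η)`, where
  `_η S` is the set of the flags `(η_1, …, η_{n - 1})` with `(η, η_1, …, η_{n - 1}) ∈ S`;
* for `n > 0` the functor `A(S, ·)` is extended from coherent to quasi-coherent sheaves by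
  filtered colimits.
For `n = 1` and `F` coherent this gives `∏_{η ∈ S} lim_l F_η / 𝔪_η ^ l F_η`, because the global
sections of `[F_η / 𝔪_η ^ l F_η]_η` are `F_η / 𝔪_η ^ l F_η`. -/
def adeles : (n : ℕ) → Set (Fin n → X) → X.Modules ⥤ AddCommGrpCat.{u + 1}
  | 0, _ => globalSections X
  | n + 1, S => cohExtend ((isCoherent X).ι ⋙ adeleStep S fun η => adeles n (residual S η))

/-- The extension to all sheaves of a transformation out of an adele functor which is defined on
coherent sheaves. -/
def adelesDesc : (n : ℕ) → (S : Set (Fin n → X)) → {H : X.Modules ⥤ AddCommGrpCat.{u + 1}} →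
    ((isCoherent X).ι ⋙ adeles n S ⟶ (isCoherent X).ι ⋙ H) → (adeles n S ⟶ H)
  | 0, _, _, α => globalSectionsDesc α
  | _ + 1, _, _, α => cohExtendDesc (cohExtendUnit _ ≫ α)

/-! ### Boundary maps -/

/-- Ways of choosing `m` out of `n` members of a flag, in order. -/
inductive Face : ℕ → ℕ → Type
  | nil : Face 0 0
  | keep {m n : ℕ} (σ : Face m n) : Face (m + 1) (n + 1)
  | skip {m n : ℕ} (σ : Face m n) : Face m (n + 1)

/-- The subflag of the chosen members of a flag. -/
def Face.restrict {α : Type*} : {m n : ℕ} → Face m n → (Fin n → α) → (Fin m → α)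
  | _, _, .nil, _ => Fin.elim0
  | _, _, .keep σ, Δ => Fin.cons (Δ 0) (σ.restrict (Fin.tail Δ))
  | _, _, .skip σ, Δ => σ.restrict (Fin.tail Δ)

/-- Componentwise map between products of limits, projecting away the unneeded factors. -/
def adeleStepMap {m n : ℕ} {T : Set (Fin (m + 1) → X)} {S : Set (Fin (n + 1) → X)}
    {B B' : X → X.Modules ⥤ AddCommGrpCat.{u + 1}}
    (h : ∀ η, (residual S η).Nonempty → (residual T η).Nonempty) (β : ∀ η, B η ⟶ B' η) :
    adeleStep T B ⟶ adeleStep S B' where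
  app F := AddCommGrpCat.ofHom
    (AddMonoidHom.mk' (fun a η => jetLimitApp η.1 (β η) F (a ⟨η.1, h η.1 η.2⟩))
      fun a b => funext fun η =>
        map_add (jetLimitApp η.1 (β η) F) (a ⟨η.1, h η.1 η.2⟩) (b ⟨η.1, h η.1 η.2⟩))
  naturality F G f := by
    ext a
    refine funext fun η => Subtype.ext (funext fun l => ?_)
    exact app_map_apply (β η.1) ((jet η.1 l).map f) ((a ⟨η.1, h η.1 η.2⟩).1 l)

/-- For transformations `β_η : B ⟶ B'_η`, the map
`B F ⟶ ∏_η lim_l B'_η ([F_η / 𝔪_η ^ l F_η]_η)` induced by `F ⟶ [F_η / 𝔪_η ^ l F_η]_η`. -/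
def toAdeleStep {n : ℕ} (S : Set (Fin (n + 1) → X)) {B : X.Modules ⥤ AddCommGrpCat.{u + 1}}
    {B' : X → X.Modules ⥤ AddCommGrpCat.{u + 1}} (β : ∀ η, B ⟶ B' η) :
    B ⟶ adeleStep S B' where
  app F := AddCommGrpCat.ofHom
    (AddMonoidHom.mk' (fun a η => jetLimitApp η.1 (β η) F (toJetLimit η.1 B F a))
      fun a b => funext fun η => by rw [map_add, map_add]; rfl)
  naturality F G f := by
    ext a
    refine funext fun η => Subtype.ext (funext fun l => ?_)
    change (β η.1).app _ (B.map ((toJet η.1 l).app G) (B.map f a)) =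
      (B' η.1).map ((jet η.1 l).map f) ((β η.1).app _ (B.map ((toJet η.1 l).app F) a))
    rw [map_map_apply, ← app_map_apply, map_map_apply, ← (toJet η.1 l).naturality]
    rfl

/-- The boundary map `A(T, F) ⟶ A(S, F)` which exists when the subflag of chosen members of every
flag in `S` lies in `T`. It is the composite of the boundary maps omitting one member of a flag:
* if the first member is kept, it is induced, in each factor `η` and for each `l`, by the boundary
  map `A(_η T, [F_η / 𝔪_η ^ l F_η]_η) ⟶ A(_η S, [F_η / 𝔪_η ^ l F_η]_η)`;
* if the first member is omitted, it is induced by the maps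
  `A(T, F) ⟶ A(T, [F_η / 𝔪_η ^ l F_η]_η) ⟶ A(_η S, [F_η / 𝔪_η ^ l F_η]_η)`. -/
def boundary : {m n : ℕ} → (σ : Face m n) → (T : Set (Fin m → X)) → (S : Set (Fin n → X)) →
    (∀ Δ ∈ S, σ.restrict Δ ∈ T) → (adeles m T ⟶ adeles n S)
  | _, _, .nil, _, _, _ => 𝟙 (globalSections X)
  | _, _, .keep σ, T, S, h =>
    have h' (η : X) : ∀ Δ ∈ residual S η, σ.restrict Δ ∈ residual T η := fun Δ hΔ => by
      simpa [Face.restrict, residual] using h _ hΔ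
    cohExtendDesc (Functor.whiskerLeft (isCoherent X).ι
      (adeleStepMap (fun η ⟨Δ, hΔ⟩ => ⟨_, h' η Δ hΔ⟩)
        fun η => boundary σ (residual T η) (residual S η) (h' η)) ≫ cohExtendUnit _)
  | m, _, .skip σ, T, S, h =>
    have h' (η : X) : ∀ Δ ∈ residual S η, σ.restrict Δ ∈ T := fun Δ hΔ => by
      simpa [Face.restrict, residual] using h _ hΔ
    adelesDesc m T (Functor.whiskerLeft (isCoherent X).ι
      (toAdeleStep S fun η => boundary σ T (residual S η) (h' η)) ≫ cohExtendUnit _)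

/-! ### Adeles for sets of codimensions -/

/-- The flags `(η_0, …, η_p)` of points of `X`, where `η_j` is a proper specialization of `η_i` for
`i < j`, such that the closure of `η_j` has codimension `l_j`, for a list `l = [l_0, …, l_p]`.
The codimension of the closure of a point `η` is the supremum of the lengths of the chains
of proper generizations of `η`. -/
def flagsOfCodim (X : Scheme.{u}) (l : List ℕ) : Set (Fin l.length → X) :=
  {Δ | (∀ i j, i < j → Δ i ⤳ Δ j ∧ Δ j ≠ Δ i) ∧ ∀ j, Order.coheight (Δ j) = (l.get j : ℕ∞)}

/-- The members of a sublist, as a choice of members of a list. -/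
def Face.ofSublist : (l l' : List ℕ) → l.Sublist l' → Face l.length l'.length
  | [], [], _ => .nil
  | [], _ :: l', _ => .skip (Face.ofSublist [] l' (List.nil_sublist l'))
  | _ :: _, [], h => absurd h (by simp)
  | a :: l, b :: l', h =>
    if hab : a = b then .keep (Face.ofSublist l l' (by subst hab; simpa using h))
    else .skip (Face.ofSublist (a :: l) l' (by
      cases h with
      | cons _ h => exact h
      | cons_cons _ h => exact absurd rfl hab))

/-- The subflag of a flag is obtained by composing with a strictly monotone map of indices which
matches the entries of the lists. -/
lemma Face.exists_index : (l l' : List ℕ) → (h : l.Sublist l') →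
    ∃ f : Fin l.length → Fin l'.length, StrictMono f ∧ (∀ j, l.get j = l'.get (f j)) ∧
      ∀ {α : Type u} (Δ : Fin l'.length → α), (Face.ofSublist l l' h).restrict Δ = Δ ∘ f
  | [], [], _ => ⟨Fin.elim0, fun i => i.elim0, fun i => i.elim0, fun _ => funext fun i => i.elim0⟩
  | [], _ :: l', _ => ⟨Fin.elim0, fun i => i.elim0, fun i => i.elim0,
      fun _ => funext fun i => i.elim0⟩
  | _ :: _, [], h => absurd h (by simp)
  | a :: l, b :: l', h => by
    by_cases hab : a = b
    · obtain ⟨f, hf, hl, hr⟩ := Face.exists_index l l' (by subst hab; simpa using h)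
      refine ⟨Fin.cons 0 fun i => (f i).succ, ?_, ?_, ?_⟩
      · intro i j
        refine Fin.cases (fun hj => ?_) (fun i hij => ?_) i
        · obtain ⟨j, rfl⟩ := Fin.exists_succ_eq.2 hj.ne'
          exact Fin.succ_pos _
        · obtain ⟨j, rfl⟩ := Fin.exists_succ_eq.2 (Fin.ne_zero_of_lt hij)
          exact Fin.succ_lt_succ_iff.2 (hf (Fin.succ_lt_succ_iff.1 hij))
      · intro j
        refine Fin.cases ?_ (fun j => ?_) j
        · exact hab
        · exact hl j
      · intro α Δ
        rw [Face.ofSublist, dif_pos hab, Face.restrict, hr]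
        funext j
        refine Fin.cases rfl (fun j => rfl) j
    · obtain ⟨f, hf, hl, hr⟩ := Face.exists_index (a :: l) l' (by
        cases h with
        | cons _ h => exact h
        | cons_cons _ h => exact absurd rfl hab)
      refine ⟨fun i => (f i).succ, fun i j hij => Fin.succ_lt_succ_iff.2 (hf hij), hl, ?_⟩
      · intro α Δ
        rw [Face.ofSublist, dif_neg hab, Face.restrict, hr]
        rfl

lemma restrict_mem_flagsOfCodim {l l' : List ℕ} (h : l.Sublist l') :
    ∀ Δ ∈ flagsOfCodim X l', (Face.ofSublist l l' h).restrict Δ ∈ flagsOfCodim X l := by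
  rintro Δ ⟨h1, h2⟩
  obtain ⟨f, hf, hl, hr⟩ := Face.exists_index l l' h
  rw [hr]
  exact ⟨fun i j hij => h1 _ _ (hf hij), fun j => by rw [hl]; exact h2 _⟩

/-- The elements of a finite set of natural numbers in increasing order. -/
def increasing (I : Finset ℕ) : List ℕ := I.sort (· ≤ ·)

lemma increasing_sublist {I J : Finset ℕ} (h : I ⊆ J) : (increasing I).Sublist (increasing J) := by
  refine List.sublist_of_subperm_of_pairwise (r := (· ≤ ·)) ?_ (I.pairwise_sort _)
    (J.pairwise_sort _)
  exact (I.sort_nodup _).subperm fun x hx =>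
    (Finset.mem_sort _).2 (h ((Finset.mem_sort _).1 hx))

/-- The adelic group functor `F ↦ A_X(I, F)` of a finite set `I = {i_0 < … < i_p}` of
codimensions: the adeles for the set of flags `(η_0, …, η_p)` with
`codim (closure of η_j) = i_j`. In particular `A_X(∅, F) = F(X)`. -/
def adelicGroup (X : Scheme.{u}) (I : Finset ℕ) : X.Modules ⥤ AddCommGrpCat.{u + 1} :=
  adeles (increasing I).length (flagsOfCodim X (increasing I))

/-- The canonical map `φ_{IJ} : A_X(I, F) ⟶ A_X(J, F)` for `I ⊆ J`, natural in `F`. -/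
def adelicMap (X : Scheme.{u}) {I J : Finset ℕ} (h : I ⊆ J) : adelicGroup X I ⟶ adelicGroup X J :=
  boundary (Face.ofSublist _ _ (increasing_sublist h)) _ _ (restrict_mem_flagsOfCodim _)

end BeilinsonAdeles

end

noncomputable section

namespace BeilinsonAdeles

variable {X : Scheme.{u}}

/-! ### Sections of sheaves of modules -/

/-! Of flatness only torsion-freeness survives. A regular local ring of dimension at most 2 is a
domain, so `X` is integral, and a flat quasi-coherent sheaf on it has injective restriction maps to
nonempty opens (`IsTf`). This property passes to subsheaves, whereas flatness does not.

Every adele functor is determined by coherent subsheaves: an element comes from a coherent subsheaf,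
and a vanishing is already visible in one. Hence injectivity of a boundary map need only be checked
on coherent subsheaves (`injective_of_coherent`), where adeles are honest products of limits and
vanishing can be read in each component. By the Artin–Rees lemma the functors also preserve
injections (`adeles_map_injective`).

The boundary maps are then treated recursively along the flag.

If the first member is kept, the map is componentwise, and it suffices that the remaining boundary
map is injective on jets and that each first member still begins a flag of the larger type
(`boundary_keep_injective`).

If the generic point `ξ` is inserted, its maximal ideal is zero, so a torsion-free sheaf embeds in
its first jet at `ξ`. Left exactness reduces to the remaining map on that jet, which is torsion-free
again (`boundary_skip_injective_of_jet`).

If a point is inserted into a global section, vanishing of all jets at the point gives vanishing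
near it by Krull's intersection theorem, hence vanishing globally (`boundary_sections_injective`).
The same argument on jets along a curve inserts a closed point of the curve.

The substantial case inserts curves before closed points, from codimensions {2} to {1, 2}. Write
`𝔪_x = (s, t)`; then `t` is prime and defines a curve `η` through `x`. If a section of `G` vanishes
to order `l` along `η`, then `c g = t^l g'` in `G_x` with `t` not dividing `c`. Embedding `G_x` in a
free module, `t^l` divides all coordinates of `g`, and Artin–Rees puts `g` into `𝔪_x^k G_x` for `l`
large, uniformly in the section. Thus the jets at `x` of the images of `G` in its jets along `η`
detect the `k`-jets of `G` at `x` (`IsCurveThrough.jet_eq_zero`).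

The geometry consumed by this is collected in `IsSurface`. That every curve contains a point of
codimension 2 follows because all closed points of an integral scheme of finite type over a field
have the same codimension. -/

/-- Restriction of sections of a sheaf of modules. -/
def secRes (F : X.Modules) {U V : X.Opens} (h : V ≤ U) : Γ(F, U) →+ Γ(F, V) :=
  (F.presheaf.map (homOfLE h).op).hom

/-- Restriction of functions. -/
def fnRes {U V : X.Opens} (h : V ≤ U) : Γ(X, U) →+* Γ(X, V) :=
  (X.presheaf.map (homOfLE h).op).hom

section Res

variable {F G : X.Modules} {U V W : X.Opens}

lemma secRes_secRes (h : V ≤ U) (h' : W ≤ V) (s : Γ(F, U)) :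
    secRes F h' (secRes F h s) = secRes F (h'.trans h) s := by
  unfold secRes
  rw [← ConcreteCategory.comp_apply, ← F.presheaf.map_comp]
  rfl

@[simp] lemma secRes_self (h : U ≤ U) (s : Γ(F, U)) : secRes F h s = s :=
  congrArg (fun g => g s) (F.presheaf.map_id (op U))

lemma fnRes_fnRes (h : V ≤ U) (h' : W ≤ V) (s : Γ(X, U)) :
    fnRes h' (fnRes h s) = fnRes (h'.trans h) s := by
  unfold fnRes
  rw [← RingHom.comp_apply, ← CommRingCat.hom_comp, ← X.presheaf.map_comp]
  rfl

@[simp] lemma fnRes_self (h : U ≤ U) (s : Γ(X, U)) : fnRes h s = s :=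
  congrArg (fun g => g s) (X.presheaf.map_id (op U))

lemma secRes_smul (h : V ≤ U) (a : Γ(X, U)) (s : Γ(F, U)) :
    secRes F h (a • s) = fnRes h a • secRes F h s :=
  F.map_smul (homOfLE h) a s

lemma app_secRes (g : F ⟶ G) (h : V ≤ U) (s : Γ(F, U)) :
    g.app V (secRes F h s) = secRes G h (g.app U s) :=
  congrArg (fun k => k s) (g.mapPresheaf.naturality (homOfLE h).op)

lemma secRes_injective_of_eq (h : V ≤ U) (e : V = U) : Function.Bijective (secRes F h) := by
  subst e
  constructor
  · intro a b hab; simpa using hab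
  · intro a; exact ⟨a, by simp⟩

/-- Sections of a sheaf of modules which agree locally are equal. -/
lemma sec_ext {s t : Γ(F, U)}
    (h : ∀ x ∈ U, ∃ (V : X.Opens) (hV : V ≤ U), x ∈ V ∧ secRes F hV s = secRes F hV t) : s = t := by
  refine TopCat.Presheaf.IsSheaf.section_ext F.isSheaf ?_
  intro x hx
  obtain ⟨V, hV, hxV, e⟩ := h x hx
  exact ⟨V, hV, hxV, e⟩

/-- The morphism on sections as an additive map. -/
lemma app_comp_apply {K : X.Modules} (f : F ⟶ G) (g : G ⟶ K) (s : Γ(F, U)) :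
    (f ≫ g).app U s = g.app U (f.app U s) := rfl

lemma hom_ext_sec {f g : F ⟶ G} (h : ∀ U (s : Γ(F, U)), f.app U s = g.app U s) : f = g := by
  refine Scheme.Modules.hom_ext _ _ fun U => ?_
  ext s
  exact h U s

end Res

/-! ### Quasi-coherence expressed by localization of sections -/

/-- A sheaf of modules is localizing if on every affine open its sections over a basic open are
obtained by localization. -/
structure IsLoc (F : X.Modules) : Prop where
  eq_zero : ∀ {U : X.Opens}, IsAffineOpen U → ∀ (f : Γ(X, U)) (s : Γ(F, U)),
    secRes F (X.basicOpen_le f) s = 0 → ∃ n : ℕ, f ^ n • s = 0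
  extend : ∀ {U : X.Opens}, IsAffineOpen U → ∀ (f : Γ(X, U)) (t : Γ(F, X.basicOpen f)),
    ∃ (n : ℕ) (s : Γ(F, U)), secRes F (X.basicOpen_le f) s = fnRes (X.basicOpen_le f) f ^ n • t

lemma fromSpec_image_le {U : X.Opens} (hU : IsAffineOpen U) (W : (Spec Γ(X, U)).Opens) :
    hU.fromSpec ''ᵁ W ≤ U := by
  have : hU.fromSpec ''ᵁ ⊤ = U := by simp
  exact (Scheme.Hom.image_mono _ le_top).trans this.le

lemma restrict_fromSpec_smul (F : X.Modules) {U : X.Opens} (hU : IsAffineOpen U)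
    (W : (Spec Γ(X, U)).Opens) (g : Γ(X, U)) (s : Γ(F.restrict hU.fromSpec, W)) :
    (show Γ(F, hU.fromSpec ''ᵁ W) from g • s) =
      fnRes (fromSpec_image_le hU W) g • (show Γ(F, hU.fromSpec ''ᵁ W) from s) := by
  rw [Scheme.Modules.smul_Spec_def]
  refine (Scheme.Modules.smul_restrictAppIso_hom_apply hU.fromSpec F W _ s).trans ?_
  refine congrArg (fun r : Γ(X, hU.fromSpec ''ᵁ W) => r • (show Γ(F, hU.fromSpec ''ᵁ W) from s)) ?_
  have : (Scheme.ΓSpecIso Γ(X, U)).inv ≫ (Spec Γ(X, U)).presheaf.map W.leTop.op ≫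
      (hU.fromSpec.appIso W).inv = X.presheaf.map (homOfLE (fromSpec_image_le hU W)).op := by
    rw [← Category.assoc, Iso.comp_inv_eq, Scheme.Hom.appIso_hom, hU.fromSpec.naturality_assoc,
      hU.fromSpec_app_self]
    simp only [Category.assoc, ← Functor.map_comp, ← op_comp]
    rfl
  exact congrArg (fun k => k.hom g) this


/-- The bijections `a` and `b` are there because the opens of `X` and the images of opens of `Spec
Γ(X, U)` agree only up to a propositional equality, so localization has to be transported between
two copies of the sections. -/
lemma isLocalizedModule_powers_iff {R R' M M' N N' : Type*} [CommRing R] [CommRing R']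
    [AddCommGroup M] [AddCommGroup M'] [AddCommGroup N] [AddCommGroup N'] [Module R M] [Module R M']
    [Module R N] [Module R' N'] (σ : R →+* R') (φ : M →ₗ[R] M') (ρ : N →+ N') (a : M →+ N)
    (b : M' →+ N') (ha : Function.Bijective a) (hb : Function.Bijective b)
    (has : ∀ (g : R) x, a (g • x) = g • a x) (hbs : ∀ (g : R) x, b (g • x) = σ g • b x)
    (hab : ∀ x, b (φ x) = ρ (a x)) (f : R) (hf : IsUnit (algebraMap R (Module.End R M') f)) :
    IsLocalizedModule (.powers f) φ ↔ (∀ s, ρ s = 0 → ∃ n : ℕ, f ^ n • s = 0) ∧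
      ∀ t, ∃ (n : ℕ) (s : N), ρ s = σ f ^ n • t := by
  rw [isLocalizedModule_iff]
  constructor
  · rintro ⟨_, h2, h3⟩
    constructor
    · intro s hs
      obtain ⟨s, rfl⟩ := ha.2 s
      rw [← hab] at hs
      have : φ s = φ 0 := by rw [map_zero]; exact hb.1 (hs.trans (map_zero b).symm)
      obtain ⟨⟨_, n, rfl⟩, hc⟩ := h3 this
      refine ⟨n, ?_⟩
      rw [← has]
      exact (congrArg a (hc.trans (smul_zero _))).trans (map_zero _)
    · intro t
      obtain ⟨t, rfl⟩ := hb.2 t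
      obtain ⟨⟨s, ⟨_, n, rfl⟩⟩, hs⟩ := h2 t
      refine ⟨n, a s, ?_⟩
      rw [← hab, ← map_pow, ← hbs]
      exact (congrArg b hs).symm
  · rintro ⟨h1, h2⟩
    refine ⟨?_, ?_, ?_⟩
    · rintro ⟨_, n, rfl⟩
      rw [map_pow]
      exact hf.pow n
    · intro t
      obtain ⟨n, s, hs⟩ := h2 (b t)
      obtain ⟨s, rfl⟩ := ha.2 s
      refine ⟨⟨s, ⟨_, n, rfl⟩⟩, hb.1 ?_⟩
      rw [← hab, ← map_pow, ← hbs] at hs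
      exact hs.symm
    · intro x y hxy
      obtain ⟨n, hn⟩ := h1 (a x - a y) (by
        rw [map_sub, ← hab, ← hab, hxy, sub_self])
      refine ⟨⟨_, n, rfl⟩, ha.1 ?_⟩
      rw [smul_sub, sub_eq_zero, ← has, ← has] at hn
      exact hn

/-- A section of the restriction of `F` along an open immersion, as a section of `F`. -/
def restrictSec (F : X.Modules) {Y : Scheme.{u}} (j : Y ⟶ X) [IsOpenImmersion j] (W : Y.Opens)
    {V : X.Opens} (h : V ≤ j ''ᵁ W) : Γ(F.restrict j, W) →+ Γ(F, V) :=
  secRes F h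

/-- The image of `⊤` under `fromSpec` is `U` and that of a basic open is the basic open of the same
function, so the criterion on the spectrum becomes one on opens of `X`. -/
lemma isLocalizing_restrict_iff (F : X.Modules) {U : X.Opens} (hU : IsAffineOpen U) :
    IsLocalizing (modulesSpecToSheaf.obj (F.restrict hU.fromSpec)) ↔
      ∀ f : Γ(X, U), (∀ s : Γ(F, U), secRes F (X.basicOpen_le f) s = 0 → ∃ n : ℕ, f ^ n • s = 0) ∧
        (∀ t : Γ(F, X.basicOpen f), ∃ (n : ℕ) (s : Γ(F, U)),
          secRes F (X.basicOpen_le f) s = fnRes (X.basicOpen_le f) f ^ n • t) := by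
  have e1 : hU.fromSpec ''ᵁ ⊤ = U := by simp
  refine forall_congr' fun f => ?_
  let D : (Spec Γ(X, U)).Opens := PrimeSpectrum.basicOpen f
  have e2 : hU.fromSpec ''ᵁ D = X.basicOpen f := by
    simpa using hU.fromSpec_image_basicOpen f
  refine isLocalizedModule_powers_iff (R := Γ(X, U)) (R' := Γ(X, X.basicOpen f))
    (M := Γ(F.restrict hU.fromSpec, ⊤)) (M' := Γ(F.restrict hU.fromSpec, D))
    (fnRes (X.basicOpen_le f)) _ (secRes F (X.basicOpen_le f))
    (restrictSec F hU.fromSpec ⊤ e1.ge) (restrictSec F hU.fromSpec D e2.ge)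
    (secRes_injective_of_eq e1.ge e1.symm)
    (secRes_injective_of_eq e2.ge e2.symm) (fun g x => ?_) (fun g x => ?_) (fun x => ?_) f
    (Scheme.Modules.isUnit_algebraMap_end_of_le_basicOpen f le_rfl)
  · refine (congrArg (secRes F e1.ge) (restrict_fromSpec_smul F hU ⊤ g x)).trans ?_
    refine (secRes_smul _ _ _).trans ?_
    rw [fnRes_fnRes, fnRes_self]
    rfl
  · refine (congrArg (secRes F e2.ge) (restrict_fromSpec_smul F hU D g x)).trans ?_
    refine (secRes_smul _ _ _).trans ?_
    rw [fnRes_fnRes]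
    rfl
  · refine (secRes_secRes (F := F) (Scheme.Hom.image_mono _ le_top) e2.ge x).trans ?_
    exact (secRes_secRes (F := F) _ _ _).symm

lemma IsLoc.isLocalizing {F : X.Modules} (h : IsLoc F) {U : X.Opens} (hU : IsAffineOpen U) :
    IsLocalizing (modulesSpecToSheaf.obj (F.restrict hU.fromSpec)) :=
  (isLocalizing_restrict_iff F hU).2 fun f => ⟨h.eq_zero hU f, h.extend hU f⟩

lemma IsLoc.of_isQuasicoherent (F : X.Modules) [F.IsQuasicoherent] : IsLoc F := by
  have key {U : X.Opens} (hU : IsAffineOpen U) := (isLocalizing_restrict_iff F hU).1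
    ((isIso_fromTildeΓ_iff_isLocalizing _).1 inferInstance)
  exact ⟨fun hU f => (key hU f).1, fun hU f => (key hU f).2⟩

/-- Transport of presentations along isomorphisms of sheaves of modules on a scheme. -/
def presentationOfIso {M N : X.Modules} (e : M ≅ N)
    (P : SheafOfModules.Presentation.{u} (R := X.ringCatSheaf) M) :
    SheafOfModules.Presentation.{u} (R := X.ringCatSheaf) N :=
  let M' : SheafOfModules.{u} X.ringCatSheaf := M
  let N' : SheafOfModules.{u} X.ringCatSheaf := N
  let e' : M' ≅ N' := ⟨e.hom, e.inv, e.hom_inv_id, e.inv_hom_id⟩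
  SheafOfModules.Presentation.ofIsIso (M := M') (N := N') e'.hom P

/-- Quasi-coherence is defined through the slice `over U`, presentations live on the scheme `U`; the
equivalence between the two preserves colimits and the unit, so it carries presentations across. -/
lemma isQuasicoherent_over_of_presentation (F : X.Modules) (U : X.Opens)
    (P : SheafOfModules.Presentation.{u} (R := U.toScheme.ringCatSheaf) (F.restrict U.ι)) :
    SheafOfModules.IsQuasicoherent.{u} (SheafOfModules.over (R := X.ringCatSheaf) F U) := by
  let E : SheafOfModules.{u} (X.ringCatSheaf.over U) ≌
    SheafOfModules.{u} (U.toScheme.ringCatSheaf) := Scheme.Modules.overEquiv U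
  let a : E.inverse.obj (SheafOfModules.unit _) ≅ SheafOfModules.unit _ :=
    TopologicalSpace.Opens.sheafOfModulesEquivOverInverseUnit U X.ringCatSheaf
  have : PreservesColimitsOfSize.{u, u} E.inverse := inferInstance
  let P4 := P.map E.inverse a.symm
  let c : E.functor.obj (SheafOfModules.over (R := X.ringCatSheaf) F U) ≅ F.restrict U.ι :=
    (Scheme.Modules.overFunctorEquiv U).app F
  let e' : E.inverse.obj (F.restrict U.ι) ≅ SheafOfModules.over (R := X.ringCatSheaf) F U :=
    E.inverse.mapIso c.symm ≪≫ (E.unitIso.app _).symm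
  exact (P4.ofIsIso e'.hom).isQuasicoherent

lemma IsLoc.isQuasicoherent {F : X.Modules} (h : IsLoc F) : F.IsQuasicoherent := by
  have (U : X.affineOpens) : SheafOfModules.IsQuasicoherent.{u}
      (SheafOfModules.over (R := X.ringCatSheaf) F U.1) := by
    have hU : IsAffineOpen U.1 := U.2
    have := (isIso_fromTildeΓ_iff_isLocalizing _).2 (h.isLocalizing hU)
    let M := ((modulesSpecToSheaf.obj (F.restrict hU.fromSpec)).presheaf.obj (op ⊤))
    -- All elements of `M` serve as generators and all relations among them as relations.
    let P : (tilde M).Presentation := presentationTilde M Set.univ (by simp) _ (Submodule.span_eq _)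
    let P1 := presentationOfIso (asIso (F.restrict hU.fromSpec).fromTildeΓ) P
    let P2 := Scheme.Modules.presentationRestrict hU.isoSpec.hom P1
    let e : (F.restrict hU.fromSpec).restrict hU.isoSpec.hom ≅ F.restrict U.1.ι :=
      ((Scheme.Modules.restrictFunctorComp _ _).app F).symm ≪≫
        (Scheme.Modules.restrictFunctorCongr (by simp)).app F
    exact isQuasicoherent_over_of_presentation F U.1 (presentationOfIso e P2)
  refine SheafOfModules.IsQuasicoherent.of_coversTop (R := X.ringCatSheaf) F
    (fun U : X.affineOpens => U.1) ?_
  rw [Opens.coversTop_iff]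
  exact iSup_affineOpens_eq_top X

/-! ### Images -/

variable {K F : X.Modules}

/-- The presheaf of submodules of sections of `F` which are locally in the image of `g`. -/
def imageSub (g : K ⟶ F) : PresheafOfModules.Submodule F.val where
  obj U :=
    { carrier := {s | ∀ x ∈ U.unop, ∃ (V : X.Opens) (h : V ≤ U.unop), x ∈ V ∧
        ∃ k : Γ(K, V), g.app V k = secRes F h s}
      zero_mem' := fun x hx => ⟨U.unop, le_rfl, hx, 0, by
        exact (map_zero (g.app U.unop).hom).trans (map_zero (secRes F le_rfl)).symm⟩
      add_mem' := by
        intro a b ha hb x hx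
        obtain ⟨V, hV, hxV, k, hk⟩ := ha x hx
        obtain ⟨W, hW, hxW, l, hl⟩ := hb x hx
        refine ⟨V ⊓ W, inf_le_left.trans hV, ⟨hxV, hxW⟩,
          secRes K inf_le_left k + secRes K inf_le_right l, ?_⟩
        refine (map_add (g.app (V ⊓ W)).hom _ _).trans ?_
        refine (congrArg₂ (· + ·) ((app_secRes g _ _).trans (congrArg _ hk))
          ((app_secRes g _ _).trans (congrArg _ hl))).trans ?_
        refine (congrArg₂ (· + ·) (secRes_secRes (F := F) _ _ a) (secRes_secRes (F := F) _ _ b)).trans ?_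
        exact (map_add (secRes F _) a b).symm
      smul_mem' := by
        intro c a ha x hx
        obtain ⟨V, hV, hxV, k, hk⟩ := ha x hx
        refine ⟨V, hV, hxV, fnRes hV c • k, ?_⟩
        refine (g.app_smul _ _).trans ?_
        rw [hk]
        exact (secRes_smul (F := F) hV c a).symm }
  map {U V} f s hs x hx := by
    obtain ⟨W, hW, hxW, k, hk⟩ := hs x (f.unop.le hx)
    refine ⟨W ⊓ V.unop, inf_le_right, ⟨hxW, hx⟩, secRes K inf_le_left k, ?_⟩
    refine ((app_secRes g _ _).trans (congrArg _ hk)).trans ?_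
    refine (secRes_secRes (F := F) _ _ s).trans ?_
    exact (secRes_secRes (F := F) f.unop.le inf_le_right s).symm

/-- Being locally in the image is a local condition, so gluing in `F` stays inside. -/
lemma imageSub_isSheaf (g : K ⟶ F) : TopCat.Presheaf.IsSheaf (imageSub g).toPresheafOfModules.presheaf := by
  rw [TopCat.Presheaf.isSheaf_iff_isSheaf_comp (forget Ab)]
  apply TopCat.Presheaf.isSheaf_of_isSheafUniqueGluing_types
  intro ι U sf hsf
  obtain ⟨s, hs, hs'⟩ := TopCat.Sheaf.existsUnique_gluing ⟨F.presheaf, F.isSheaf⟩ U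
    (fun i => (sf i).1) (fun i j => congrArg Subtype.val (hsf i j))
  refine ⟨⟨s, ?_⟩, ?_, ?_⟩
  · intro x hx
    obtain ⟨i, hi⟩ := TopologicalSpace.Opens.mem_iSup.1 hx
    obtain ⟨V, hV, hxV, k, hk⟩ := (sf i).2 x hi
    refine ⟨V, hV.trans (le_iSup U i), hxV, k, hk.trans ?_⟩
    refine (congrArg (secRes F hV) (hs i).symm).trans ?_
    exact secRes_secRes (F := F) (le_iSup U i) hV s
  · intro i
    exact Subtype.ext (hs i)
  · intro t ht
    exact Subtype.ext (hs' _ fun i => congrArg Subtype.val (ht i))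

/-- The image of a morphism of sheaves of modules. -/
def imageSheaf (g : K ⟶ F) : X.Modules := ⟨(imageSub g).toPresheafOfModules, imageSub_isSheaf g⟩

/-- The inclusion of the image. -/
def imageι (g : K ⟶ F) : imageSheaf g ⟶ F := ⟨(imageSub g).ι⟩

lemma imageι_injective (g : K ⟶ F) (U : X.Opens) : Function.Injective ((imageι g).app U) :=
  fun _ _ h => Subtype.ext h

/-- The restriction of a morphism to its image. -/
def toImage (g : K ⟶ F) : K ⟶ imageSheaf g :=
  ⟨PresheafOfModules.homMk
    { app := fun U => AddCommGrpCat.ofHom (AddMonoidHom.mk'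
        (fun k => (⟨g.app U.unop k, fun x hx => ⟨U.unop, le_rfl, hx, k,
          (secRes_self (F := F) le_rfl _).symm⟩⟩ : (imageSub g).obj U))
        fun a b => Subtype.ext (map_add (g.app U.unop).hom a b))
      naturality := fun U V f => by
        ext k
        exact Subtype.ext (app_secRes g f.unop.le k) }
    fun U r k => Subtype.ext (g.app_smul r k)⟩

lemma toImage_ι (g : K ⟶ F) : toImage g ≫ imageι g = g :=
  hom_ext_sec fun _ _ => rfl

lemma imageSheaf_locally (g : K ⟶ F) {U : X.Opens} (s : Γ(imageSheaf g, U)) :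
    ∀ x ∈ U, ∃ (V : X.Opens) (h : V ≤ U), x ∈ V ∧
        ∃ k : Γ(K, V), (toImage g).app V k = secRes _ h s := by
  intro x hx
  obtain ⟨V, hV, hxV, k, hk⟩ := s.2 x hx
  exact ⟨V, hV, hxV, k, Subtype.ext hk⟩

/-- The linear map on sections given by a morphism of sheaves of modules. -/
def appLinear {K F : X.Modules} (g : K ⟶ F) (U : X.Opens) : Γ(K, U) →ₗ[Γ(X, U)] Γ(F, U) where
  toFun := g.app U
  map_add' := map_add (g.app U).hom
  map_smul' := g.app_smul

/-- A section over an affine open which is locally in the image is in the image. -/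
lemma toImage_surjective (hF : IsLoc F) (hK : ∀ {U : X.Opens}, IsAffineOpen U →
    ∀ (f : Γ(X, U)) (t : Γ(K, X.basicOpen f)), ∃ (n : ℕ) (s : Γ(K, U)),
      secRes K (X.basicOpen_le f) s = fnRes (X.basicOpen_le f) f ^ n • t)
    (g : K ⟶ F) {U : X.Opens} (hU : IsAffineOpen U) :
    Function.Surjective ((toImage g).app U) := by
  intro s
  -- The functions that multiply `s` into the image form an ideal. Near each point a power of some
  -- `f` not vanishing there belongs to it, once the denominators of the local preimage are cleared;
  -- hence it is the unit ideal.
  let I : Ideal Γ(X, U) := (LinearMap.range (appLinear (toImage g) U)).colon {s}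
  have hI : I = ⊤ := by
    rw [← Ideal.span_eq I]
    refine hU.self_le_iSup_basicOpen_iff.1 fun x hx => ?_
    obtain ⟨V, hV, hxV, k, hk⟩ := imageSheaf_locally g s x hx
    obtain ⟨f, hfV, hxf⟩ := hU.exists_basicOpen_le ⟨x, hxV⟩ hx
    obtain ⟨n, k', hk'⟩ := hK hU f (secRes K hfV k)
    have e : secRes F (X.basicOpen_le f) (g.app U k' - f ^ n • (imageι g).app U s) = 0 := by
      rw [map_sub, sub_eq_zero, ← app_secRes, hk', secRes_smul, ← app_secRes, g.app_smul, map_pow]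
      congr 1
      refine Eq.trans (b := (imageι g).app _ ((toImage g).app _ (secRes K hfV k))) rfl ?_
      rw [app_secRes, hk, secRes_secRes]
    obtain ⟨m, hm⟩ := hF.eq_zero hU f _ e
    have hmem : f ^ (m + n) ∈ I := by
      rw [Submodule.mem_colon_singleton]
      refine ⟨f ^ m • k', imageι_injective g U ?_⟩
      change (imageι g).app U ((toImage g).app U (f ^ m • k')) = (imageι g).app U (f ^ (m + n) • s)
      rw [← app_comp_apply, toImage_ι, g.app_smul, (imageι g).app_smul, pow_add, mul_smul]
      rwa [smul_sub, sub_eq_zero] at hm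
    refine TopologicalSpace.Opens.mem_iSup.2 ⟨⟨f ^ (m + n), hmem⟩, ?_⟩
    rw [Scheme.mem_basicOpen _ _ _ hx] at hxf ⊢
    rw [map_pow]
    exact hxf.pow _
  have h1 : (1 : Γ(X, U)) ∈ I := hI ▸ trivial
  rw [Submodule.mem_colon_singleton, one_smul] at h1
  exact h1

/-- Vanishing is tested in `F` and extension of sections in `K`, so only the extension half of
localization is asked of `K`. -/
lemma isLoc_imageSheaf (hF : IsLoc F) (hK : ∀ {U : X.Opens}, IsAffineOpen U →
    ∀ (f : Γ(X, U)) (t : Γ(K, X.basicOpen f)), ∃ (n : ℕ) (s : Γ(K, U)),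
      secRes K (X.basicOpen_le f) s = fnRes (X.basicOpen_le f) f ^ n • t) (g : K ⟶ F) :
    IsLoc (imageSheaf g) := by
  refine ⟨fun {U} hU f s hs => ?_, fun {U} hU f t => ?_⟩
  · obtain ⟨n, hn⟩ := hF.eq_zero hU f ((imageι g).app U s) (by
      rw [← app_secRes, hs]; exact map_zero ((imageι g).app _).hom)
    refine ⟨n, imageι_injective g U ?_⟩
    rw [(imageι g).app_smul, hn]
    exact (map_zero ((imageι g).app U).hom).symm
  · obtain ⟨k, rfl⟩ := toImage_surjective hF hK g (hU.basicOpen f) t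
    obtain ⟨n, k', hk'⟩ := hK hU f k
    refine ⟨n, (toImage g).app U k', ?_⟩
    rw [← app_secRes, hk', (toImage g).app_smul]

lemma isCoherent_imageSheaf (hF : IsLoc F) (hK : ∀ {U : X.Opens}, IsAffineOpen U →
    ∀ (f : Γ(X, U)) (t : Γ(K, X.basicOpen f)), ∃ (n : ℕ) (s : Γ(K, U)),
      secRes K (X.basicOpen_le f) s = fnRes (X.basicOpen_le f) f ^ n • t)
    (hfin : ∀ U : X.Opens, IsAffineOpen U → Module.Finite Γ(X, U) Γ(K, U)) (g : K ⟶ F) :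
    isCoherent X (imageSheaf g) := by
  refine ⟨(isLoc_imageSheaf hF hK g).isQuasicoherent, fun U hU => ?_⟩
  have := hfin U hU
  exact Module.Finite.of_surjective (appLinear (toImage g) U) (toImage_surjective hF hK g hU)

lemma isLoc_of_isCoherent {G : X.Modules} (hG : isCoherent X G) : IsLoc G :=
  have := hG.1
  IsLoc.of_isQuasicoherent G

/-! ### Stalks -/

/-- The stalk of a sheaf of modules. -/
abbrev Stalk (F : X.Modules) (x : X) : Type u := ↑(TopCat.Presheaf.stalk F.presheaf x)

/-- The local ring of a scheme at a point. -/
abbrev LocRing (x : X) : Type u := ↑(X.presheaf.stalk x)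

/-- The germ of a section. -/
def secGerm (F : X.Modules) {U : X.Opens} {x : X} (hx : x ∈ U) : Γ(F, U) →+ Stalk F x :=
  (TopCat.Presheaf.germ F.presheaf U x hx).hom

/-- The germ of a function. -/
def fnGerm {U : X.Opens} {x : X} (hx : x ∈ U) : Γ(X, U) →+* LocRing x :=
  (X.presheaf.germ U x hx).hom

section Germ

variable {F G : X.Modules} {U V : X.Opens} {x : X}

lemma secGerm_secRes (h : V ≤ U) (hx : x ∈ V) (s : Γ(F, U)) :
    secGerm F hx (secRes F h s) = secGerm F (h hx) s :=
  TopCat.Presheaf.germ_res_apply F.presheaf (homOfLE h) x hx s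

lemma fnGerm_fnRes (h : V ≤ U) (hx : x ∈ V) (s : Γ(X, U)) :
    fnGerm hx (fnRes h s) = fnGerm (h hx) s :=
  TopCat.Presheaf.germ_res_apply X.presheaf (homOfLE h) x hx s

lemma exists_secGerm_eq (g : Stalk F x) :
    ∃ (U : X.Opens) (hx : x ∈ U) (s : Γ(F, U)), secGerm F hx s = g :=
  TopCat.Presheaf.exists_germ_eq F.presheaf g

lemma exists_fnGerm_eq (g : LocRing x) :
    ∃ (U : X.Opens) (hx : x ∈ U) (s : Γ(X, U)), fnGerm hx s = g :=
  TopCat.Presheaf.exists_germ_eq X.presheaf g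

lemma secRes_eq_of_secGerm_eq (hU : x ∈ U) (hV : x ∈ V) (s : Γ(F, U)) (t : Γ(F, V))
    (h : secGerm F hU s = secGerm F hV t) : ∃ (W : X.Opens) (_ : x ∈ W) (h₁ : W ≤ U) (h₂ : W ≤ V),
      secRes F h₁ s = secRes F h₂ t := by
  obtain ⟨W, hW, i, j, e⟩ := TopCat.Presheaf.germ_eq F.presheaf x hU hV s t h
  exact ⟨W, hW, i.le, j.le, e⟩

lemma secRes_eq_zero_of_secGerm_eq_zero (hU : x ∈ U) (s : Γ(F, U)) (h : secGerm F hU s = 0) :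
    ∃ (W : X.Opens) (_ : x ∈ W) (h₁ : W ≤ U), secRes F h₁ s = 0 := by
  obtain ⟨W, hW, i, j, e⟩ := secRes_eq_of_secGerm_eq hU hU s 0 (h.trans (map_zero _).symm)
  exact ⟨W, hW, i, e.trans (map_zero _)⟩

lemma secGerm_smul (hx : x ∈ U) (a : Γ(X, U)) (s : Γ(F, U)) :
    secGerm F hx (a • s) = fnGerm hx a • secGerm F hx s :=
  PresheafOfModules.germ_smul (R := X.presheaf) F.val x U hx a s

end Germ

/-! ### Jets -/

/-- The residue ring of the local ring at `η` modulo a power of the maximal ideal. -/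
abbrev JetRing (η : X) (l : ℕ) : Type u :=
  LocRing η ⧸ IsLocalRing.maximalIdeal (LocRing η) ^ l

instance jetRingModule (η : X) (l : ℕ) (N : (thickening η l).Modules) (W : (thickening η l).Opens) :
    Module (JetRing η l) Γ(N, W) :=
  (fun (R : CommRingCat.{u}) (M : (Spec R).Modules) (U : (Spec R).Opens) =>
    (inferInstance : Module R Γ(M, U))) (.of (JetRing η l)) N W

/-- The projection of the local ring to its jets. -/
abbrev jetMk (η : X) (l : ℕ) : LocRing η →+* JetRing η l := Ideal.Quotient.mk _

/-- The class of the germ of a function at `η` modulo a power of the maximal ideal. -/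
def jetClass (η : X) (l : ℕ) {U : X.Opens} (hU : η ∈ U) : Γ(X, U) →+* JetRing η l :=
  (jetMk η l).comp (fnGerm hU)

lemma thickeningι_apply (η : X) (l : ℕ) (p : thickening η l) : thickeningι η l p = η := by
  have : Spec.map (CommRingCat.ofHom (Ideal.Quotient.mk
      (IsLocalRing.maximalIdeal (X.presheaf.stalk η) ^ l))) p =
      IsLocalRing.closedPoint (X.presheaf.stalk η) := by
    refine PrimeSpectrum.ext ?_
    let p' : PrimeSpectrum (JetRing η l) := p
    have hp : (p'.asIdeal.comap (Ideal.Quotient.mk _)).IsPrime := inferInstance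
    refine ((IsLocalRing.maximalIdeal.isMaximal _).eq_of_le hp.ne_top ?_).symm
    -- A prime containing a power of the maximal ideal contains the maximal ideal. The exponent `l +
    -- 1` keeps the power nonzero also for `l = 0`, where the thickening is empty.
    refine (hp.pow_le_iff (n := l + 1) (Nat.succ_ne_zero l)).1 fun a ha => ?_
    rw [Ideal.mem_comap, Ideal.Quotient.eq_zero_iff_mem.2 (Ideal.pow_le_pow_right l.le_succ ha)]
    exact zero_mem _
  unfold thickeningι
  rw [Scheme.Hom.comp_apply, this, Scheme.fromSpecStalk_closedPoint]

lemma thickeningι_preimage_le (η : X) (l : ℕ) {U V : X.Opens} (hV : η ∈ V) :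
    thickeningι η l ⁻¹ᵁ U ≤ thickeningι η l ⁻¹ᵁ V := fun p _ => by
  change thickeningι η l p ∈ V
  rwa [thickeningι_apply]

lemma specMap_fromSpecStalk_app (η : X) {R : CommRingCat.{u}} (φ : X.presheaf.stalk η ⟶ R)
    {U : X.Opens} (hU : η ∈ U) : (Spec.map φ ≫ X.fromSpecStalk η).app U =
      X.presheaf.germ U η hU ≫ φ ≫ (Scheme.ΓSpecIso R).inv ≫
        (Spec R).presheaf.map (homOfLE le_top).op := by
  rw [Scheme.ΓSpecIso_inv_naturality_assoc, Scheme.Hom.comp_app, Scheme.fromSpecStalk_app hU]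
  simp only [Category.assoc, Scheme.Hom.naturality]
  rfl

lemma thickeningι_app (η : X) (l : ℕ) {U : X.Opens} (hU : η ∈ U) (a : Γ(X, U)) :
    (thickeningι η l).app U a = (thickening η l).presheaf.map (homOfLE le_top).op
      ((Scheme.ΓSpecIso (.of (JetRing η l))).inv (jetClass η l hU a)) := by
  have h1 := specMap_fromSpecStalk_app η (CommRingCat.ofHom (jetMk η l)) hU
  exact congrArg (fun k => k.hom a) h1

/-- On a pushforward from the spectrum of `𝒪_{X,η} / 𝔪_η ^ l`, functions act through their classes. -/
lemma push_smul (η : X) (l : ℕ) (N : (thickening η l).Modules) {U : X.Opens} (hU : η ∈ U)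
    (a : Γ(X, U)) (x : Γ(N, thickeningι η l ⁻¹ᵁ U)) :
    (show Γ(N, thickeningι η l ⁻¹ᵁ U) from
      a • (show Γ((Scheme.Modules.pushforward (thickeningι η l)).obj N, U) from x)) =
        jetClass η l hU a • x := by
  refine Eq.trans ?_ (Scheme.Modules.smul_Spec_def (M := N) _ x).symm
  refine Eq.trans (b := (thickeningι η l).app U a • x) rfl ?_
  rw [thickeningι_app η l hU]
  rfl

/-- Every point of the thickening lies over `η`, so the preimage of `U` is empty. -/
lemma push_subsingleton (η : X) (l : ℕ) (N : (thickening η l).Modules) {U : X.Opens} (hU : η ∉ U) :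
    Subsingleton Γ((Scheme.Modules.pushforward (thickeningι η l)).obj N, U) := by
  refine ⟨fun s t => sec_ext (F := N) (U := thickeningι η l ⁻¹ᵁ U) fun p hp => ?_⟩
  have : thickeningι η l p ∈ U := hp
  rw [thickeningι_apply] at this
  exact absurd this hU

lemma push_secRes_bijective (η : X) (l : ℕ) (N : (thickening η l).Modules) {U V : X.Opens}
    (h : V ≤ U) (hV : η ∈ V) :
    Function.Bijective (secRes ((Scheme.Modules.pushforward (thickeningι η l)).obj N) h) :=
  secRes_injective_of_eq (F := N) (show thickeningι η l ⁻¹ᵁ V ≤ thickeningι η l ⁻¹ᵁ U from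
    fun _ hp => h hp) (le_antisymm (fun _ hp => h hp) (thickeningι_preimage_le η l hV))

/-! ### Pushforwards to `X` of sheaves associated with modules over a jet ring -/

/-- The section of the sheaf associated to a module given by an element. -/
def tildeSec {η : X} {l : ℕ} (M : Type u) [AddCommGroup M] [Module (JetRing η l) M]
    (W : (thickening η l).Opens) :
    M →ₗ[JetRing η l] Γ((tilde (ModuleCat.of (JetRing η l) M) : (thickening η l).Modules), W) :=
  (tilde.toOpen (R := .of (JetRing η l)) (ModuleCat.of (JetRing η l) M) W).hom

section

variable {η : X} {l : ℕ} (M : Type u) [AddCommGroup M] [Module (JetRing η l) M]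

lemma secRes_tildeSec {W W' : (thickening η l).Opens} (h : W' ≤ W) (m : M) :
    secRes _ h (tildeSec M W m) = tildeSec M W' m :=
  congrArg (fun k => k.hom m)
    (tilde.toOpen_res (R := .of (JetRing η l)) (ModuleCat.of (JetRing η l) M) W W' (homOfLE h))

lemma toOpen_top_bijective {R : CommRingCat.{u}} (M : ModuleCat.{u} R) :
    Function.Bijective (tilde.toOpen M ⊤).hom :=
  ConcreteCategory.bijective_of_isIso (tilde.toOpen M ⊤)

lemma tildeSec_top_bijective : Function.Bijective (tildeSec M (⊤ : (thickening η l).Opens)) :=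
  toOpen_top_bijective (R := .of (JetRing η l)) (ModuleCat.of (JetRing η l) M)

lemma tildeSec_bijective {U : X.Opens} (hU : η ∈ U) :
    Function.Bijective (tildeSec M (thickeningι η l ⁻¹ᵁ U)) := by
  have h : thickeningι η l ⁻¹ᵁ U = ⊤ :=
    le_antisymm le_top (thickeningι_preimage_le (U := ⊤) η l hU)
  rw [h]
  exact tildeSec_top_bijective M

variable (η l) in
/-- The pushforward to `X` of the sheaf on `Spec (𝒪_{X,η} / 𝔪_η ^ l)` associated to a module. -/
def pushTilde : X.Modules :=
  (Scheme.Modules.pushforward (thickeningι η l)).obj (tilde (ModuleCat.of (JetRing η l) M))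

variable (η l) in
/-- The section of `pushTilde` given by an element of the module. -/
def pushSec (U : X.Opens) : M →+ Γ(pushTilde η l M, U) :=
  (tildeSec M (thickeningι η l ⁻¹ᵁ U)).toAddMonoidHom

lemma secRes_pushSec {U V : X.Opens} (h : V ≤ U) (m : M) :
    secRes (pushTilde η l M) h (pushSec η l M U m) = pushSec η l M V m :=
  Eq.trans (b := secRes (tilde (ModuleCat.of (JetRing η l) M) : (thickening η l).Modules)
    (show thickeningι η l ⁻¹ᵁ V ≤ thickeningι η l ⁻¹ᵁ U from fun _ hx => h hx)
    (tildeSec M (thickeningι η l ⁻¹ᵁ U) m)) rfl (secRes_tildeSec M _ m)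

lemma pushSec_smul {U : X.Opens} (hU : η ∈ U) (a : Γ(X, U)) (m : M) :
    pushSec η l M U (jetClass η l hU a • m) = a • pushSec η l M U m :=
  ((tildeSec M (thickeningι η l ⁻¹ᵁ U)).map_smul _ m).trans (push_smul η l _ hU a _).symm

lemma pushSec_bijective {U : X.Opens} (hU : η ∈ U) : Function.Bijective (pushSec η l M U) :=
  tildeSec_bijective M hU

lemma pushTilde_subsingleton {U : X.Opens} (hU : η ∉ U) : Subsingleton Γ(pushTilde η l M, U) :=
  push_subsingleton η l _ hU

/-- A morphism of sheaves of modules given by maps on sections. -/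
def mkHom {F G : X.Modules} (f : ∀ U, Γ(F, U) →+ Γ(G, U))
    (hres : ∀ {U V : X.Opens} (h : V ≤ U) (s : Γ(F, U)), f V (secRes F h s) = secRes G h (f U s))
    (hsmul : ∀ (U : X.Opens) (a : Γ(X, U)) (s : Γ(F, U)), f U (a • s) = a • f U s) : F ⟶ G :=
  ⟨PresheafOfModules.homMk
    { app := fun U => AddCommGrpCat.ofHom (f U.unop)
      naturality := fun U V g => by
        ext s
        exact hres g.unop.le s }
    fun U r s => hsmul U.unop r s⟩

variable {M} {G : X.Modules}

open Classical in
/-- The map on sections of `toPush`. -/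
def toPushFun (φ : Stalk G η →+ M) (U : X.Opens) : Γ(G, U) →+ Γ(pushTilde η l M, U) :=
  if h : η ∈ U then (pushSec η l M U).comp (φ.comp (secGerm G h)) else 0

lemma toPushFun_of_mem (φ : Stalk G η →+ M) {U : X.Opens} (hU : η ∈ U) (s : Γ(G, U)) :
    toPushFun φ U s = pushSec η l M U (φ (secGerm G hU s)) := by
  unfold toPushFun
  rw [dif_pos hU]
  rfl

/-- The morphism `G ⟶ i_* M~` for `i : Spec (𝒪_{X,η} / 𝔪_η ^ l) ⟶ X` given by a semilinear map
`G_η → M`. -/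
def toPush (φ : Stalk G η →+ M) (hφ : ∀ a g, φ (a • g) = jetMk η l a • φ g) :
    G ⟶ pushTilde η l M :=
  mkHom (toPushFun φ)
    (fun {U V} h s => by
      by_cases hV : η ∈ V
      · rw [toPushFun_of_mem φ hV, toPushFun_of_mem φ (h hV), secRes_pushSec, secGerm_secRes]
      · exact @Subsingleton.elim _ (pushTilde_subsingleton M hV) _ _)
    (fun U a s => by
      by_cases hU : η ∈ U
      · rw [toPushFun_of_mem φ hU, toPushFun_of_mem φ hU, secGerm_smul, hφ, ← pushSec_smul M hU]
        rfl
      · exact @Subsingleton.elim _ (pushTilde_subsingleton M hU) _ _)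

lemma toPush_app (φ : Stalk G η →+ M) (hφ : ∀ a g, φ (a • g) = jetMk η l a • φ g) {U : X.Opens}
    (hU : η ∈ U) (s : Γ(G, U)) :
    (toPush φ hφ).app U s = pushSec η l M U (φ (secGerm G hU s)) :=
  toPushFun_of_mem φ hU s

/-- Sections over neighbourhoods of `η` vanishing in the jets are sections with germ in
`𝔪_η ^ l G_η`. -/
lemma germ_mem_of_toJet_eq_zero {U : X.Opens} (hU : η ∈ U) (s : Γ(G, U))
    (h : ((toJet η l).app G).app U s = 0) :
    secGerm G hU s ∈ (IsLocalRing.maximalIdeal (LocRing η) ^ l • ⊤ : Submodule (LocRing η) (Stalk G η)) := by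
  let I := IsLocalRing.maximalIdeal (LocRing η) ^ l
  -- The projection `G_η → G_η / 𝔪_η^l G_η` gives a morphism from `G` to a pushforward from the
  -- thickening, which by adjunction factors through the jets; whatever dies in the jets therefore
  -- dies in this quotient. No explicit computation of the pullback is needed.
  let φ : Stalk G η →+ (Stalk G η ⧸ (I • ⊤ : Submodule (LocRing η) (Stalk G η))) :=
    (Submodule.mkQ _).toAddMonoidHom
  have hφ : ∀ a g, φ (a • g) = jetMk η l a • φ g := fun a g => rfl
  let adj := (Scheme.Modules.pullbackPushforwardAdjunction (thickeningι η l))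
  let ψ := (adj.homEquiv _ _).symm (toPush φ hφ)
  have e : (toJet η l).app G ≫ (Scheme.Modules.pushforward (thickeningι η l)).map ψ = toPush φ hφ :=
    (adj.homEquiv_unit _ _ _).symm.trans (Equiv.apply_symm_apply _ _)
  have e' := toPush_app φ hφ hU s
  have e₂ : ((Scheme.Modules.pushforward (thickeningι η l)).map ψ).app U
      (((toJet η l).app G).app U s) = (toPush φ hφ).app U s := congrArg (fun k => k.app U s) e
  have e₃ : (toPush φ hφ).app U s = 0 := by
    rw [← e₂, h]
    exact map_zero (((Scheme.Modules.pushforward (thickeningι η l)).map ψ).app U).hom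
  have := (pushSec_bijective (l := l) _ hU).1
    ((e'.symm.trans e₃).trans (map_zero (pushSec η l _ U)).symm)
  exact (Submodule.Quotient.mk_eq_zero _).1 this

end

/-! ### Sections of jets -/

/-- On a scheme with one point every sheaf of modules is localizing. -/
lemma isLoc_of_subsingleton [Subsingleton X] (N : X.Modules) : IsLoc N := by
  have key : ∀ {U : X.Opens} (f : Γ(X, U)), IsAffineOpen U →
      -- On a single point a basic open is everything or empty; in the empty case `f` is nilpotent,
      -- so a power of it kills all sections.
      X.basicOpen f = U ∨ (IsNilpotent f ∧ Subsingleton Γ(N, X.basicOpen f)) := by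
    intro U f hU
    by_cases h : X.basicOpen f = ⊥
    · refine .inr ⟨(Scheme.isNilpotent_iff_basicOpen_eq_bot_of_isCompact hU.isCompact f).2 h,
        ⟨fun s t => sec_ext fun x hx => ?_⟩⟩
      rw [h] at hx
      exact hx.elim
    · left
      obtain ⟨x, hx⟩ := TopologicalSpace.Opens.ne_bot_iff_nonempty _ |>.1 h
      refine le_antisymm (X.basicOpen_le f) fun y _ => ?_
      rw [Subsingleton.elim y x]
      exact hx
  refine ⟨fun {U} hU f s hs => ?_, fun {U} hU f t => ?_⟩
  · rcases key f hU with h | ⟨⟨n, hn⟩, -⟩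
    · refine ⟨0, ?_⟩
      rw [(secRes_injective_of_eq (X.basicOpen_le f) h).1 (hs.trans (map_zero _).symm), smul_zero]
    · exact ⟨n, by rw [hn, zero_smul]⟩
  · rcases key f hU with h | ⟨-, h⟩
    · obtain ⟨s, hs⟩ := (secRes_injective_of_eq (F := N) (X.basicOpen_le f) h).2 t
      exact ⟨0, s, by rw [hs, pow_zero, one_smul]⟩
    · exact ⟨0, 0, h.elim _ _⟩

lemma spec_secRes_smul {R : CommRingCat.{u}} (N : (Spec R).Modules) {U V : (Spec R).Opens}
    (h : V ≤ U) (r : R) (s : Γ(N, U)) : secRes N h (r • s) = r • secRes N h s :=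
  Scheme.Modules.map_smul_Spec (M := N) (homOfLE h).op r s

/-- The map induced by `M → M / E` works, since global sections of an associated sheaf are the
module itself. -/
lemma exists_tilde_hom_ker_eq {R : CommRingCat.{u}} (M : ModuleCat.{u} R) (E : Submodule R M) :
    ∃ (N' : (Spec R).Modules) (ψ : tilde M ⟶ N'), ∀ e : M,
      ψ.app ⊤ ((tilde.toOpen M ⊤).hom e) = 0 ↔ e ∈ E := by
  let M' : ModuleCat R := ModuleCat.of R (M ⧸ E)
  let q : M ⟶ M' := ModuleCat.ofHom E.mkQ
  refine ⟨tilde M', tilde.map q, fun e => ?_⟩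
  have h3 : (tilde.map q).app ⊤ ((tilde.toOpen M ⊤).hom e) = (tilde.toOpen M' ⊤).hom (q.hom e) :=
    congrArg (fun k => k.hom e) (tilde.toOpen_map_app q ⊤)
  rw [h3]
  constructor
  · intro h
    have := (toOpen_top_bijective M').1 (h.trans (map_zero (tilde.toOpen M' ⊤).hom).symm)
    exact (Submodule.Quotient.mk_eq_zero _).1 this
  · intro h
    have : q.hom e = 0 := (Submodule.Quotient.mk_eq_zero _).2 h
    rw [this]
    exact map_zero (tilde.toOpen M' ⊤).hom

/-- A submodule of the global sections of a quasi-coherent sheaf on an affine scheme is the kernel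
of a morphism on global sections. -/
lemma exists_hom_ker_eq {R : CommRingCat.{u}} (N : (Spec R).Modules) [N.IsQuasicoherent]
    (E : Submodule R Γ(N, ⊤)) :
    ∃ (N' : (Spec R).Modules) (ψ : N ⟶ N'), ∀ e : Γ(N, ⊤), ψ.app ⊤ e = 0 ↔ e ∈ E := by
  let M : ModuleCat R := (modulesSpecToSheaf.obj N).presheaf.obj (.op ⊤)
  let E' : Submodule R M := E
  have : IsIso N.fromTildeΓ := Scheme.Modules.isIso_fromTildeΓ_of_isQuasicoherent N
  obtain ⟨N', ψ, hψ⟩ := exists_tilde_hom_ker_eq M E'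
  refine ⟨N', inv N.fromTildeΓ ≫ ψ, fun e => ?_⟩
  have h1 : N.fromTildeΓ.app ⊤ ((tilde.toOpen M ⊤).hom e) = e := by
    refine (congrArg (fun k => k.hom e) (Scheme.Modules.toOpen_fromTildeΓ_app N ⊤)).trans ?_
    exact secRes_self (F := N) le_rfl e
  have h2 : (inv N.fromTildeΓ).app ⊤ e = (tilde.toOpen M ⊤).hom e := by
    have : (N.fromTildeΓ ≫ inv N.fromTildeΓ).app ⊤ ((tilde.toOpen M ⊤).hom e) =
      (tilde.toOpen M ⊤).hom e := by rw [IsIso.hom_inv_id]; rfl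
    exact (congrArg ((inv N.fromTildeΓ).app ⊤) h1.symm).trans this
  refine Iff.trans ?_ (hψ e)
  rw [app_comp_apply, h2]

section

variable {η : X} {l : ℕ} {G : X.Modules}

instance (η : X) (l : ℕ) : Subsingleton (thickening η l) := by
  refine ⟨fun p q => ?_⟩
  have key (p : thickening η l) : (show PrimeSpectrum (JetRing η l) from p).asIdeal.comap
      (Ideal.Quotient.mk _) = IsLocalRing.maximalIdeal (LocRing η) := by
    let p' : PrimeSpectrum (JetRing η l) := p
    have hp : (p'.asIdeal.comap (Ideal.Quotient.mk _)).IsPrime := inferInstance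
    refine ((IsLocalRing.maximalIdeal.isMaximal _).eq_of_le hp.ne_top ?_).symm
    refine (hp.pow_le_iff (n := l + 1) (Nat.succ_ne_zero l)).1 fun a ha => ?_
    rw [Ideal.mem_comap, Ideal.Quotient.eq_zero_iff_mem.2 (Ideal.pow_le_pow_right l.le_succ ha)]
    exact zero_mem _
  refine PrimeSpectrum.ext ?_
  exact Ideal.comap_injective_of_surjective _ Ideal.Quotient.mk_surjective
    ((key p).trans (key q).symm)

/-- The restriction maps of jets are bijective between neighbourhoods of the point. -/
lemma jet_secRes_bijective {U V : X.Opens} (h : V ≤ U) (hV : η ∈ V) :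
    Function.Bijective (secRes ((jet η l).obj G) h) :=
  push_secRes_bijective η l _ h hV

lemma jet_subsingleton {U : X.Opens} (hU : η ∉ U) : Subsingleton Γ((jet η l).obj G, U) :=
  push_subsingleton η l _ hU

variable (η l G) in
/-- The morphism from a sheaf of modules to its jets. -/
def toJetHom : G ⟶ (jet η l).obj G := (toJet η l).app G

lemma jet_smul_eq_zero {U : X.Opens} (hU : η ∈ U) {a : Γ(X, U)}
    (ha : fnGerm hU a ∈ IsLocalRing.maximalIdeal (LocRing η) ^ l) (s : Γ((jet η l).obj G, U)) :
    a • s = 0 := by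
  refine (push_smul η l _ hU a s).trans ?_
  have : jetClass η l hU a = 0 := Ideal.Quotient.eq_zero_iff_mem.2 ha
  rw [this]
  exact zero_smul _ _

/-- Converse to `germ_mem_of_toJet_eq_zero`. An element of `𝔪_η^l G_η` is, near `η`, a sum of
sections multiplied by functions in `𝔪_η^l`, which act as zero on the jets; shrinking the
neighbourhood loses nothing there. -/
lemma toJet_eq_zero_of_germ_mem {U : X.Opens} (hU : η ∈ U) (s : Γ(G, U))
    (h : secGerm G hU s ∈
      (IsLocalRing.maximalIdeal (LocRing η) ^ l • ⊤ : Submodule (LocRing η) (Stalk G η))) :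
    (toJetHom η l G).app U s = 0 := by
  have key : ∀ g ∈ (IsLocalRing.maximalIdeal (LocRing η) ^ l • ⊤ :
      Submodule (LocRing η) (Stalk G η)), ∃ (V : X.Opens) (hV : η ∈ V) (t : Γ(G, V)),
      secGerm G hV t = g ∧ (toJetHom η l G).app V t = 0 := by
    intro g hg
    refine Submodule.smul_induction_on hg (fun a ha g _ => ?_) fun g g' h h' => ?_
    · obtain ⟨V, hV, t, rfl⟩ := exists_secGerm_eq g
      obtain ⟨W, hW, a, rfl⟩ := exists_fnGerm_eq a
      have hVW : η ∈ V ⊓ W := ⟨hV, hW⟩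
      refine ⟨V ⊓ W, hVW, fnRes (U := W) (V := V ⊓ W) inf_le_right a • secRes G (V := V ⊓ W) inf_le_left t, ?_, ?_⟩
      · rw [secGerm_smul, fnGerm_fnRes, secGerm_secRes]
      · refine ((toJetHom η l G).app_smul _ _).trans (jet_smul_eq_zero hVW ?_ _)
        rwa [fnGerm_fnRes]
    · obtain ⟨V, hV, t, rfl, ht⟩ := h
      obtain ⟨W, hW, t', rfl, ht'⟩ := h'
      have hVW : η ∈ V ⊓ W := ⟨hV, hW⟩
      refine ⟨V ⊓ W, hVW, secRes G inf_le_left t + secRes G inf_le_right t', ?_, ?_⟩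
      · rw [map_add, secGerm_secRes, secGerm_secRes]
      · refine (map_add ((toJetHom η l G).app _).hom _ _).trans ?_
        refine (congrArg₂ (· + ·) ((app_secRes _ _ t).trans (congrArg _ ht))
          ((app_secRes _ _ t').trans (congrArg _ ht'))).trans ?_
        rw [map_zero, map_zero, add_zero]
  obtain ⟨V, hV, t, e, ht⟩ := key _ h
  obtain ⟨W, hW, h1, h2, e⟩ := secRes_eq_of_secGerm_eq hV hU t s e
  refine (jet_secRes_bijective h2 hW).1 ?_
  rw [map_zero, ← app_secRes, ← e, app_secRes, ht, map_zero]

/-- Every section of the jets comes from a section over a neighbourhood of the point. -/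
lemma exists_toJet_eq {U : X.Opens} (hU : η ∈ U) (e : Γ((jet η l).obj G, U)) :
    ∃ (V : X.Opens) (_ : η ∈ V) (h : V ≤ U) (s : Γ(G, V)),
      (toJetHom η l G).app V s = secRes _ h e := by
  let N : (thickening η l).Modules := (Scheme.Modules.pullback (thickeningι η l)).obj G
  have : N.IsQuasicoherent := (isLoc_of_subsingleton N).isQuasicoherent
  let P (e : Γ(N, ⊤)) : Prop := ∃ (V : X.Opens) (_ : η ∈ V) (s : Γ(G, V)),
      (toJetHom η l G).app V s = secRes N (V := thickeningι η l ⁻¹ᵁ V) le_top e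
  have hP0 : P 0 := ⟨⊤, trivial, 0, (map_zero ((toJetHom η l G).app ⊤).hom).trans
    (map_zero (secRes N _)).symm⟩
  have hPres : ∀ {V W : X.Opens} (h : W ≤ V) (s : Γ(G, V)) (e : Γ(N, ⊤)),
      (toJetHom η l G).app V s = secRes N (V := thickeningι η l ⁻¹ᵁ V) le_top e →
      (toJetHom η l G).app W (secRes G h s) =
        secRes N (V := thickeningι η l ⁻¹ᵁ W) le_top e := by
    intro V W h s e hs
    refine (app_secRes _ _ s).trans ?_
    rw [hs]
    exact secRes_secRes (F := N) (U := ⊤) (V := thickeningι η l ⁻¹ᵁ V)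
      (W := thickeningι η l ⁻¹ᵁ W) le_top (fun _ hx => h hx) e
  have hPadd : ∀ e e', P e → P e' → P (e + e') := by
    rintro e e' ⟨V, hV, s, hs⟩ ⟨W, hW, t, ht⟩
    refine ⟨V ⊓ W, ⟨hV, hW⟩, secRes G inf_le_left s + secRes G inf_le_right t, ?_⟩
    refine (map_add ((toJetHom η l G).app _).hom _ _).trans ?_
    refine Eq.trans ?_ (map_add (secRes N _) e e').symm
    exact congrArg₂ (· + ·) (hPres _ _ _ hs) (hPres _ _ _ ht)
  have hPsmul : ∀ (r : JetRing η l) e, P e → P (r • e) := by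
    rintro r e ⟨V, hV, s, hs⟩
    obtain ⟨r, rfl⟩ := Ideal.Quotient.mk_surjective r
    obtain ⟨W, hW, a, rfl⟩ := exists_fnGerm_eq r
    have hVW : η ∈ V ⊓ W := ⟨hV, hW⟩
    refine ⟨V ⊓ W, hVW, fnRes (U := W) (V := V ⊓ W) inf_le_right a • secRes G (V := V ⊓ W) inf_le_left s, ?_⟩
    refine ((toJetHom η l G).app_smul _ _).trans ?_
    refine (push_smul η l N hVW _ _).trans ?_
    refine Eq.trans ?_ (spec_secRes_smul (R := .of (JetRing η l)) N _ _ e).symm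
    have h1 : jetClass η l hVW (fnRes (U := W) inf_le_right a) =
      jetMk η l (fnGerm hW a) := congrArg (jetMk η l) (fnGerm_fnRes _ _ _)
    rw [h1]
    exact congrArg (fun y : Γ(N, thickeningι η l ⁻¹ᵁ (V ⊓ W)) => jetMk η l (fnGerm hW a) • y)
      (hPres _ _ _ hs)
  -- `E` consists of the jets that come from a section of `G` near `η`. A morphism `ψ` out of the
  -- pullback with kernel `E` has an adjoint that kills `G`, so `ψ = 0` and `E` is everything.
  let E : Submodule (JetRing η l) Γ(N, ⊤) :=
    { carrier := {e | P e}
      zero_mem' := hP0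
      add_mem' := fun {a b} ha hb => hPadd a b ha hb
      smul_mem' := hPsmul }
  obtain ⟨N', ψ, hψ⟩ := exists_hom_ker_eq (R := .of (JetRing η l)) N E
  have hzero : ψ = 0 := by
    let adj := (Scheme.Modules.pullbackPushforwardAdjunction (thickeningι η l))
    refine (adj.homEquiv _ _).injective ?_
    rw [adj.homEquiv_unit, adj.homEquiv_unit, Functor.map_zero, comp_zero]
    refine hom_ext_sec fun U s => ?_
    by_cases hU : η ∈ U
    · have hbij : Function.Bijective (secRes N (V := thickeningι η l ⁻¹ᵁ U) le_top) :=
        secRes_injective_of_eq _ (le_antisymm le_top (thickeningι_preimage_le (U := ⊤) η l hU))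
      obtain ⟨e, he⟩ := hbij.2 ((toJetHom η l G).app U s)
      have heE : e ∈ E := ⟨U, hU, s, he.symm⟩
      refine Eq.trans (b := ψ.app _ ((toJetHom η l G).app U s)) rfl ?_
      refine (congrArg _ he.symm).trans ?_
      refine (app_secRes ψ _ e).trans ?_
      rw [(hψ e).2 heE]
      exact map_zero (secRes N' _)
    · exact @Subsingleton.elim _ (push_subsingleton η l N' hU) _ _
  obtain ⟨e', he'⟩ := (jet_secRes_bijective (G := G) (l := l) (le_top : U ≤ ⊤) hU).2 e
  have : P e' := (hψ e').1 (by rw [hzero]; rfl)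
  obtain ⟨V, hV, s, hs⟩ := this
  refine ⟨V ⊓ U, ⟨hV, hU⟩, inf_le_right, secRes G inf_le_left s, ?_⟩
  rw [hPres _ _ _ hs, ← he', secRes_secRes]
  rfl

/-- If `η` lies in the basic open of `f`, restriction is bijective; otherwise `f` is in `𝔪_η` at
`η`, so `f^l` kills the jets, or there are no sections at all. -/
lemma jet_isLoc : IsLoc ((jet η l).obj G) := by
  refine ⟨fun {U} hU f s hs => ?_, fun {U} hU f t => ?_⟩
  · by_cases hη : η ∈ U
    · by_cases hf : η ∈ X.basicOpen f
      · exact ⟨0, by rw [(jet_secRes_bijective (X.basicOpen_le f) hf).1 (hs.trans (map_zero _).symm),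
          smul_zero]⟩
      · refine ⟨l, jet_smul_eq_zero hη ?_ s⟩
        rw [map_pow]
        refine Ideal.pow_mem_pow ?_ l
        rwa [Scheme.mem_basicOpen _ _ _ hη] at hf
    · exact ⟨0, (jet_subsingleton hη).elim _ _⟩
  · by_cases hf : η ∈ X.basicOpen f
    · obtain ⟨s, hs⟩ := (jet_secRes_bijective (X.basicOpen_le f) hf).2 t
      exact ⟨0, s, by rw [hs, pow_zero, one_smul]⟩
    · exact ⟨0, 0, (jet_subsingleton hf).elim _ _⟩

end

/-! ### Coherent approximation -/

/-- A morphism of sheaves of modules which is injective on sections. -/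
def IsInj {F G : X.Modules} (g : F ⟶ G) : Prop := ∀ U, Function.Injective (g.app U)

lemma IsInj.mono {F G : X.Modules} {g : F ⟶ G} (hg : IsInj g) : Mono g :=
  ⟨fun _ _ h => hom_ext_sec fun U s => hg U (congrArg (fun k => k.app U s) h)⟩

lemma IsInj.comp {F G H : X.Modules} {f : F ⟶ G} {g : G ⟶ H} (hf : IsInj f) (hg : IsInj g) :
    IsInj (f ≫ g) := fun U => (hg U).comp (hf U)

lemma IsInj.of_comp {F G H : X.Modules} {f : F ⟶ G} {g : G ⟶ H} (h : IsInj (f ≫ g)) : IsInj f :=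
  fun U => Function.Injective.of_comp (f := g.app U) (h U)

lemma isInj_imageι {F G : X.Modules} (g : F ⟶ G) : IsInj (imageι g) := imageι_injective g

lemma isCoherent_image {F G : X.Modules} (hF : IsLoc F) (hG : isCoherent X G) (g : G ⟶ F) :
    isCoherent X (imageSheaf g) :=
  isCoherent_imageSheaf hF (fun hU => (isLoc_of_isCoherent hG).extend hU) hG.2 g

lemma biprod_sec_eq {G₁ G₂ : X.Modules} {U : X.Opens} (s : Γ(G₁ ⊞ G₂, U)) :
    (biprod.inl : G₁ ⟶ G₁ ⊞ G₂).app U ((biprod.fst : G₁ ⊞ G₂ ⟶ G₁).app U s) +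
      (biprod.inr : G₂ ⟶ G₁ ⊞ G₂).app U ((biprod.snd : G₁ ⊞ G₂ ⟶ G₂).app U s) = s :=
  congrArg (fun f => Scheme.Modules.Hom.app f U s) (biprod.total (X := G₁) (Y := G₂))

lemma isCoherent_image_biprod {F G₁ G₂ : X.Modules} (hF : IsLoc F) (h₁ : isCoherent X G₁)
    (h₂ : isCoherent X G₂) (g : G₁ ⊞ G₂ ⟶ F) : isCoherent X (imageSheaf g) := by
  refine isCoherent_imageSheaf hF (fun {U} hU f t => ?_) (fun U hU => ?_) g
  · obtain ⟨n₁, s₁, e₁⟩ := (isLoc_of_isCoherent h₁).extend hU f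
      ((biprod.fst : G₁ ⊞ G₂ ⟶ G₁).app _ t)
    obtain ⟨n₂, s₂, e₂⟩ := (isLoc_of_isCoherent h₂).extend hU f
      ((biprod.snd : G₁ ⊞ G₂ ⟶ G₂).app _ t)
    refine ⟨n₁ + n₂, f ^ n₂ • (biprod.inl : G₁ ⟶ G₁ ⊞ G₂).app U s₁ +
      f ^ n₁ • (biprod.inr : G₂ ⟶ G₁ ⊞ G₂).app U s₂, ?_⟩
    rw [map_add, secRes_smul, secRes_smul, ← app_secRes, ← app_secRes, e₁, e₂,
      Scheme.Modules.Hom.app_smul, Scheme.Modules.Hom.app_smul, map_pow, map_pow, smul_smul,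
      smul_smul, ← pow_add, ← pow_add, add_comm n₂ n₁, ← smul_add, biprod_sec_eq]
  · have := h₁.2 U hU
    have := h₂.2 U hU
    refine Module.Finite.of_surjective ((appLinear (biprod.inl : G₁ ⟶ G₁ ⊞ G₂) U).coprod
      (appLinear (biprod.inr : G₂ ⟶ G₁ ⊞ G₂) U)) fun x => ⟨(_, _), biprod_sec_eq x⟩

/-- The category of coherent sheaves over a localizing sheaf is filtered. -/
lemma isFiltered_coh {F : X.Modules} (hF : IsLoc F) :
    IsFiltered (CostructuredArrow (isCoherent X).ι F) := by
  have : Nonempty (CostructuredArrow (isCoherent X).ι F) :=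
    ⟨CostructuredArrow.mk (Y := cohO X) (0 : structureSheaf X ⟶ F)⟩
  refine @IsFiltered.mk _ _ ⟨fun a b => ?_, fun a b f g => ?_⟩ this
  -- The sum of the two images in `F` is an upper bound.
  · let p : a.left.obj ⊞ b.left.obj ⟶ F := biprod.desc a.hom b.hom
    let c : CostructuredArrow (isCoherent X).ι F :=
      CostructuredArrow.mk (Y := (⟨imageSheaf p, isCoherent_image_biprod hF a.left.2 b.left.2 p⟩ :
        (isCoherent X).FullSubcategory)) (imageι p)
    refine ⟨c, CostructuredArrow.homMk (ObjectProperty.homMk (biprod.inl ≫ toImage p)) ?_,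
      CostructuredArrow.homMk (ObjectProperty.homMk (biprod.inr ≫ toImage p)) ?_, trivial⟩
    · change (biprod.inl ≫ toImage p) ≫ imageι p = _
      rw [Category.assoc, toImage_ι, biprod.inl_desc]
    · change (biprod.inr ≫ toImage p) ≫ imageι p = _
      rw [Category.assoc, toImage_ι, biprod.inr_desc]
  -- Replacing `b` by its image in `F` makes the structure map monic, and then `f` and `g`, which
  -- agree in `F`, agree already in the image.
  · let p : b.left.obj ⟶ F := b.hom
    let c : CostructuredArrow (isCoherent X).ι F :=
      CostructuredArrow.mk (Y := (⟨imageSheaf p, isCoherent_image hF b.left.2 p⟩ :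
        (isCoherent X).FullSubcategory)) (imageι p)
    refine ⟨c, CostructuredArrow.homMk (ObjectProperty.homMk (toImage p)) (toImage_ι p), ?_⟩
    refine CostructuredArrow.hom_ext _ _ (ObjectProperty.hom_ext _ ?_)
    have := (isInj_imageι p).mono
    refine (cancel_mono (imageι p)).1 ?_
    change (f.left.hom ≫ toImage p) ≫ imageι p = (g.left.hom ≫ toImage p) ≫ imageι p
    rw [Category.assoc, Category.assoc, toImage_ι]
    exact (CostructuredArrow.w f).trans (CostructuredArrow.w g).symm

section CohExtend

variable {A : (isCoherent X).FullSubcategory ⥤ AddCommGrpCat.{u + 1}} {F : X.Modules}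

lemma preservesColimit_forget (hF : IsLoc F) :
    PreservesColimit (CostructuredArrow.proj (isCoherent X).ι F ⋙ A) (forget AddCommGrpCat.{u + 1}) := by
  have := isFiltered_coh hF
  have : PreservesFilteredColimitsOfSize.{u, u + 1} (forget AddCommGrpCat.{u + 1}) :=
    preservesFilteredColimitsOfSize_of_univLE.{u + 1, u + 1, u, u + 1} _
  infer_instance

/-- Any representative can be pushed to its image in `F`, so coherent subsheaves suffice in the
filtered colimit. -/
lemma exists_cohExtend_eq (hF : IsLoc F) (a : (cohExtend A).obj F) :
    ∃ (G : (isCoherent X).FullSubcategory) (g : G.obj ⟶ F) (_ : IsInj g) (b : A.obj G),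
      (cohExtend A).map g ((cohExtendUnit A).app G b) = a := by
  have := preservesColimit_forget (A := A) hF
  obtain ⟨j, b, hb⟩ := Concrete.isColimit_exists_rep _
    ((isCoherent X).ι.pointwiseLeftKanExtensionIsPointwiseLeftKanExtension A F) a
  let p : j.left.obj ⟶ F := j.hom
  let G' : (isCoherent X).FullSubcategory := ⟨imageSheaf p, isCoherent_image hF j.left.2 p⟩
  let q : j.left ⟶ G' := ObjectProperty.homMk (toImage p)
  refine ⟨G', imageι p, isInj_imageι p, A.map q b, ?_⟩
  refine Eq.trans ?_ hb
  refine (congrArg ((cohExtend A).map (imageι p)) (app_map_apply (cohExtendUnit A) q b)).trans ?_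
  refine (map_map_apply (cohExtend A) _ _ _).trans ?_
  exact congrArg (fun k => (cohExtend A).map k ((cohExtendUnit A).app j.left b)) (toImage_ι p)

lemma exists_map_eq_zero_of_cohExtend (hF : IsLoc F) (G : (isCoherent X).FullSubcategory)
    (g : G.obj ⟶ F) (b : A.obj G) (h : (cohExtend A).map g ((cohExtendUnit A).app G b) = 0) :
    ∃ (G' : (isCoherent X).FullSubcategory) (q : G ⟶ G') (g' : G'.obj ⟶ F), IsInj g' ∧
      q.hom ≫ g' = g ∧ A.map q b = 0 := by
  have := preservesColimit_forget (A := A) hF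
  have := isFiltered_coh hF
  let j : CostructuredArrow (isCoherent X).ι F := CostructuredArrow.mk (Y := G) g
  obtain ⟨k, f, f', e⟩ := Concrete.isColimit_exists_of_rep_eq _
    ((isCoherent X).ι.pointwiseLeftKanExtensionIsPointwiseLeftKanExtension A F)
    (i := j) (j := j) b (0 : A.obj G) (h.trans (map_zero _).symm)
  let p : k.left.obj ⟶ F := k.hom
  let G' : (isCoherent X).FullSubcategory := ⟨imageSheaf p, isCoherent_image hF k.left.2 p⟩
  let q : k.left ⟶ G' := ObjectProperty.homMk (toImage p)
  refine ⟨G', f.left ≫ q, imageι p, isInj_imageι p, ?_, ?_⟩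
  · change (f.left.hom ≫ toImage p) ≫ imageι p = g
    rw [Category.assoc, toImage_ι]
    exact CostructuredArrow.w f
  · have e' : A.map f.left b = 0 := e.trans (map_zero _)
    rw [A.map_comp, ConcreteCategory.comp_apply, e', map_zero]

/-- When `G` is itself coherent, its identity is terminal among coherent sheaves over it. For
injectivity, an element dying in the colimit dies under some `q` that has a retraction back to `G`.
-/
lemma cohExtendUnit_bijective (G : (isCoherent X).FullSubcategory) :
    Function.Bijective ((cohExtendUnit A).app G) := by
  constructor
  · refine (injective_iff_map_eq_zero ((cohExtendUnit A).app G).hom).2 fun b hb => ?_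
    have hb' : (cohExtend A).map (𝟙 G.obj) ((cohExtendUnit A).app G b) = 0 :=
      (congrArg ((cohExtend A).map (𝟙 G.obj)) hb).trans (map_zero _)
    obtain ⟨G', q, g', -, e, h⟩ := exists_map_eq_zero_of_cohExtend (isLoc_of_isCoherent G.2) G
      (𝟙 _) b hb'
    have : q ≫ (ObjectProperty.homMk g' : G' ⟶ G) = 𝟙 G := ObjectProperty.hom_ext _ e
    rw [← ConcreteCategory.id_apply (X := A.obj G) b, ← A.map_id, ← this, A.map_comp,
      ConcreteCategory.comp_apply, h, map_zero]
  · intro a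
    obtain ⟨G', g, -, b, rfl⟩ := exists_cohExtend_eq (isLoc_of_isCoherent G.2) a
    exact ⟨A.map (ObjectProperty.homMk g : G' ⟶ G) b, app_map_apply (cohExtendUnit A) _ b⟩

end CohExtend

/-- The values of a functor on localizing sheaves are determined by those on coherent subsheaves. -/
structure IsCohDetermined (B : X.Modules ⥤ AddCommGrpCat.{u + 1}) : Prop where
  exists_eq : ∀ {F : X.Modules}, IsLoc F → ∀ a : B.obj F, ∃ (G : X.Modules) (_ : isCoherent X G)
    (g : G ⟶ F) (_ : IsInj g) (b : B.obj G), B.map g b = a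
  exists_map_eq_zero : ∀ {F : X.Modules}, IsLoc F → ∀ {G : X.Modules}, isCoherent X G →
    ∀ (g : G ⟶ F) (b : B.obj G), B.map g b = 0 → ∃ (G' : X.Modules) (_ : isCoherent X G')
      (q : G ⟶ G') (g' : G' ⟶ F), IsInj g' ∧ q ≫ g' = g ∧ B.map q b = 0

lemma isCohDetermined_cohExtend (A : (isCoherent X).FullSubcategory ⥤ AddCommGrpCat.{u + 1}) :
    IsCohDetermined (cohExtend A) where
  exists_eq hF a := by
    obtain ⟨G, g, hg, b, e⟩ := exists_cohExtend_eq hF a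
    exact ⟨G.obj, G.2, g, hg, _, e⟩
  exists_map_eq_zero hF G hG g b h := by
    obtain ⟨b, rfl⟩ := (cohExtendUnit_bijective (A := A) ⟨G, hG⟩).2 b
    obtain ⟨G', q, g', hg', e, h'⟩ := exists_map_eq_zero_of_cohExtend hF ⟨G, hG⟩ g b h
    refine ⟨G'.obj, G'.2, q.hom, g', hg', e, ?_⟩
    refine (app_map_apply (cohExtendUnit A) q b).symm.trans ?_
    rw [h', map_zero]

lemma isCohDetermined_globalSections : IsCohDetermined (globalSections X) where
  exists_eq {F} hF a := by
    let p := ofSection a.down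
    refine ⟨imageSheaf p, isCoherent_image hF isCoherent_structureSheaf p, imageι p,
      isInj_imageι p, ⟨(toImage p).app ⊤ (oneSection X)⟩, ?_⟩
    exact ULift.ext _ _ (ofSection_app_one a.down)
  exists_map_eq_zero {F} hF G hG g b h := by
    refine ⟨imageSheaf g, isCoherent_image hF hG g, toImage g, imageι g, isInj_imageι g,
      toImage_ι g, ULift.ext _ _ ?_⟩
    refine isInj_imageι g ⊤ (Eq.trans ?_ (map_zero ((imageι g).app ⊤).hom).symm)
    exact congrArg ULift.down h

lemma isCohDetermined_adeles (n : ℕ) (S : Set (Fin n → X)) : IsCohDetermined (adeles n S) := by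
  cases n with
  | zero => exact isCohDetermined_globalSections
  | succ n => exact isCohDetermined_cohExtend _

/-- A transformation is injective at a localizing sheaf if it is so at its coherent subsheaves. -/
lemma injective_of_coherent {B B' : X.Modules ⥤ AddCommGrpCat.{u + 1}} (hB : IsCohDetermined B)
    (hB' : IsCohDetermined B') (β : B ⟶ B') {F : X.Modules} (hF : IsLoc F)
    (h : ∀ {G : X.Modules}, isCoherent X G → ∀ g : G ⟶ F, IsInj g →
      Function.Injective (β.app G)) : Function.Injective (β.app F) := by
  refine (injective_iff_map_eq_zero (β.app F).hom).2 fun a ha => ?_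
  obtain ⟨G, hG, g, -, b, rfl⟩ := hB.exists_eq hF a
  -- The image of `b` vanishes at a coherent subsheaf `G'` of `F` through which `g` factors, and
  -- there the hypothesis applies.
  obtain ⟨G', hG', q, g', hg', rfl, e⟩ := hB'.exists_map_eq_zero hF hG g (β.app G b)
    ((app_map_apply β g b).symm.trans ha)
  have : B.map q b = 0 := h hG' g' hg' ((app_map_apply β q b).trans (e.trans (map_zero _).symm))
  rw [← map_map_apply, this, map_zero]

/-- A functor determined by coherent subsheaves preserves injectivity if it does so for coherent
sheaves. -/
lemma map_injective_of_coherent {B : X.Modules ⥤ AddCommGrpCat.{u + 1}} (hB : IsCohDetermined B)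
    (h : ∀ {G G' : X.Modules}, isCoherent X G → isCoherent X G' → ∀ g : G ⟶ G', IsInj g →
      Function.Injective (B.map g)) {F F' : X.Modules} (hF : IsLoc F) (hF' : IsLoc F')
    (f : F ⟶ F') (hf : IsInj f) : Function.Injective (B.map f) := by
  refine (injective_iff_map_eq_zero (B.map f).hom).2 fun a ha => ?_
  obtain ⟨G, hG, g, hg, b, rfl⟩ := hB.exists_eq hF a
  obtain ⟨G', hG', q, g', hg', e, e'⟩ := hB.exists_map_eq_zero hF' hG (g ≫ f) b
    ((map_map_apply B g f b).symm.trans ha)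
  have hq : IsInj q := IsInj.of_comp (g := g') (e ▸ hg.comp hf)
  have : b = 0 := h hG hG' q hq (e'.trans (map_zero _).symm)
  rw [this, map_zero]

/-! ### Stalks of coherent sheaves -/

/-- The linear map on stalks induced by a morphism of sheaves of modules. -/
def stalkMap {F G : X.Modules} (g : F ⟶ G) (x : X) : Stalk F x →ₗ[LocRing x] Stalk G x where
  toFun := (TopCat.Presheaf.stalkFunctor Ab x).map g.mapPresheaf
  map_add' := map_add ((TopCat.Presheaf.stalkFunctor Ab x).map g.mapPresheaf).hom
  map_smul' a s := by
    obtain ⟨U, hU, s, rfl⟩ := exists_secGerm_eq s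
    obtain ⟨V, hV, a, rfl⟩ := exists_fnGerm_eq a
    have hUV : x ∈ U ⊓ V := ⟨hU, hV⟩
    have key (W : X.Opens) (hW : x ∈ W) (t : Γ(F, W)) :
        (TopCat.Presheaf.stalkFunctor Ab x).map g.mapPresheaf (secGerm F hW t) =
          secGerm G hW (g.app W t) :=
      TopCat.Presheaf.stalkFunctor_map_germ_apply W x hW g.mapPresheaf t
    have e : fnGerm hV a • secGerm F hU s =
        secGerm F hUV (fnRes (U := V) (V := U ⊓ V) inf_le_right a • secRes F inf_le_left s) := by
      rw [secGerm_smul, fnGerm_fnRes, secGerm_secRes]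
    refine (congrArg _ e).trans ?_
    refine (key _ _ _).trans ?_
    rw [g.app_smul, app_secRes, secGerm_smul, fnGerm_fnRes, secGerm_secRes]
    exact congrArg (fnGerm hV a • ·) (key _ _ _).symm

lemma stalkMap_secGerm {F G : X.Modules} (g : F ⟶ G) {x : X} {U : X.Opens} (hU : x ∈ U)
    (s : Γ(F, U)) : stalkMap g x (secGerm F hU s) = secGerm G hU (g.app U s) :=
  TopCat.Presheaf.stalkFunctor_map_germ_apply U x hU g.mapPresheaf s

lemma stalkMap_injective {F G : X.Modules} {g : F ⟶ G} (hg : IsInj g) (x : X) :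
    Function.Injective (stalkMap g x) := by
  refine (injective_iff_map_eq_zero _).2 fun s hs => ?_
  obtain ⟨U, hU, s, rfl⟩ := exists_secGerm_eq s
  rw [stalkMap_secGerm] at hs
  obtain ⟨W, hW, h, e⟩ := secRes_eq_zero_of_secGerm_eq_zero hU _ hs
  have : secRes F h s = 0 := hg W (by rw [app_secRes, e]; exact (map_zero (g.app W).hom).symm)
  rw [← secGerm_secRes h hW, this, map_zero]

/-- Elements of the stalk are sections over a given affine neighbourhood up to units. -/
lemma IsLoc.exists_isUnit_smul_eq {F : X.Modules} (hF : IsLoc F) {U : X.Opens} (hU : IsAffineOpen U)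
    {x : X} (hx : x ∈ U) (g : Stalk F x) :
    ∃ (a : Γ(X, U)) (s : Γ(F, U)), IsUnit (fnGerm hx a) ∧ fnGerm hx a • g = secGerm F hx s := by
  obtain ⟨V, hV, t, rfl⟩ := exists_secGerm_eq g
  obtain ⟨f, hfV, hxf⟩ := hU.exists_basicOpen_le ⟨x, hV⟩ hx
  obtain ⟨n, s, hs⟩ := hF.extend hU f (secRes F hfV t)
  refine ⟨f ^ n, s, ?_, ?_⟩
  · rw [map_pow]
    exact ((Scheme.mem_basicOpen _ _ _ hx).1 hxf).pow n
  · rw [← secGerm_secRes (X.basicOpen_le f) hxf s, hs, secGerm_smul, secGerm_secRes, map_pow,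
      map_pow, fnGerm_fnRes]

/-- Generators over an affine neighbourhood generate the stalk, because each germ becomes a section
over that neighbourhood after multiplication by a unit. -/
lemma stalk_finite {G : X.Modules} (hG : isCoherent X G) (x : X) :
    Module.Finite (LocRing x) (Stalk G x) := by
  obtain ⟨U, hU, hx, -⟩ := exists_isAffineOpen_mem_and_subset (U := ⊤) (x := x) trivial
  obtain ⟨S, hS⟩ := (hG.2 U hU).fg_top
  classical
  refine ⟨⟨S.image (secGerm G hx), ?_⟩⟩
  rw [eq_top_iff]
  intro g _
  obtain ⟨a, s, ha, e⟩ := (isLoc_of_isCoherent hG).exists_isUnit_smul_eq hU hx g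
  have hs : secGerm G hx s ∈ Submodule.span (LocRing x) (secGerm G hx '' S) := by
    have : s ∈ Submodule.span Γ(X, U) (S : Set Γ(G, U)) := hS ▸ trivial
    refine Submodule.span_induction (fun t ht => Submodule.subset_span ⟨t, ht, rfl⟩) ?_ ?_ ?_ this
    · rw [map_zero]; exact zero_mem _
    · intro s t _ _ h h'
      rw [map_add]; exact add_mem h h'
    · intro a s _ h
      rw [secGerm_smul]; exact Submodule.smul_mem _ _ h
  rw [Finset.coe_image]
  obtain ⟨b, hb⟩ := ha.exists_left_inv
  have : g = b • secGerm G hx s := by rw [← e, smul_smul, hb, one_smul]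
  rw [this]
  exact Submodule.smul_mem _ _ hs

/-! ### Adele functors preserve injectivity -/

/-- The Artin–Rees lemma for an injective linear map. -/
lemma exists_mem_pow_smul_top_of_injective {R M N : Type*} [CommRing R] [IsNoetherianRing R]
    [AddCommGroup M] [Module R M] [AddCommGroup N] [Module R N] [Module.Finite R N] (I : Ideal R)
    (f : M →ₗ[R] N) (hf : Function.Injective f) (l : ℕ) :
    ∃ c, ∀ m, f m ∈ (I ^ (l + c) • ⊤ : Submodule R N) → m ∈ (I ^ l • ⊤ : Submodule R M) := by
  obtain ⟨k, hk⟩ := I.exists_pow_inf_eq_pow_smul (LinearMap.range f)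
  refine ⟨k, fun m hm => ?_⟩
  have h1 : f m ∈ (I ^ (l + k) • ⊤ ⊓ LinearMap.range f : Submodule R N) := ⟨hm, m, rfl⟩
  rw [hk _ (Nat.le_add_left k l), Nat.add_sub_cancel] at h1
  have h2 : f m ∈ I ^ l • LinearMap.range f := Submodule.smul_mono le_rfl inf_le_right h1
  rw [LinearMap.range_eq_map, ← Submodule.map_smul''] at h2
  obtain ⟨m', hm', e⟩ := h2
  rwa [← hf e]

/-- The transition maps between jets. -/
def jetTransTo (η : X) (l : ℕ) : (c : ℕ) → (jet η (l + c) ⟶ jet η l)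
  | 0 => 𝟙 _
  | c + 1 => jetTrans η (l + c) ≫ jetTransTo η l c

lemma toJet_jetTransTo (η : X) (l c : ℕ) (G : X.Modules) :
    toJetHom η (l + c) G ≫ (jetTransTo η l c).app G = toJetHom η l G := by
  induction c with
  | zero => exact Category.comp_id _
  | succ c ih =>
    have h := toJet_trans η (l + c) G
    refine Eq.trans ?_ ih
    exact (Category.assoc _ _ _).symm.trans (congrArg (· ≫ (jetTransTo η l c).app G) h)

lemma jetLimit_jetTransTo {η : X} {B : X.Modules ⥤ AddCommGrpCat.{u + 1}} {G : X.Modules}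
    (a : jetLimit η B G) (l c : ℕ) : B.map ((jetTransTo η l c).app G) (a.1 (l + c)) = a.1 l := by
  induction c with
  | zero => exact congrArg (fun k => k (a.1 l)) (B.map_id _)
  | succ c ih =>
    refine Eq.trans ?_ ih
    refine (map_map_apply B ((jetTrans η (l + c)).app G) ((jetTransTo η l c).app G) _).symm.trans ?_
    exact congrArg _ (a.2 (l + c))

/-- A morphism which vanishes on the kernel of a surjection factors through it. -/
lemma exists_factor {K I L : X.Modules} (q : K ⟶ I) (hq : ∀ U, Function.Surjective (q.app U))
    (T : K ⟶ L) (h : ∀ U (s : Γ(K, U)), q.app U s = 0 → T.app U s = 0) :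
    ∃ r : I ⟶ L, q ≫ r = T := by
  let f (U : X.Opens) : Γ(I, U) →+ Γ(L, U) :=
    (q.app U).hom.liftOfSurjective (hq U) ⟨(T.app U).hom, fun s hs => h U s hs⟩
  have hf (U : X.Opens) (s : Γ(K, U)) : f U (q.app U s) = T.app U s :=
    AddMonoidHom.liftOfRightInverse_comp_apply _ _ _ _ s
  refine ⟨mkHom f ?_ ?_, hom_ext_sec fun U s => hf U s⟩
  · intro U V hUV s
    obtain ⟨s, rfl⟩ := hq U s
    rw [hf, ← app_secRes, hf, app_secRes]
  · intro U a s
    obtain ⟨s, rfl⟩ := hq U s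
    rw [hf, ← q.app_smul, hf, T.app_smul]

lemma toJetHom_naturality (η : X) (l : ℕ) {F G : X.Modules} (g : F ⟶ G) :
    g ≫ toJetHom η l G = toJetHom η l F ≫ (jet η l).map g :=
  (toJet η l).naturality g

/-- Sections of a morphism from jets to jets are determined at germs. -/
lemma jet_toImage_surjective {η : X} {l m : ℕ} {G H : X.Modules}
    (g : (jet η l).obj G ⟶ (jet η m).obj H) (U : X.Opens) :
    Function.Surjective ((toImage g).app U) := by
  intro s
  by_cases hU : η ∈ U
  · obtain ⟨V, hV, hη, k, hk⟩ := imageSheaf_locally g s η hU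
    obtain ⟨k, rfl⟩ := (jet_secRes_bijective hV hη).2 k
    refine ⟨k, imageι_injective g U ((jet_secRes_bijective hV hη).1 ?_)⟩
    rw [← app_secRes, ← app_secRes, ← app_secRes, hk]
  · exact ⟨0, imageι_injective g U ((jet_subsingleton hU).elim _ _)⟩

lemma IsLoc.imageSheaf {F K : X.Modules} (hF : IsLoc F) (hK : IsLoc K) (g : K ⟶ F) :
    IsLoc (imageSheaf g) :=
  isLoc_imageSheaf hF (fun hU => hK.extend hU) g

/-- If a section of the jets of `G` vanishes in the jets of `H ⊇ G` then it vanishes in the jets of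
`G` of a lower order. -/
lemma exists_jetTransTo_eq_zero [IsLocallyNoetherian X] {G H : X.Modules} (hH : isCoherent X H)
    {g : G ⟶ H} (hg : IsInj g) (η : X) (l : ℕ) :
    ∃ c, ∀ U (s : Γ((jet η (l + c)).obj G, U)), ((jet η (l + c)).map g).app U s = 0 →
      ((jetTransTo η l c).app G).app U s = 0 := by
  have := stalk_finite hH η
  obtain ⟨c, hc⟩ := exists_mem_pow_smul_top_of_injective
    (IsLocalRing.maximalIdeal (LocRing η)) _ (stalkMap_injective hg η) l
  refine ⟨c, fun U s hs => ?_⟩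
  by_cases hU : η ∈ U
  · obtain ⟨V, hV, h, t, ht⟩ := exists_toJet_eq hU s
    have e : (toJetHom η (l + c) H).app V (g.app V t) = 0 := by
      rw [← app_comp_apply, toJetHom_naturality, app_comp_apply]
      refine (congrArg _ ht).trans ?_
      rw [app_secRes, hs, map_zero]
    have h1 := germ_mem_of_toJet_eq_zero hV _ e
    rw [← stalkMap_secGerm] at h1
    have h2 := toJet_eq_zero_of_germ_mem hV t (hc _ h1)
    refine (jet_secRes_bijective h hV).1 ?_
    rw [map_zero, ← app_secRes]
    refine (congrArg _ ht.symm).trans (Eq.trans ?_ h2)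
    exact congrArg (fun k => k.app V t) (toJet_jetTransTo η l c G)
  · exact (jet_subsingleton hU).elim _ _

/-- An injection need not stay injective on jets, but by Artin–Rees the kernel at level `l + c` dies
at level `l`. Hence the transition map factors through the image of the `(l + c)`-jets of `G` in
those of `H`, on which `B η` sees no kernel, and a compatible family is recovered at level `l` from
level `l + c`. -/
lemma adeleStep_map_injective [IsLocallyNoetherian X] {n : ℕ} (S : Set (Fin (n + 1) → X))
    {B : X → X.Modules ⥤ AddCommGrpCat.{u + 1}}
    (hB : ∀ η {F G : X.Modules} (g : F ⟶ G), IsLoc F → IsLoc G → IsInj g →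
      Function.Injective ((B η).map g)) {G H : X.Modules} (hH : isCoherent X H)
    (g : G ⟶ H) (hg : IsInj g) : Function.Injective ((adeleStep S B).map g) := by
  refine (injective_iff_map_eq_zero ((adeleStep S B).map g).hom).2 fun a ha => ?_
  refine funext fun η => Subtype.ext (funext fun l => ?_)
  obtain ⟨c, hc⟩ := exists_jetTransTo_eq_zero hH hg η.1 l
  let p := (jet η.1 (l + c)).map g
  obtain ⟨r, hr⟩ := exists_factor (toImage p) (jet_toImage_surjective p)
    ((jetTransTo η.1 l c).app G) fun U s hs => hc U s (by
      have := congrArg ((imageι p).app U) hs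
      rw [← app_comp_apply, toImage_ι] at this
      exact this.trans (map_zero ((imageι p).app U).hom))
  have h0 : (B η.1).map p ((a η).1 (l + c)) = 0 :=
    congrArg (fun b => (b η).1 (l + c)) ha
  have h1 : (B η.1).map (toImage p) ((a η).1 (l + c)) = 0 := by
    refine hB η.1 (imageι p) (jet_isLoc.imageSheaf jet_isLoc p) jet_isLoc (isInj_imageι p) ?_
    rw [map_map_apply, toImage_ι, h0, map_zero]
  rw [← jetLimit_jetTransTo (a η) l c, ← hr, ← map_map_apply, h1, map_zero]
  rfl

/-- Adele functors preserve injectivity of morphisms. -/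
theorem adeles_map_injective [IsLocallyNoetherian X] (n : ℕ) (S : Set (Fin n → X))
    {F G : X.Modules} (g : F ⟶ G) (hF : IsLoc F) (hG : IsLoc G) (hg : IsInj g) :
    Function.Injective ((adeles n S).map g) := by
  induction n generalizing F G with
  | zero => exact fun a b h => ULift.ext _ _ (hg ⊤ (congrArg ULift.down h))
  | succ n ih =>
    refine map_injective_of_coherent (isCohDetermined_adeles _ S) ?_ hF hG g hg
    intro G G' hG hG' g hg
    have h := adeleStep_map_injective S (fun η {F G} g => ih (residual S η) g) hG' g hg
    let A := (isCoherent X).ι ⋙ adeleStep S fun η => adeles n (residual S η)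
    refine (injective_iff_map_eq_zero ((adeles (n + 1) S).map g).hom).2 fun a ha => ?_
    obtain ⟨a, rfl⟩ := (cohExtendUnit_bijective (A := A) ⟨G, hG⟩).2 a
    let g' : (⟨G, hG⟩ : (isCoherent X).FullSubcategory) ⟶ ⟨G', hG'⟩ := ObjectProperty.homMk g
    have e : (cohExtendUnit A).app ⟨G', hG'⟩ (A.map g' a) = 0 :=
      (app_map_apply (cohExtendUnit A) g' a).trans ha
    have e' : A.map g' a = 0 :=
      (cohExtendUnit_bijective (A := A) ⟨G', hG'⟩).1 (e.trans (map_zero _).symm)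
    have : a = 0 := h (e'.trans (map_zero _).symm)
    rw [this]
    exact map_zero ((cohExtendUnit A).app ⟨G, hG⟩).hom

/-! ### Boundary maps on coherent sheaves -/

lemma cohExtendDesc_unit {A : (isCoherent X).FullSubcategory ⥤ AddCommGrpCat.{u + 1}}
    {H : X.Modules ⥤ AddCommGrpCat.{u + 1}} (α : A ⟶ (isCoherent X).ι ⋙ H)
    (G : (isCoherent X).FullSubcategory) (a : A.obj G) :
    (cohExtendDesc α).app G.obj ((cohExtendUnit A).app G a) = α.app G a := by
  have := ((isCoherent X).ι.pointwiseLeftKanExtension A).descOfIsLeftKanExtension_fac_app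
    ((isCoherent X).ι.pointwiseLeftKanExtensionUnit A) H α G
  exact congrArg (fun k => k a) this

lemma adelesDesc_app {m : ℕ} {T : Set (Fin m → X)} {H : X.Modules ⥤ AddCommGrpCat.{u + 1}}
    (α : (isCoherent X).ι ⋙ adeles m T ⟶ (isCoherent X).ι ⋙ H)
    (G : (isCoherent X).FullSubcategory) (a : (adeles m T).obj G.obj) :
    (adelesDesc m T α).app G.obj a = α.app G a := by
  cases m with
  | zero => exact globalSectionsDescFun_coh α G a
  | succ m =>
    let A := (isCoherent X).ι ⋙ adeleStep T fun η => adeles m (residual T η)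
    obtain ⟨a, rfl⟩ := (cohExtendUnit_bijective (A := A) G).2 a
    exact cohExtendDesc_unit (cohExtendUnit A ≫ α) G a

/-- The functor on coherent sheaves whose extension is `adeles (n + 1) S`. -/
abbrev cohAdeles {n : ℕ} (S : Set (Fin (n + 1) → X)) :
    (isCoherent X).FullSubcategory ⥤ AddCommGrpCat.{u + 1} :=
  (isCoherent X).ι ⋙ adeleStep S fun η => adeles n (residual S η)

/-- The canonical map to the adeles of a coherent sheaf. -/
def toAdeles {n : ℕ} (S : Set (Fin (n + 1) → X)) (G : (isCoherent X).FullSubcategory) :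
    (adeleStep S fun η => adeles n (residual S η)).obj G.obj →+ (adeles (n + 1) S).obj G.obj :=
  ((cohExtendUnit (cohAdeles S)).app G).hom

lemma toAdeles_bijective {n : ℕ} (S : Set (Fin (n + 1) → X))
    (G : (isCoherent X).FullSubcategory) : Function.Bijective (toAdeles S G) :=
  cohExtendUnit_bijective (A := cohAdeles S) G

lemma map_toAdeles {n : ℕ} (S : Set (Fin (n + 1) → X)) {G H : (isCoherent X).FullSubcategory}
    (g : G ⟶ H) (a : (adeleStep S fun η => adeles n (residual S η)).obj G.obj) :
    (adeles (n + 1) S).map g.hom (toAdeles S G a) =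
      toAdeles S H ((adeleStep S fun η => adeles n (residual S η)).map g.hom a) :=
  (app_map_apply (cohExtendUnit (cohAdeles S)) g a).symm

/-! ### Vanishing and injectivity criteria for boundary maps -/

section

variable {m n : ℕ}

lemma restrict_mem_residual_keep {σ : Face m n} {T : Set (Fin (m + 1) → X)}
    {S : Set (Fin (n + 1) → X)} (h : ∀ Δ ∈ S, σ.keep.restrict Δ ∈ T) (η : X) :
    ∀ Δ ∈ residual S η, σ.restrict Δ ∈ residual T η := fun Δ hΔ => by
  simpa [Face.restrict, residual] using h _ hΔ

lemma restrict_mem_residual_skip {σ : Face m n} {T : Set (Fin m → X)}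
    {S : Set (Fin (n + 1) → X)} (h : ∀ Δ ∈ S, σ.skip.restrict Δ ∈ T) (η : X) :
    ∀ Δ ∈ residual S η, σ.restrict Δ ∈ T := fun Δ hΔ => by
  simpa [Face.restrict, residual] using h _ hΔ

lemma nonempty_residual_keep {σ : Face m n} {T : Set (Fin (m + 1) → X)}
    {S : Set (Fin (n + 1) → X)} (h : ∀ Δ ∈ S, σ.keep.restrict Δ ∈ T) {η : X}
    (hη : (residual S η).Nonempty) : (residual T η).Nonempty :=
  ⟨_, restrict_mem_residual_keep h η _ hη.some_mem⟩

/-- On coherent sheaves the extended functors agree with the products of limits, so the vanishing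
can be read in each component and at each level. -/
lemma boundary_keep_eq_zero {σ : Face m n} {T : Set (Fin (m + 1) → X)} {S : Set (Fin (n + 1) → X)}
    (h : ∀ Δ ∈ S, σ.keep.restrict Δ ∈ T) (G : (isCoherent X).FullSubcategory)
    (a : (adeleStep T fun η => adeles m (residual T η)).obj G.obj)
    (ha : (boundary σ.keep T S h).app G.obj (toAdeles T G a) = 0) (η : X)
    (hη : (residual S η).Nonempty) (l : ℕ) :
    (boundary σ (residual T η) (residual S η) (restrict_mem_residual_keep h η)).app _
      ((a ⟨η, nonempty_residual_keep h hη⟩).1 l) = 0 := by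
  have e := cohExtendDesc_unit (A := cohAdeles T) (H := adeles (n + 1) S)
    (Functor.whiskerLeft (isCoherent X).ι
      (adeleStepMap (fun η ⟨Δ, hΔ⟩ => ⟨_, restrict_mem_residual_keep h η Δ hΔ⟩)
        fun η => boundary σ (residual T η) (residual S η) (restrict_mem_residual_keep h η)) ≫
      cohExtendUnit (cohAdeles S)) G a
  have e' := (toAdeles_bijective S G).1 ((e.symm.trans ha).trans (map_zero (toAdeles S G)).symm)
  exact congrArg (fun b => (b ⟨η, hη⟩).1 l) e'

lemma boundary_skip_eq_zero {σ : Face m n} {T : Set (Fin m → X)} {S : Set (Fin (n + 1) → X)}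
    (h : ∀ Δ ∈ S, σ.skip.restrict Δ ∈ T) (G : (isCoherent X).FullSubcategory)
    (a : (adeles m T).obj G.obj) (ha : (boundary σ.skip T S h).app G.obj a = 0) (η : X)
    (hη : (residual S η).Nonempty) (l : ℕ) :
    (boundary σ T (residual S η) (restrict_mem_residual_skip h η)).app _
      ((adeles m T).map (toJetHom η l G.obj) a) = 0 := by
  have e := adelesDesc_app (T := T) (H := adeles (n + 1) S) (Functor.whiskerLeft (isCoherent X).ι
      (toAdeleStep S fun η => boundary σ T (residual S η) (restrict_mem_residual_skip h η)) ≫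
      cohExtendUnit (cohAdeles S)) G a
  have e' := (toAdeles_bijective S G).1 ((e.symm.trans ha).trans (map_zero (toAdeles S G)).symm)
  exact congrArg (fun b => (b ⟨η, hη⟩).1 l) e'

/-- The map is a product over first members. Condition `hne` says that no component is lost: a point
beginning a flag in `T` also begins one in `S`. -/
lemma boundary_keep_injective {σ : Face m n} {T : Set (Fin (m + 1) → X)}
    {S : Set (Fin (n + 1) → X)} (h : ∀ Δ ∈ S, σ.keep.restrict Δ ∈ T)
    (hne : ∀ η, (residual T η).Nonempty → (residual S η).Nonempty)
    (hinj : ∀ η, (residual S η).Nonempty → ∀ l (G : X.Modules), Function.Injective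
      ((boundary σ (residual T η) (residual S η) (restrict_mem_residual_keep h η)).app
        ((jet η l).obj G))) {F : X.Modules} (hF : IsLoc F) :
    Function.Injective ((boundary σ.keep T S h).app F) := by
  refine injective_of_coherent (isCohDetermined_adeles _ _) (isCohDetermined_adeles _ _) _ hF ?_
  intro G hG _ _
  refine (injective_iff_map_eq_zero ((boundary σ.keep T S h).app G).hom).2 fun a ha => ?_
  obtain ⟨a, rfl⟩ := (toAdeles_bijective T ⟨G, hG⟩).2 a
  have h0 := boundary_keep_eq_zero h ⟨G, hG⟩ a ha
  have : a = 0 := by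
    refine funext fun η => Subtype.ext (funext fun l => ?_)
    exact hinj η.1 (hne η.1 η.2) l G ((h0 η.1 (hne _ η.2) l).trans (map_zero _).symm)
  rw [this, map_zero]

lemma boundary_skip_injective {σ : Face m n} {T : Set (Fin m → X)}
    {S : Set (Fin (n + 1) → X)} (h : ∀ Δ ∈ S, σ.skip.restrict Δ ∈ T) {F : X.Modules}
    (hF : IsLoc F) (H : ∀ {G : X.Modules}, isCoherent X G → ∀ g : G ⟶ F, IsInj g →
      ∀ a : (adeles m T).obj G, (∀ η, (residual S η).Nonempty → ∀ l,
        (boundary σ T (residual S η) (restrict_mem_residual_skip h η)).app _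
          ((adeles m T).map (toJetHom η l G) a) = 0) → a = 0) :
    Function.Injective ((boundary σ.skip T S h).app F) := by
  refine injective_of_coherent (isCohDetermined_adeles _ _) (isCohDetermined_adeles _ _) _ hF ?_
  intro G hG g hg
  refine (injective_iff_map_eq_zero ((boundary σ.skip T S h).app G).hom).2 fun a ha => ?_
  exact H hG g hg a (boundary_skip_eq_zero h ⟨G, hG⟩ a ha)

/-- Krull's intersection theorem: a section with vanishing jets at `x` vanishes near `x`. -/
lemma exists_secRes_eq_zero_of_jets [IsLocallyNoetherian X] {G : X.Modules} (hG : isCoherent X G)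
    {U : X.Opens} {x : X} (hx : x ∈ U) (s : Γ(G, U))
    (h : ∀ l, (toJetHom x l G).app U s = 0) :
    ∃ (W : X.Opens) (_ : x ∈ W) (hW : W ≤ U), secRes G hW s = 0 := by
  have h2 (l : ℕ) := germ_mem_of_toJet_eq_zero (l := l) hx s (h l)
  have := stalk_finite hG x
  refine secRes_eq_zero_of_secGerm_eq_zero hx s ?_
  have := Ideal.iInf_pow_smul_eq_bot_of_isLocalRing (M := Stalk G x)
    (IsLocalRing.maximalIdeal (LocRing x)) (IsLocalRing.maximalIdeal.isMaximal _).ne_top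
  rw [← Submodule.mem_bot (R := LocRing x), ← this, Submodule.mem_iInf]
  exact h2

lemma sec_eq_zero_of_secRes {G F : X.Modules} {g : G ⟶ F} (hg : IsInj g) {U W : X.Opens}
    (h : W ≤ U) (hF : Function.Injective (secRes F h)) {s : Γ(G, U)} (hs : secRes G h s = 0) :
    s = 0 := by
  have h4 : secRes F h (g.app U s) = 0 := by
    rw [← app_secRes, hs]
    exact map_zero (g.app W).hom
  exact hg U ((hF (h4.trans (map_zero _).symm)).trans (map_zero (g.app U).hom).symm)

/-- The boundary map from global sections is injective if there is a point `x` at which it is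
injective on jets and all of whose neighbourhoods detect global sections. -/
lemma boundary_sections_injective [IsLocallyNoetherian X] {σ : Face 0 n} {T : Set (Fin 0 → X)}
    {S : Set (Fin (n + 1) → X)} (h : ∀ Δ ∈ S, σ.skip.restrict Δ ∈ T) {F : X.Modules}
    (hF : IsLoc F) (x : X) (hx : (residual S x).Nonempty)
    (hinj : ∀ l (G : X.Modules), Function.Injective
      ((boundary σ T (residual S x) (restrict_mem_residual_skip h x)).app ((jet x l).obj G)))
    (hU : ∀ U : X.Opens, x ∈ U → Function.Injective (secRes F (le_top : U ≤ ⊤))) :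
    Function.Injective ((boundary σ.skip T S h).app F) := by
  refine boundary_skip_injective h hF fun {G} hG g hg a ha => ?_
  have h0 (l : ℕ) : (adeles 0 T).map (toJetHom x l G) a = 0 :=
    hinj l G ((ha x hx l).trans (map_zero _).symm)
  have h1 (l : ℕ) : (toJetHom x l G).app ⊤ a.down = 0 := congrArg ULift.down (h0 l)
  obtain ⟨W, hW, hle, e⟩ := exists_secRes_eq_zero_of_jets hG (U := ⊤) (x := x) trivial _ h1
  exact ULift.ext _ _ (sec_eq_zero_of_secRes hg hle (hU W hW) e)

lemma boundary_nil_injective {T S : Set (Fin 0 → X)} (h : ∀ Δ ∈ S, Face.nil.restrict Δ ∈ T)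
    (F : X.Modules) : Function.Injective ((boundary Face.nil T S h).app F) :=
  fun _ _ h => h

/-- The boundary map which inserts a first point `ξ` is injective if sections are determined by
their first jets at `ξ`. -/
lemma boundary_skip_injective_of_jet [IsLocallyNoetherian X] {σ : Face m n} {T : Set (Fin m → X)}
    {S : Set (Fin (n + 1) → X)} (h : ∀ Δ ∈ S, σ.skip.restrict Δ ∈ T) {F : X.Modules}
    (hF : IsLoc F) (ξ : X) (hξ : (residual S ξ).Nonempty) (l : ℕ)
    (hinj : ∀ (G : X.Modules), Function.Injective
      ((boundary σ T (residual S ξ) (restrict_mem_residual_skip h ξ)).app ((jet ξ l).obj G)))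
    (hjet : ∀ {G : X.Modules} (g : G ⟶ F), IsInj g → IsInj (toJetHom ξ l G)) :
    Function.Injective ((boundary σ.skip T S h).app F) := by
  refine boundary_skip_injective h hF fun {G} hG g hg a ha => ?_
  have h0 : (adeles m T).map (toJetHom ξ l G) a = 0 :=
    hinj G ((ha ξ hξ l).trans (map_zero _).symm)
  exact adeles_map_injective m T (toJetHom ξ l G) (isLoc_of_isCoherent hG) jet_isLoc (hjet g hg)
    (h0.trans (map_zero _).symm)

end

/-! ### Sheaves whose sections are determined on dense open subsets -/

/-- The restriction maps to nonempty open subsets are injective. -/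
def IsTf (F : X.Modules) : Prop :=
  ∀ {U V : X.Opens} (h : V ≤ U), (V : Set X).Nonempty → Function.Injective (secRes F h)

lemma IsTf.of_isInj {F G : X.Modules} (hF : IsTf F) {g : G ⟶ F} (hg : IsInj g) : IsTf G := by
  intro U V h hV
  refine (injective_iff_map_eq_zero (secRes G h)).2 fun s hs => ?_
  exact sec_eq_zero_of_secRes hg h (hF h hV) hs

/-- Every nonempty open contains `ξ`, and jets at `ξ` do not change between neighbourhoods of it. -/
lemma isTf_jet {ξ : X} (hξ : ∀ x, ξ ⤳ x) (l : ℕ) (G : X.Modules) : IsTf ((jet ξ l).obj G) := by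
  rintro U V h ⟨x, hx⟩
  exact (jet_secRes_bijective h ((hξ x).mem_open V.2 hx)).1

/-- An element of a stalk killed by a nonzero element is zero. -/
lemma IsTf.eq_zero_of_smul [IsIntegral X] {F : X.Modules} (hF : IsTf F) {x : X} {a : LocRing x}
    (ha : a ≠ 0) {g : Stalk F x} (h : a • g = 0) : g = 0 := by
  obtain ⟨U, hU, s, rfl⟩ := exists_secGerm_eq g
  obtain ⟨V, hV, a, rfl⟩ := exists_fnGerm_eq a
  have hUV : x ∈ U ⊓ V := ⟨hU, hV⟩
  rw [← fnGerm_fnRes (V := U ⊓ V) inf_le_right hUV, ← secGerm_secRes (V := U ⊓ V) inf_le_left hUV,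
    ← secGerm_smul] at h
  obtain ⟨W, hW, hle, e⟩ := secRes_eq_zero_of_secGerm_eq_zero _ _ h
  rw [secRes_smul, fnRes_fnRes, secRes_secRes] at e
  have hne : fnRes (hle.trans inf_le_right) a ≠ 0 := by
    intro h0
    apply ha
    rw [← fnGerm_fnRes (hle.trans inf_le_right) hW, h0, map_zero]
  have hD : ((X.basicOpen (fnRes (hle.trans inf_le_right) a) : X.Opens) : Set X).Nonempty := by
    rw [← TopologicalSpace.Opens.ne_bot_iff_nonempty]
    intro h0
    exact hne ((basicOpen_eq_bot_iff _).1 h0)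
  let b := fnRes (hle.trans inf_le_right) a
  have hb : IsUnit (fnRes (X.basicOpen_le b) b) := RingedSpace.isUnit_res_basicOpen _ b
  have e2 : fnRes (X.basicOpen_le b) b • secRes F (X.basicOpen_le b)
      (secRes F (hle.trans inf_le_left) s) = 0 := by
    rw [← secRes_smul, e, map_zero]
  have e3 := (hb.smul_eq_zero).1 e2
  have e4 := hF (X.basicOpen_le b) hD (e3.trans (map_zero _).symm)
  rw [← secGerm_secRes (hle.trans inf_le_left) hW, e4, map_zero]

lemma fnGerm_injective [IsIntegral X] {U : X.Opens} {x : X} (hx : x ∈ U) :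
    Function.Injective (fnGerm (X := X) hx) :=
  germ_injective_of_isIntegral X x hx

/-- A section vanishing on a nonempty open is killed, on affine pieces, by a power of a nonzero
function, and flat modules over a domain are torsion-free. This is the only use of flatness. -/
lemma IsTf.of_isFlat [IsIntegral X] {F : X.Modules} (hF : IsLoc F) (hflat : IsFlat F) : IsTf F := by
  intro U V h hV
  refine (injective_iff_map_eq_zero (secRes F h)).2 fun s hs => sec_ext fun x hx => ?_
  obtain ⟨W, hW, hxW, hWU'⟩ := exists_isAffineOpen_mem_and_subset hx
  have hWU : W ≤ U := hWU'
  have hWV : ((V ⊓ W : X.Opens) : Set X).Nonempty :=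
    nonempty_preirreducible_inter V.2 W.2 hV ⟨x, hxW⟩
  obtain ⟨y, hyV, hyW⟩ := hWV
  obtain ⟨f, hfV, hyf⟩ := hW.exists_basicOpen_le ⟨y, hyV⟩ hyW
  have hf : f ≠ 0 := by
    rintro rfl
    simp at hyf
  obtain ⟨n, hn⟩ := hF.eq_zero hW f (secRes F hWU s) (by
    rw [secRes_secRes, ← secRes_secRes h hfV, hs, map_zero])
  have e : fnGerm hxW (f ^ n) • secGerm F hxW (secRes F hWU s) = 0 := by
    rw [← secGerm_smul, hn, map_zero]
  have hne : fnGerm hxW (f ^ n) ≠ 0 := by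
    rw [Ne, map_eq_zero_iff _ (fnGerm_injective hxW)]
    exact pow_ne_zero n hf
  have := hflat x
  have e2 : secGerm F hxW (secRes F hWU s) = 0 :=
    (smul_eq_zero.1 e).resolve_left hne
  obtain ⟨Z, hZ, hle, e3⟩ := secRes_eq_zero_of_secGerm_eq_zero _ _ e2
  refine ⟨Z, hle.trans hWU, hZ, ?_⟩
  rw [map_zero, ← e3, secRes_secRes]

/-- With zero maximal ideal the first jet at `ξ` is the whole stalk, and a section with zero generic
germ is zero by torsion-freeness. -/
lemma IsTf.isInj_toJetHom {F : X.Modules} (hF : IsTf F) {ξ : X} (hξ : ∀ x, ξ ⤳ x)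
    (hm : IsLocalRing.maximalIdeal (LocRing ξ) = ⊥) : IsInj (toJetHom ξ 1 F) := by
  intro U
  refine (injective_iff_map_eq_zero ((toJetHom ξ 1 F).app U).hom).2 fun s hs => ?_
  by_cases hU : (U : Set X).Nonempty
  · obtain ⟨x, hx⟩ := hU
    have hξU : ξ ∈ U := (hξ x).mem_open U.2 hx
    have h1 := germ_mem_of_toJet_eq_zero hξU s hs
    rw [hm, pow_one, Submodule.bot_smul, Submodule.mem_bot] at h1
    obtain ⟨W, hW, hle, e⟩ := secRes_eq_zero_of_secGerm_eq_zero _ _ h1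
    exact hF hle ⟨ξ, hW⟩ (e.trans (map_zero _).symm)
  · refine sec_ext fun x hx => (hU ⟨x, hx⟩).elim

/-! ### Inserting a curve through a closed point -/

/-- A finitely generated torsion-free module over a domain embeds in a free module. -/
lemma exists_injective_to_free {R M : Type*} [CommRing R] [IsDomain R] [AddCommGroup M] [Module R M]
    [Module.Finite R M] (h : ∀ (a : R) (m : M), a ≠ 0 → a • m = 0 → m = 0) :
    ∃ (n : ℕ) (f : M →ₗ[R] (Fin n → R)), Function.Injective f := by
  obtain ⟨S, hS⟩ := Module.Finite.fg_top (R := R) (M := M)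
  let v : S → M := Subtype.val
  -- A maximal independent set of generators spans a free `N`. Each generator has a nonzero multiple
  -- in `N`; the product `A` of these multipliers sends all of `M` into `N`, injectively by
  -- torsion-freeness.
  obtain ⟨I, hI, hI'⟩ := exists_maximal_linearIndepOn R v
  let N := Submodule.span R (v '' I)
  have key : ∀ i : S, ∃ a : R, a ≠ 0 ∧ a • v i ∈ N := by
    intro i
    by_cases hi : i ∈ I
    · exact ⟨1, one_ne_zero, by rw [one_smul]; exact Submodule.subset_span ⟨i, hi, rfl⟩⟩
    · exact hI' i hi
  choose a ha ha' using key
  let A := ∏ i, a i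
  have hA : A ≠ 0 := Finset.prod_ne_zero_iff.2 fun i _ => ha i
  have hAN : ∀ m : M, A • m ∈ N := by
    intro m
    have hm : m ∈ Submodule.span R (S : Set M) := hS ▸ trivial
    refine Submodule.span_induction (fun t ht => ?_) ?_ ?_ ?_ hm
    · obtain ⟨b, hb⟩ : a ⟨t, ht⟩ ∣ A := Finset.dvd_prod_of_mem a (Finset.mem_univ _)
      rw [hb, mul_comm, mul_smul]
      exact N.smul_mem _ (ha' ⟨t, ht⟩)
    · rw [smul_zero]; exact N.zero_mem
    · intro s t _ _ h h'
      rw [smul_add]; exact N.add_mem h h'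
    · intro b s _ h
      rw [smul_comm]; exact N.smul_mem _ h
  have hspan : N = Submodule.span R (Set.range fun i : I => v i) := by
    rw [← Set.image_eq_range]
  let B : Module.Basis I R (Submodule.span R (Set.range fun i : I => v i)) := Module.Basis.span hI
  have : Finite I := inferInstance
  obtain ⟨n, ⟨e⟩⟩ := Finite.exists_equiv_fin I
  let B' := B.reindex e
  let f₀ : M →ₗ[R] Submodule.span R (Set.range fun i : I => v i) :=
    (LinearMap.lsmul R M A).codRestrict _ fun m => hspan ▸ hAN m
  refine ⟨n, B'.equivFun.toLinearMap ∘ₗ f₀, B'.equivFun.injective.comp ?_⟩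
  refine (injective_iff_map_eq_zero f₀).2 fun m hm => h A m hA (congrArg Subtype.val hm)

/-- In a free module containing `M`, each coordinate of `c • g` is divisible by `t^l` and `t` is
prime to `c`, so `t^l` divides the coordinates of `g`. Artin–Rees for the embedding costs `d`
powers, whence `l = k + d`. The bound depends on none of `c`, `g`, `g'`. -/
lemma exists_mem_pow_smul_of_prime {R M : Type*} [CommRing R] [IsDomain R] [IsNoetherianRing R]
    [AddCommGroup M] [Module R M] [Module.Finite R M]
    (h : ∀ (a : R) (m : M), a ≠ 0 → a • m = 0 → m = 0) {t : R} (ht : Prime t) {I : Ideal R}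
    (htI : t ∈ I) (k : ℕ) : ∃ l, ∀ (c : R) (g g' : M), ¬ t ∣ c → c • g = t ^ l • g' →
      g ∈ (I ^ k • ⊤ : Submodule R M) := by
  obtain ⟨n, f, hf⟩ := exists_injective_to_free h
  obtain ⟨d, hd⟩ := exists_mem_pow_smul_top_of_injective I f hf k
  refine ⟨k + d, fun c g g' hc e => hd g ?_⟩
  have h1 (i : Fin n) : t ^ (k + d) ∣ f g i := by
    refine ht.pow_dvd_of_dvd_mul_left _ hc ⟨f g' i, ?_⟩
    have := congrFun (congrArg f e) i
    rwa [map_smul, map_smul] at this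
  choose v hv using h1
  have : f g = t ^ (k + d) • v := funext fun i => hv i
  rw [this]
  exact Submodule.smul_mem_smul (Ideal.pow_mem_pow htI _) trivial

/-- `η` is the generic point of a curve through `x` which is cut out near `x` by one equation. -/
def IsCurveThrough (η x : X) : Prop :=
  η ⤳ x ∧ ∃ (U : X.Opens) (_ : IsAffineOpen U) (hx : x ∈ U) (hη : η ∈ U) (τ : Γ(X, U)),
    Prime (fnGerm hx τ) ∧ fnGerm hx τ ∈ IsLocalRing.maximalIdeal (LocRing x) ∧
    IsLocalRing.maximalIdeal (LocRing η) = Ideal.span {fnGerm hη τ} ∧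
    ∀ c, IsUnit (fnGerm hη c) → ¬ fnGerm hx τ ∣ fnGerm hx c

lemma IsCurveThrough.exists_germ_mem [IsIntegral X] [IsLocallyNoetherian X] {η x : X}
    (h : IsCurveThrough η x) {G : X.Modules} (hG : isCoherent X G) (hG' : IsTf G) (k : ℕ) :
    ∃ l, ∀ (V : X.Opens) (hV : x ∈ V) (s : Γ(G, V)), (toJetHom η l G).app V s = 0 →
      secGerm G hV s ∈
        (IsLocalRing.maximalIdeal (LocRing x) ^ k • ⊤ : Submodule (LocRing x) (Stalk G x)) := by
  obtain ⟨hηx, U, hU, hx, hη, τ, hτ, hτm, hm, hc⟩ := h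
  have := stalk_finite hG x
  have hloc := isLoc_of_isCoherent hG
  obtain ⟨l, hl⟩ := exists_mem_pow_smul_of_prime (R := LocRing x) (M := Stalk G x)
    (fun a m ha e => hG'.eq_zero_of_smul ha e) hτ hτm k
  refine ⟨l, fun V hV s hs => ?_⟩
  have hηV : η ∈ V := hηx.mem_open V.2 hV
  -- Up to a unit at `x` the germ extends to the fixed affine `U`, where `τ` lives.
  obtain ⟨a, s₀, ha, e₀⟩ := hloc.exists_isUnit_smul_eq hU hx (secGerm G hV s)
  have h1 : secGerm G hη s₀ ∈
      (IsLocalRing.maximalIdeal (LocRing η) ^ l • ⊤ : Submodule (LocRing η) (Stalk G η)) := by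
    have hUV : x ∈ U ⊓ V := ⟨hx, hV⟩
    have e₁ : secGerm G hUV (fnRes (U := U) (V := U ⊓ V) inf_le_left a • secRes G inf_le_right s) =
        secGerm G hx s₀ := by
      rw [secGerm_smul, fnGerm_fnRes, secGerm_secRes, e₀]
    obtain ⟨W, hW, h₁, h₂, e₂⟩ := secRes_eq_of_secGerm_eq _ _ _ _ e₁
    have hηW : η ∈ W := hηx.mem_open W.2 hW
    rw [← secGerm_secRes h₂ hηW, ← e₂, secRes_smul, secGerm_smul, secRes_secRes, secGerm_secRes]
    exact Submodule.smul_mem _ _ (germ_mem_of_toJet_eq_zero hηV s hs)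
  rw [hm, Ideal.span_singleton_pow, Submodule.ideal_span_singleton_smul] at h1
  obtain ⟨g', -, e'⟩ := Submodule.mem_smul_pointwise_iff_exists _ _ _ |>.1 h1
  obtain ⟨c, s', hcu, e''⟩ := hloc.exists_isUnit_smul_eq hU hη g'
  have h2 : secGerm G hη (c • s₀ - τ ^ l • s') = 0 := by
    rw [map_sub, secGerm_smul, secGerm_smul, ← e', ← e'', map_pow, smul_comm, sub_self]
  obtain ⟨W, hW, hle, e₃⟩ := secRes_eq_zero_of_secGerm_eq_zero _ _ h2
  -- The equation `c s₀ = τ^l s'` holds near `η`, hence on all of `U` by torsion-freeness, and so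
  -- may be read at `x`.
  have h3 := sub_eq_zero.1 (hG' hle ⟨η, hW⟩ (e₃.trans (map_zero _).symm))
  have h4 := congrArg (secGerm G hx) h3
  rw [secGerm_smul, secGerm_smul, map_pow] at h4
  have h5 := hl _ _ _ (hc c hcu) h4
  obtain ⟨b, hb⟩ := ha.exists_left_inv
  have : secGerm G hV s = b • secGerm G hx s₀ := by rw [← e₀, smul_smul, hb, one_smul]
  rw [this]
  exact Submodule.smul_mem _ _ h5

lemma stalkMap_toImage_surjective {K F : X.Modules} (g : K ⟶ F) (x : X) :
    Function.Surjective (stalkMap (toImage g) x) := by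
  intro s
  obtain ⟨U, hU, s, rfl⟩ := exists_secGerm_eq s
  obtain ⟨V, hV, hx, k, hk⟩ := imageSheaf_locally g s x hU
  exact ⟨secGerm K hx k, by rw [stalkMap_secGerm, hk, secGerm_secRes]⟩

/-- Let `H` be the image of `G` in its `l`-jets along `η`. A germ of `G` at `x` that lands in `𝔪_x^k
H_x` differs from an element of `𝔪_x^k G_x` by a germ vanishing to order `l` along `η`, and for the
chosen `l` the latter lies in `𝔪_x^k G_x` too. -/
lemma IsCurveThrough.jet_eq_zero [IsIntegral X] [IsLocallyNoetherian X] {η x : X}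
    (h : IsCurveThrough η x) {G : X.Modules} (hG : isCoherent X G) (hG' : IsTf G) (k : ℕ)
    (b : Γ((jet x k).obj G, ⊤))
    (hb : ∀ l, ((jet x k).map (toImage (toJetHom η l G))).app ⊤ b = 0) : b = 0 := by
  obtain ⟨l, hl⟩ := h.exists_germ_mem hG hG' k
  let p := toJetHom η l G
  have hx : x ∈ (⊤ : X.Opens) := trivial
  obtain ⟨V, hV, hle, s, hs⟩ := exists_toJet_eq hx b
  have h1 : (toJetHom x k (imageSheaf p)).app V ((toImage p).app V s) = 0 := by
    rw [← app_comp_apply, toJetHom_naturality, app_comp_apply]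
    refine (congrArg _ hs).trans ?_
    rw [app_secRes, hb l, map_zero]
  have h2 := germ_mem_of_toJet_eq_zero hV _ h1
  rw [← stalkMap_secGerm, ← LinearMap.range_eq_top.2 (stalkMap_toImage_surjective p x),
    LinearMap.range_eq_map, ← Submodule.map_smul''] at h2
  obtain ⟨g, hg, e⟩ := h2
  have h3 : secGerm G hV s - g ∈
      (IsLocalRing.maximalIdeal (LocRing x) ^ k • ⊤ : Submodule (LocRing x) (Stalk G x)) := by
    have e' : stalkMap (toImage p) x (secGerm G hV s - g) = 0 := by rw [map_sub, e, sub_self]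
    generalize secGerm G hV s - g = g' at e'
    obtain ⟨U, hU, t, rfl⟩ := exists_secGerm_eq g'
    rw [stalkMap_secGerm] at e'
    obtain ⟨W, hW, hWU, e₂⟩ := secRes_eq_zero_of_secGerm_eq_zero _ _ e'
    rw [← secGerm_secRes hWU hW]
    refine hl W hW _ ?_
    have : (imageι p).app W ((toImage p).app W (secRes G hWU t)) = 0 := by
      rw [app_secRes, e₂]
      exact map_zero ((imageι p).app W).hom
    rwa [← app_comp_apply, toImage_ι] at this
  have h4 := add_mem h3 hg
  rw [sub_add_cancel] at h4
  have h5 := toJet_eq_zero_of_germ_mem hV s h4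
  exact (jet_secRes_bijective hle hV).1 ((hs.symm.trans h5).trans (map_zero _).symm)

/-- The boundary map inserting a curve through every point of a set of closed points is injective. -/
lemma boundary_curve_injective [IsIntegral X] [IsLocallyNoetherian X] {T : Set (Fin 1 → X)}
    {S : Set (Fin 2 → X)} (h : ∀ Δ ∈ S, Face.nil.keep.skip.restrict Δ ∈ T) {F : X.Modules}
    (hF : IsLoc F) (hF' : IsTf F) (hcurve : ∀ x, (residual T x).Nonempty →
      ∃ η, IsCurveThrough η x ∧ (residual (residual S η) x).Nonempty) :
    Function.Injective ((boundary Face.nil.keep.skip T S h).app F) := by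
  refine boundary_skip_injective h hF fun {G} hG g hg a ha => ?_
  obtain ⟨a, rfl⟩ := (toAdeles_bijective T ⟨G, hG⟩).2 a
  have : a = 0 := by
    refine funext fun x => Subtype.ext (funext fun k => ?_)
    obtain ⟨η, hη, hne⟩ := hcurve x.1 x.2
    refine ULift.ext _ _ (hη.jet_eq_zero hG (hF'.of_isInj hg) k _ fun l => ?_)
    let p := toJetHom η l G
    -- The jet sheaf need not be coherent, so its adeles cannot be read in components. Left
    -- exactness of adeles moves the vanishing to the coherent image `H`, where the component at `x`
    -- can be extracted.
    let H : (isCoherent X).FullSubcategory := ⟨imageSheaf p, isCoherent_image jet_isLoc hG p⟩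
    let q : (⟨G, hG⟩ : (isCoherent X).FullSubcategory) ⟶ H := ObjectProperty.homMk (toImage p)
    have hS : ∀ Δ ∈ residual S η, Face.nil.keep.restrict Δ ∈ T := restrict_mem_residual_skip h η
    have hη' : (residual S η).Nonempty := ⟨_, hne.some_mem⟩
    let β := boundary Face.nil.keep T (residual S η) hS
    have e1 : (adeles 1 (residual S η)).map (imageι p) (β.app _
        ((adeles 1 T).map (toImage p) (toAdeles T ⟨G, hG⟩ a))) = 0 := by
      rw [← app_map_apply, map_map_apply, toImage_ι]
      exact ha η hη' l
    have e2 := adeles_map_injective 1 _ (imageι p) (isLoc_of_isCoherent H.2) jet_isLoc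
      (isInj_imageι p) (e1.trans (map_zero _).symm)
    have e3 := boundary_keep_eq_zero hS H
      ((adeleStep T fun η => adeles 0 (residual T η)).map (toImage p) a)
      ((congrArg (β.app _) (map_toAdeles T q a)).symm.trans e2) x.1 hne k
    exact congrArg ULift.down e3
  rw [this, map_zero]

/-! ### Flags on a surface -/

/-- The facts about points of a regular integral surface used for adeles; `ξ` is the generic
point. -/
structure IsSurface (X : Scheme.{u}) (ξ : X) : Prop where
  specializes : ∀ x, ξ ⤳ x
  coheight_eq_zero : ∀ x : X, Order.coheight x = 0 ↔ x = ξ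
  maximalIdeal_eq_bot : IsLocalRing.maximalIdeal (LocRing ξ) = ⊥
  exists_one : ∃ η : X, Order.coheight η = 1
  exists_two : ∀ η : X, Order.coheight η = 1 → ∃ x : X, η ⤳ x ∧ Order.coheight x = 2
  exists_curve : ∀ x : X, Order.coheight x = 2 → ∃ η : X, Order.coheight η = 1 ∧ IsCurveThrough η x

lemma cons_mem_flags_singleton {x : X} {i : ℕ} (hx : Order.coheight x = i) :
    (Fin.cons x Fin.elim0 : Fin 1 → X) ∈ flagsOfCodim X [i] := by
  refine ⟨fun i j hij => ?_, fun j => ?_⟩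
  · exact absurd hij (by rw [Subsingleton.elim (α := Fin 1) i j]; exact lt_irrefl _)
  · obtain rfl : j = 0 := Subsingleton.elim (α := Fin 1) _ _
    exact hx

lemma cons_mem_flags_pair {η x : X} {i j : ℕ} (hη : Order.coheight η = i)
    (hx : Order.coheight x = j) (hij : i ≠ j) (h : η ⤳ x) :
    (Fin.cons η (Fin.cons x Fin.elim0) : Fin 2 → X) ∈ flagsOfCodim X [i, j] := by
  have hne : x ≠ η := by
    rintro rfl
    exact hij (by exact_mod_cast hη.symm.trans hx)
  refine ⟨fun (a b : Fin 2) hab => ?_, fun (a : Fin 2) => ?_⟩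
  · fin_cases a <;> fin_cases b
    · exact absurd hab (lt_irrefl _)
    · exact ⟨h, hne⟩
    · exact absurd (show (1 : Fin 2) < 0 from hab) (by decide)
    · exact absurd hab (lt_irrefl _)
  · fin_cases a
    · exact hη
    · exact hx

lemma nonempty_residual_singleton {x : X} {i : ℕ} (hx : Order.coheight x = i) :
    (residual (flagsOfCodim X [i]) x).Nonempty := ⟨Fin.elim0, cons_mem_flags_singleton hx⟩

lemma nonempty_residual_pair {η x : X} {i j : ℕ} (hη : Order.coheight η = i)
    (hx : Order.coheight x = j) (hij : i ≠ j) (h : η ⤳ x) :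
    (residual (residual (flagsOfCodim X [i, j]) η) x).Nonempty :=
  ⟨Fin.elim0, cons_mem_flags_pair hη hx hij h⟩

lemma coheight_of_residual {l : List ℕ} {i : ℕ} {x : X}
    (h : (residual (flagsOfCodim X (i :: l)) x).Nonempty) : Order.coheight x = i := by
  obtain ⟨Δ, -, h⟩ := h
  exact h (0 : Fin (l.length + 1))

lemma sublist_pair {α : Type*} {a b : α} {l : List α} (h : l.Sublist [a, b]) :
    l = [] ∨ l = [a] ∨ l = [b] ∨ l = [a, b] := by
  cases h with
  | cons _ h => rcases List.sublist_singleton.1 h with rfl | rfl <;> simp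
  | cons_cons _ h => rcases List.sublist_singleton.1 h with rfl | rfl <;> simp

/-! ### Injectivity for all pairs of codimension sets -/

namespace IsSurface

variable {ξ : X}

/-- The generic point specializes to everything, so it can be put in front of any flag; `0 ∉ l`
ensures that no later member equals it. -/
lemma residual_generic (hX : IsSurface X ξ) {l : List ℕ} (hl : 0 ∉ l) :
    residual (flagsOfCodim X (0 :: l)) ξ = flagsOfCodim X l := by
  ext Δ
  constructor
  · rintro ⟨h1, h2⟩
    exact ⟨fun i j hij => h1 i.succ j.succ (Fin.succ_lt_succ_iff.2 hij), fun j => h2 j.succ⟩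
  · rintro ⟨h1, h2⟩
    refine ⟨fun (i j : Fin (l.length + 1)) => ?_, fun (j : Fin (l.length + 1)) => ?_⟩
    · refine Fin.cases (fun hij => ?_) (fun i hij => ?_) i
      · obtain ⟨j, rfl⟩ := Fin.exists_succ_eq.2 hij.ne'
        refine ⟨hX.specializes _, fun (e : Δ j = ξ) => ?_⟩
        have h3 := h2 j
        rw [(hX.coheight_eq_zero _).2 e] at h3
        refine hl ?_
        have h4 : l.get j = 0 := by exact_mod_cast h3.symm
        rw [← h4]
        exact List.get_mem _ _
      · obtain ⟨j, rfl⟩ := Fin.exists_succ_eq.2 (Fin.ne_zero_of_lt hij)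
        exact h1 i j (Fin.succ_lt_succ_iff.1 hij)
    · refine Fin.cases ?_ (fun j => h2 j) j
      exact (hX.coheight_eq_zero ξ).2 rfl

lemma nonempty_flags (hX : IsSurface X ξ) {l : List ℕ} (hl : l.Sublist [1, 2]) :
    (flagsOfCodim X l).Nonempty := by
  obtain ⟨η, hη⟩ := hX.exists_one
  obtain ⟨x, hηx, hx⟩ := hX.exists_two η hη
  rcases sublist_pair hl with rfl | rfl | rfl | rfl
  · exact ⟨Fin.elim0, fun i => i.elim0, fun i => i.elim0⟩
  · exact ⟨_, cons_mem_flags_singleton hη⟩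
  · exact ⟨_, cons_mem_flags_singleton hx⟩
  · exact ⟨_, cons_mem_flags_pair hη hx (by decide) hηx⟩

/-- Boundary maps between adeles of positive codimensions. -/
lemma boundary_injective_pos [IsIntegral X] [IsLocallyNoetherian X] (hX : IsSurface X ξ)
    {l l' : List ℕ} (h : l.Sublist l') (h' : l'.Sublist [1, 2]) {F : X.Modules} (hF : IsLoc F)
    (hF' : IsTf F) :
    Function.Injective ((boundary (Face.ofSublist l l' h) _ _ (restrict_mem_flagsOfCodim h)).app F) := by
  have htf : ∀ (x : X) (U : X.Opens), x ∈ U → Function.Injective (secRes F (le_top : U ≤ ⊤)) :=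
    fun x U hx => hF' _ ⟨x, hx⟩
  have hjet : ∀ {η x : X}, η ⤳ x → ∀ (l : ℕ) (G : X.Modules) (U : X.Opens), x ∈ U →
      Function.Injective (secRes ((jet η l).obj G) (le_top : U ≤ ⊤)) :=
    fun h l G U hx => (jet_secRes_bijective _ (h.mem_open U.2 hx)).1
  obtain ⟨η, hη⟩ := hX.exists_one
  obtain ⟨x, hηx, hx⟩ := hX.exists_two η hη
  rcases sublist_pair h' with rfl | rfl | rfl | rfl
  · obtain rfl := List.sublist_nil.1 h
    exact boundary_nil_injective _ F
  · rcases List.sublist_singleton.1 h with rfl | rfl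
    · exact boundary_sections_injective (σ := .nil) _ hF η (nonempty_residual_singleton hη)
        (fun _ _ => boundary_nil_injective _ _) (htf η)
    · exact boundary_keep_injective (σ := .nil) _ (fun _ h => h)
        (fun _ _ _ _ => boundary_nil_injective _ _) hF
  · rcases List.sublist_singleton.1 h with rfl | rfl
    · exact boundary_sections_injective (σ := .nil) _ hF x (nonempty_residual_singleton hx)
        (fun _ _ => boundary_nil_injective _ _) (htf x)
    · exact boundary_keep_injective (σ := .nil) _ (fun _ h => h)
        (fun _ _ _ _ => boundary_nil_injective _ _) hF
  · have hne := nonempty_residual_pair hη hx (by decide) hηx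
    rcases sublist_pair h with rfl | rfl | rfl | rfl
    -- A global section is tested in its jets at `η`, and these in their jets at a closed point `x`
    -- of the curve; each neighbourhood of `x` contains `η`, so it detects jets at `η`.
    · exact boundary_sections_injective (σ := .skip .nil) _ hF η ⟨_, hne.some_mem⟩
        (fun l G => boundary_sections_injective (σ := .nil) _ jet_isLoc x hne
          (fun _ _ => boundary_nil_injective _ _) (hjet hηx l G)) (htf η)
    -- Every curve `y` must contain a point `z` of codimension 2, both to keep its component and to
    -- test its jets.
    · refine boundary_keep_injective (σ := .skip .nil) _ (fun y hy => ?_) (fun y hy l G => ?_) hF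
      · obtain ⟨z, hyz, hz⟩ := hX.exists_two y (coheight_of_residual hy)
        exact ⟨_, (nonempty_residual_pair (coheight_of_residual hy) hz (by decide) hyz).some_mem⟩
      · obtain ⟨z, hyz, hz⟩ := hX.exists_two y (coheight_of_residual hy)
        exact boundary_sections_injective (σ := .nil) _ jet_isLoc z
          (nonempty_residual_pair (coheight_of_residual hy) hz (by decide) hyz)
          (fun _ _ => boundary_nil_injective _ _) (hjet hyz l G)
    -- The only case here that needs a curve cut out by one equation at a given point.
    · refine boundary_curve_injective _ hF hF' fun y hy => ?_
      obtain ⟨z, hz, hzy⟩ := hX.exists_curve y (coheight_of_residual hy)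
      exact ⟨z, hzy, nonempty_residual_pair hz (coheight_of_residual hy) (by decide) hzy.1⟩
    · exact boundary_keep_injective (σ := .keep .nil) _ (fun _ h => h)
        (fun _ _ _ _ => boundary_keep_injective (σ := .nil) _ (fun _ h => h)
          (fun _ _ _ _ => boundary_nil_injective _ _) jet_isLoc) hF

lemma boundary_injective_congr {m n : ℕ} {σ : Face m n} {T T' : Set (Fin m → X)}
    {S S' : Set (Fin n → X)} (hT : T = T') (hS : S = S') (h : ∀ Δ ∈ S, σ.restrict Δ ∈ T)
    (h' : ∀ Δ ∈ S', σ.restrict Δ ∈ T') {F : X.Modules}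
    (hinj : Function.Injective ((boundary σ T' S' h').app F)) :
    Function.Injective ((boundary σ T S h).app F) := by
  subst hT hS
  exact hinj

/-- Codimension 0 occurs only as the generic point in first place. Removing it leaves flags of
positive codimensions and jets at `ξ`, which are torsion-free, so `boundary_injective_pos` applies
to them. -/
theorem boundary_injective [IsIntegral X] [IsLocallyNoetherian X] (hX : IsSurface X ξ)
    {l l' : List ℕ} (h : l.Sublist l') (h' : l'.Sublist [0, 1, 2]) {F : X.Modules} (hF : IsLoc F)
    (hF' : IsTf F) :
    Function.Injective ((boundary (Face.ofSublist l l' h) _ _ (restrict_mem_flagsOfCodim h)).app F) := by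
  have hzero : ∀ {k : List ℕ}, k.Sublist [1, 2] → 0 ∉ k := fun hk h0 => by
    simpa using hk.subset h0
  rcases l' with _ | ⟨i, k'⟩
  · exact boundary_injective_pos hX h (List.nil_sublist _) hF hF'
  by_cases hi : i = 0
  · subst hi
    have hk' : k'.Sublist [1, 2] := by simpa using h'
    have hr' := hX.residual_generic (hzero hk')
    have hne : (residual (flagsOfCodim X (0 :: k')) ξ).Nonempty := hr' ▸ hX.nonempty_flags hk'
    rcases l with _ | ⟨j, k⟩
    · exact boundary_skip_injective_of_jet (σ := Face.ofSublist [] k' (List.nil_sublist k')) _ hF ξ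
        hne 1 (fun G => boundary_injective_congr rfl hr' _ _
          (boundary_injective_pos hX (List.nil_sublist k') hk' jet_isLoc (isTf_jet hX.specializes 1 G)))
        fun g hg => IsTf.isInj_toJetHom (hF'.of_isInj hg) hX.specializes hX.maximalIdeal_eq_bot
    by_cases hj : j = 0
    · subst hj
      have hk : k.Sublist k' := by simpa using h
      have hr := hX.residual_generic (hzero (hk.trans hk'))
      have hσ : ∀ {η : X}, (residual (flagsOfCodim X (0 :: k)) η).Nonempty → η = ξ := fun hη =>
        (hX.coheight_eq_zero _).1 (by exact_mod_cast coheight_of_residual hη)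
      have hσ' : ∀ {η : X}, (residual (flagsOfCodim X (0 :: k')) η).Nonempty → η = ξ := fun hη =>
        (hX.coheight_eq_zero _).1 (by exact_mod_cast coheight_of_residual hη)
      refine boundary_keep_injective (σ := Face.ofSublist k k' hk) _ (fun η hη => ?_)
        (fun η hη l G => ?_) hF
      · rw [hσ hη]
        exact hne
      · obtain rfl := hσ' hη
        exact boundary_injective_congr hr hr' _ _
          (boundary_injective_pos hX hk hk' jet_isLoc (isTf_jet hX.specializes l G))
    · have hk : (j :: k).Sublist k' := by
        cases h with
        | cons _ h => exact h
        | cons_cons _ h => exact absurd rfl hj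
      have e : Face.ofSublist (j :: k) (0 :: k') h = .skip (Face.ofSublist (j :: k) k' hk) := by
        rw [Face.ofSublist, dif_neg hj]
      suffices H : ∀ (σ : Face (k.length + 1) (k'.length + 1))
          (hσ : σ = .skip (Face.ofSublist (j :: k) k' hk)) hm, Function.Injective
            ((boundary σ (flagsOfCodim X (j :: k)) (flagsOfCodim X (0 :: k')) hm).app F) from
        H _ e _
      rintro _ rfl hm
      exact boundary_skip_injective_of_jet (σ := Face.ofSublist (j :: k) k' hk) _ hF ξ
        hne 1 (fun G => boundary_injective_congr rfl hr' _ _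
          (boundary_injective_pos hX hk hk' jet_isLoc (isTf_jet hX.specializes 1 G)))
        fun g hg => IsTf.isInj_toJetHom (hF'.of_isInj hg) hX.specializes hX.maximalIdeal_eq_bot
  · have hk' : (i :: k').Sublist [1, 2] := by
      cases h' with
      | cons _ h => exact h
      | cons_cons _ h => exact absurd rfl hi
    exact boundary_injective_pos hX h hk' hF hF'

end IsSurface

/-! ### Regular local rings of dimension at most two -/

section Regular

variable {R : Type*} [CommRing R] [IsLocalRing R] [IsNoetherianRing R]

open IsLocalRing

lemma le_of_le_sup_maximalIdeal_smul {I J : Ideal R} (h : I ≤ J ⊔ maximalIdeal R * I) : I ≤ J :=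
  Submodule.le_of_le_smul_of_le_jacobson_bot (IsNoetherian.noetherian I)
    (IsLocalRing.maximalIdeal_le_jacobson ⊥) h

/-- A local Noetherian ring with a principal prime ideal which is not a minimal prime is a domain. -/
lemma isDomain_of_span_singleton {t : R} (ht : (Ideal.span {t}).IsPrime)
    (hmin : Ideal.span {t} ∉ minimalPrimes R) : IsDomain R := by
  obtain ⟨Q, hQ, hle⟩ := Ideal.exists_minimalPrimes_le (bot_le : ⊥ ≤ Ideal.span {t})
  have hQp : Q.IsPrime := hQ.1.1
  have htQ : t ∉ Q := fun h => hmin (by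
    rw [le_antisymm ((Ideal.span_singleton_le_iff_mem _).2 h) hle]
    exact hQ)
  have htm : t ∈ maximalIdeal R :=
    le_maximalIdeal ht.ne_top (Ideal.mem_span_singleton_self t)
  -- An element `t a` of `Q` has `a ∈ Q` because `t ∉ Q`; thus `Q ≤ 𝔪 Q`, and Nakayama's lemma gives
  -- `Q = 0`.
  have : Q ≤ ⊥ := le_of_le_sup_maximalIdeal_smul fun q hq => by
    obtain ⟨a, rfl⟩ := Ideal.mem_span_singleton.1 (hle hq)
    rw [bot_sup_eq]
    exact Ideal.mul_mem_mul htm ((hQp.mem_or_mem hq).resolve_left htQ)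
  rw [le_bot_iff] at this
  subst this
  exact (IsDomain.of_bot_isPrime R)

/-- A minimal prime `P` over `(t)` has height at most 1, so it misses `s`. An element `a s + b t` of
`P` then has `a ∈ P`, hence `P ≤ (t) + 𝔪 P`, and Nakayama's lemma gives `P = (t)`. -/
lemma isPrime_span_singleton {s t : R} (h : maximalIdeal R = Ideal.span {s, t})
    (hh : (maximalIdeal R).height = 2) : (Ideal.span {t}).IsPrime := by
  have htm : t ∈ maximalIdeal R := h ▸ Ideal.subset_span (by simp)
  have hle : Ideal.span {t} ≤ maximalIdeal R := (Ideal.span_singleton_le_iff_mem _).2 htm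
  obtain ⟨P, hP, hPm⟩ := Ideal.exists_minimalPrimes_le hle
  have hPp : P.IsPrime := hP.1.1
  have htP : t ∈ P := hP.1.2 (Ideal.mem_span_singleton_self t)
  have hsP : s ∉ P := fun hs => by
    have : maximalIdeal R = P := le_antisymm (h ▸ Ideal.span_le.2 (by
      rintro x (rfl | rfl)
      · exact hs
      · exact htP)) hPm
    have h1 := Ideal.height_le_one_of_isPrincipal_of_mem_minimalPrimes (Ideal.span {t}) P hP
    rw [← this, hh] at h1
    exact absurd h1 (by decide)
  have : P ≤ Ideal.span {t} := le_of_le_sup_maximalIdeal_smul fun p hp => by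
    have hpm := hPm hp
    rw [h, Ideal.mem_span_pair] at hpm
    obtain ⟨a, b, rfl⟩ := hpm
    have ha : a ∈ P := by
      have : a * s ∈ P := (P.add_mem_iff_left (P.mul_mem_left b htP)).1 hp
      exact (hPp.mem_or_mem this).resolve_right hsP
    rw [add_comm]
    refine Submodule.add_mem_sup (Ideal.mul_mem_left _ b (Ideal.mem_span_singleton_self t)) ?_
    rw [mul_comm a s]
    exact Ideal.mul_mem_mul (h ▸ Ideal.subset_span (by simp)) ha
  rwa [le_antisymm hP.1.2 this]

/-- Each `t + s^(n+1)` can replace `t`, so it generates a prime. If one of these primes is not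
minimal, the ring is a domain. Otherwise two of them coincide, as there are finitely many minimal
primes; their difference, a power of `s` times a unit, forces `s` into the prime, making the maximal
ideal minimal. -/
lemma isDomain_of_span_pair {s t : R} (h : maximalIdeal R = Ideal.span {s, t})
    (hh : (maximalIdeal R).height = 2) : IsDomain R := by
  have h' (n : ℕ) : maximalIdeal R = Ideal.span {s, t + s ^ (n + 1)} := by
    rw [h, pow_succ]
    exact (Ideal.span_pair_add_mul_left _ _ _).symm
  have hp (n : ℕ) := isPrime_span_singleton (h' n) hh
  by_contra hd
  have hmin (n : ℕ) : Ideal.span {t + s ^ (n + 1)} ∈ minimalPrimes R := by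
    by_contra hn
    exact hd (isDomain_of_span_singleton (hp n) hn)
  have hfin : (minimalPrimes R).Finite := minimalPrimes.finite_of_isNoetherianRing R
  obtain ⟨n, m, hnm, e⟩ : ∃ n m, n < m ∧
      Ideal.span {t + s ^ (n + 1)} = Ideal.span {t + s ^ (m + 1)} := by
    have : ¬ Function.Injective fun n : ℕ => (⟨_, hmin n⟩ : minimalPrimes R) := fun hinj => by
      have := hfin.to_subtype
      exact not_injective_infinite_finite _ hinj
    simp only [Function.Injective, not_forall] at this
    obtain ⟨n, m, e, hne⟩ := this
    rcases lt_or_gt_of_ne hne with hlt | hlt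
    · exact ⟨n, m, hlt, congrArg Subtype.val e⟩
    · exact ⟨m, n, hlt, (congrArg Subtype.val e).symm⟩
  obtain ⟨d, rfl⟩ := Nat.exists_eq_add_of_lt hnm
  have hsm : s ∈ maximalIdeal R := h ▸ Ideal.subset_span (by simp)
  have h1 : s ^ (n + 1) * (1 - s ^ (d + 1)) ∈ Ideal.span {t + s ^ (n + 1)} := by
    have h2 : t + s ^ (n + 1) ∈ Ideal.span {t + s ^ (n + 1)} := Ideal.mem_span_singleton_self _
    have h3 : t + s ^ (n + d + 1 + 1) ∈ Ideal.span {t + s ^ (n + 1)} :=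
      e ▸ Ideal.mem_span_singleton_self _
    convert Ideal.sub_mem _ h2 h3 using 1
    ring
  have hu : IsUnit (1 - s ^ (d + 1)) := by
    by_contra hu
    have h3 : (1 - s ^ (d + 1)) ∈ maximalIdeal R := hu
    have h4 := Ideal.add_mem _ h3 (Ideal.pow_mem_of_mem _ hsm (d + 1) d.succ_pos)
    rw [sub_add_cancel] at h4
    exact (Ideal.ne_top_iff_one _).1 (maximalIdeal.isMaximal R).ne_top h4
  have h5 : s ∈ Ideal.span {t + s ^ (n + 1)} :=
    (hp n).mem_of_pow_mem _ ((Ideal.mul_unit_mem_iff_mem _ hu).1 h1)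
  have h6 : maximalIdeal R = Ideal.span {t + s ^ (n + 1)} := by
    rw [h' n]
    refine le_antisymm (Ideal.span_le.2 ?_) (Ideal.span_mono (by simp))
    rintro x (rfl | rfl)
    · exact h5
    · exact Ideal.mem_span_singleton_self _
  have h7 := hmin n
  rw [← h6] at h7
  have h8 : (maximalIdeal R).height = 0 := Ideal.height_eq_zero_iff.2 h7
  rw [hh] at h8
  exact absurd h8 (by decide)

end Regular

lemma exists_maximalIdeal_eq_span_pair {R : Type*} [CommRing R] [IsRegularLocalRing R]
    (h : ringKrullDim R = 2) : ∃ s t : R, IsLocalRing.maximalIdeal R = Ideal.span {s, t} := by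
  have h1 := IsRegularLocalRing.spanFinrank_maximalIdeal (R := R)
  have hfg : (IsLocalRing.maximalIdeal R).FG := IsNoetherian.noetherian _
  rw [h] at h1
  have h2 : (IsLocalRing.maximalIdeal R).generators.ncard = 2 := by
    rw [Submodule.FG.generators_ncard hfg]
    exact_mod_cast h1
  obtain ⟨s, t, -, e⟩ := Set.ncard_eq_two.1 h2
  refine ⟨s, t, ?_⟩
  rw [← e]
  exact (Submodule.span_generators _).symm

lemma height_maximalIdeal_eq {R : Type*} [CommRing R] [IsLocalRing R] {n : ℕ}
    (h : ringKrullDim R = n) : (IsLocalRing.maximalIdeal R).height = n := by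
  have := IsLocalRing.maximalIdeal_height_eq_ringKrullDim (R := R)
  rw [h] at this
  exact_mod_cast this

/-- Regular local rings of dimension at most two are domains. -/
lemma isDomain_of_isRegularLocalRing {R : Type*} [CommRing R] [IsRegularLocalRing R]
    (h : ringKrullDim R ≤ 2) : IsDomain R := by
  have h1 := IsRegularLocalRing.spanFinrank_maximalIdeal (R := R)
  have hfg : (IsLocalRing.maximalIdeal R).FG := IsNoetherian.noetherian _
  generalize hn : (IsLocalRing.maximalIdeal R).spanFinrank = n at h1
  have hn2 : n ≤ 2 := by
    rw [← h1] at h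
    exact_mod_cast h
  have hh := height_maximalIdeal_eq h1.symm
  interval_cases n
  · have : IsLocalRing.maximalIdeal R = ⊥ := (Submodule.spanFinrank_eq_zero_iff_eq_bot hfg).1 hn
    have hf : IsField R := (IsLocalRing.isField_iff_maximalIdeal_eq).2 this
    exact hf.isDomain
  · obtain ⟨⟨⟨t, ht⟩⟩, -⟩ := (Submodule.spanFinrank_eq_one_iff _).1 hn
    have ht' : IsLocalRing.maximalIdeal R = Ideal.span {t} := ht
    refine isDomain_of_span_singleton (t := t) (ht' ▸ inferInstance) fun hmin => ?_
    rw [← ht', ← Ideal.height_eq_zero_iff, hh] at hmin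
    exact absurd hmin (by decide)
  · obtain ⟨s, t, e⟩ := exists_maximalIdeal_eq_span_pair (R := R) (by exact_mod_cast h1.symm)
    exact isDomain_of_span_pair e hh

/-! ### Heights of maximal ideals in finitely generated domains over a field -/

/-- By induction: a maximal ideal of `A[X]` over a Jacobson ring `A` contracts to a maximal ideal of
`A`, and its height is one more. -/
lemma height_of_isMaximal_mvPolynomial (k : Type*) [Field k] :
    ∀ (n : ℕ) (P : Ideal (MvPolynomial (Fin n) k)) [P.IsMaximal], P.height = n
  | 0, P, hP => by
    have h := Ideal.height_le_ringKrullDim_of_ne_top hP.ne_top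
    rw [MvPolynomial.ringKrullDim_of_isNoetherianRing, ringKrullDim_eq_zero_of_field] at h
    simpa using h
  | n + 1, P, hP => by
    let e := (MvPolynomial.finSuccEquiv k n).toRingEquiv
    have hP' : (P.comap e.symm).IsMaximal := Ideal.comap_isMaximal_of_equiv e.symm
    have hm : ((P.comap e.symm).under (MvPolynomial (Fin n) k)).IsMaximal :=
      Polynomial.isMaximal_comap_C_of_isJacobsonRing _
    have hl : (P.comap e.symm).LiesOver ((P.comap e.symm).under (MvPolynomial (Fin n) k)) := ⟨rfl⟩
    have h := Polynomial.height_eq_height_add_one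
      ((P.comap e.symm).under (MvPolynomial (Fin n) k)) (P.comap e.symm)
    rw [height_of_isMaximal_mvPolynomial k n, RingEquiv.height_comap] at h
    rw [h]
    rfl

/-- Going down makes the heights differ by the height in the fibre, and the fibre of a finite
algebra over `R ⧸ p` is Artinian. -/
lemma height_eq_of_liesOver_of_finite {R A : Type*} [CommRing R] [CommRing A] [IsNoetherianRing R]
    [IsNoetherianRing A] [Algebra R A] [Module.Finite R A] [Algebra.HasGoingDown R A] (p : Ideal R) [p.IsMaximal]
    (P : Ideal A) [P.IsPrime] [P.LiesOver p] : P.height = p.height := by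
  rw [Ideal.height_eq_height_add_of_liesOver_of_hasGoingDown p P]
  have hle : p.map (algebraMap R A) ≤ P := by
    rw [Ideal.map_le_iff_le_comap, Ideal.LiesOver.over (p := p) (P := P)]
  let _ : Field (R ⧸ p) := Ideal.Quotient.field p
  have : Module.Finite R (A ⧸ p.map (algebraMap R A)) :=
    Module.Finite.of_surjective (Ideal.Quotient.mkₐ R _).toLinearMap Ideal.Quotient.mk_surjective
  have : Module.Finite (R ⧸ p) (A ⧸ p.map (algebraMap R A)) :=
    Module.Finite.of_restrictScalars_finite R _ _
  have : IsArtinianRing (A ⧸ p.map (algebraMap R A)) := IsArtinianRing.of_finite (R ⧸ p) _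
  have hne : P.map (Ideal.Quotient.mk (p.map (algebraMap R A))) ≠ ⊤ := fun h => by
    have h1 := congrArg (Ideal.comap (Ideal.Quotient.mk (p.map (algebraMap R A)))) h
    rw [Ideal.comap_map_of_surjective' _ Ideal.Quotient.mk_surjective, Ideal.mk_ker,
      sup_eq_left.2 hle, Ideal.comap_top] at h1
    exact Ideal.IsPrime.ne_top' h1
  have h0 := (Ideal.height_le_ringKrullDim_of_ne_top hne).trans
    (Order.KrullDimLE.krullDim_le (n := 0))
  have : (P.map (Ideal.Quotient.mk (p.map (algebraMap R A)))).height = 0 := by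
    exact le_antisymm (by exact_mod_cast h0) bot_le
  rw [this, add_zero]

/-- All maximal ideals of a finitely generated domain over a field have the same height. -/
lemma exists_height_eq_of_isMaximal (k A : Type*) [Field k] [CommRing A] [IsDomain A] [Algebra k A]
    [Algebra.FiniteType k A] : ∃ n : ℕ, ∀ P : Ideal A, P.IsMaximal → P.height = n := by
  -- Noether normalization; the common height is the number `s` of variables.
  obtain ⟨s, g, hinj, hfin⟩ := exists_finite_inj_algHom_of_fg k A
  refine ⟨s, fun P hP => ?_⟩
  algebraize [g.toRingHom]
  have : Module.Finite (MvPolynomial (Fin s) k) A := hfin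
  have : IsNoetherianRing A := Algebra.FiniteType.isNoetherianRing k A
  have : FaithfulSMul (MvPolynomial (Fin s) k) A := (faithfulSMul_iff_algebraMap_injective _ _).2 hinj
  have : (P.under (MvPolynomial (Fin s) k)).IsMaximal := Ideal.IsMaximal.under _ P
  rw [height_eq_of_liesOver_of_finite (P.under (MvPolynomial (Fin s) k)) P,
    height_of_isMaximal_mvPolynomial]

/-! ### Local rings and primes of affine open subsets -/

section Prime

variable {U : X.Opens} (hU : IsAffineOpen U) {x : X} (hx : x ∈ U)

/-- The prime ideal of a point in an affine open subset. -/
def pointIdeal : Ideal Γ(X, U) := (hU.primeIdealOf ⟨x, hx⟩).asIdeal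

instance : (pointIdeal hU hx).IsPrime := (hU.primeIdealOf ⟨x, hx⟩).isPrime

lemma isLocalization_fnGerm :
    @IsLocalization.AtPrime _ _ (LocRing x) _ (fnGerm hx).toAlgebra (pointIdeal hU hx) _ :=
  hU.isLocalization_stalk ⟨x, hx⟩

lemma isUnit_fnGerm_iff (a : Γ(X, U)) : IsUnit (fnGerm hx a) ↔ a ∉ pointIdeal hU hx := by
  let _ := (fnGerm hx).toAlgebra
  have := isLocalization_fnGerm hU hx
  exact IsLocalization.AtPrime.isUnit_to_map_iff (LocRing x) (pointIdeal hU hx) a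

lemma exists_mul_fnGerm_eq (r : LocRing x) : ∃ (b s : Γ(X, U)), s ∉ pointIdeal hU hx ∧
    r * fnGerm hx s = fnGerm hx b := by
  let _ := (fnGerm hx).toAlgebra
  have := isLocalization_fnGerm hU hx
  obtain ⟨⟨b, s⟩, h⟩ := IsLocalization.surj (pointIdeal hU hx).primeCompl r
  exact ⟨b, s, s.2, h⟩

lemma map_pointIdeal : (pointIdeal hU hx).map (fnGerm hx) = IsLocalRing.maximalIdeal (LocRing x) := by
  let _ := (fnGerm hx).toAlgebra
  have := isLocalization_fnGerm hU hx
  exact IsLocalization.AtPrime.map_eq_maximalIdeal (pointIdeal hU hx) (LocRing x)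

lemma height_comap_fnGerm {U : X.Opens} (hU : IsAffineOpen U) {x : X} (hx : x ∈ U)
    (P : Ideal (LocRing x)) : (P.comap (fnGerm hx)).height = P.height := by
  let _ := (fnGerm hx).toAlgebra
  have := isLocalization_fnGerm hU hx
  exact IsLocalization.height_under (pointIdeal hU hx).primeCompl P

lemma comap_fnGerm_le (P : Ideal (LocRing x)) [hP : P.IsPrime] :
    P.comap (fnGerm hx) ≤ pointIdeal hU hx := fun a ha => by
  by_contra h
  exact hP.ne_top (Ideal.eq_top_of_isUnit_mem _ ha ((isUnit_fnGerm_iff hU hx a).2 h))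

lemma coheight_eq_height_pointIdeal : Order.coheight x = (pointIdeal hU hx).height := by
  have h := ringKrullDim_stalk_eq_coheight x
  let _ := (fnGerm hx).toAlgebra
  have := isLocalization_fnGerm hU hx
  have h' := IsLocalization.AtPrime.ringKrullDim_eq_height (pointIdeal hU hx) (LocRing x)
  exact_mod_cast h.symm.trans h'

lemma exists_pointIdeal_eq (q : Ideal Γ(X, U)) [hq : q.IsPrime] :
    ∃ (η : X) (hη : η ∈ U), pointIdeal hU hη = q := by
  let y : Spec Γ(X, U) := ⟨q, hq⟩
  have hy : hU.fromSpec y ∈ U := by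
    have : hU.fromSpec y ∈ Set.range hU.fromSpec := ⟨y, rfl⟩
    rwa [hU.range_fromSpec] at this
  refine ⟨hU.fromSpec y, hy, ?_⟩
  have : hU.primeIdealOf ⟨hU.fromSpec y, hy⟩ = y :=
    hU.fromSpec.isOpenEmbedding.injective (hU.fromSpec_primeIdealOf ⟨hU.fromSpec y, hy⟩)
  exact congrArg PrimeSpectrum.asIdeal this

lemma specializes_of_pointIdeal_le {η : X} (hη : η ∈ U) (h : pointIdeal hU hη ≤ pointIdeal hU hx) :
    η ⤳ x := by
  have h1 : hU.primeIdealOf ⟨η, hη⟩ ⤳ hU.primeIdealOf ⟨x, hx⟩ :=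
    (PrimeSpectrum.le_iff_specializes _ _).1 h
  have h2 := h1.map hU.fromSpec.continuous
  rwa [hU.fromSpec_primeIdealOf, hU.fromSpec_primeIdealOf] at h2

end Prime

/-- A prime element of a local ring defines a curve through the point. -/
lemma exists_isCurveThrough [IsIntegral X] {x : X} {t : LocRing x} (ht : Prime t) :
    ∃ η, Order.coheight η = (Ideal.span {t}).height ∧ IsCurveThrough η x := by
  obtain ⟨U, hU, hx, -⟩ := exists_isAffineOpen_mem_and_subset (x := x) (U := ⊤) trivial
  have hPp : (Ideal.span {t}).IsPrime := (Ideal.span_singleton_prime ht.ne_zero).2 ht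
  obtain ⟨η, hη, hq⟩ := exists_pointIdeal_eq hU ((Ideal.span {t}).comap (fnGerm hx))
  have hle : pointIdeal hU hη ≤ pointIdeal hU hx := hq ▸ comap_fnGerm_le hU hx _
  have hmem (a : Γ(X, U)) : a ∈ pointIdeal hU hη ↔ t ∣ fnGerm hx a := by
    rw [hq, Ideal.mem_comap, Ideal.mem_span_singleton]
  -- Clearing the denominator of `t` gives a function `τ` on `U` whose germ at `x` is associated to
  -- `t`.
  obtain ⟨τ, s, hs, hτ⟩ := exists_mul_fnGerm_eq hU hx t
  have hass : Associated t (fnGerm hx τ) :=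
    ⟨((isUnit_fnGerm_iff hU hx s).2 hs).unit, hτ⟩
  refine ⟨η, ?_, specializes_of_pointIdeal_le hU hx hη hle, U, hU, hx, hη, τ, hass.prime ht, ?_, ?_,
    ?_⟩
  · rw [coheight_eq_height_pointIdeal hU hη, hq, height_comap_fnGerm hU hx]
  · exact (hass.prime ht).not_isUnit
  · rw [← map_pointIdeal hU hη]
    refine le_antisymm (Ideal.map_le_iff_le_comap.2 fun a ha => ?_) ?_
    · obtain ⟨r, hr⟩ := hass.dvd_iff_dvd_left.1 ((hmem a).1 ha)
      obtain ⟨b, c, hc, hb⟩ := exists_mul_fnGerm_eq hU hx r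
      have e : a * c = τ * b := fnGerm_injective hx (by
        rw [map_mul, map_mul, hr, mul_assoc, hb])
      have hcu : IsUnit (fnGerm hη c) := (isUnit_fnGerm_iff hU hη c).2 fun h => hc (hle h)
      rw [Ideal.mem_comap, Ideal.mem_span_singleton, ← hcu.dvd_mul_right, ← map_mul, e, map_mul]
      exact dvd_mul_right _ _
    · rw [Ideal.span_singleton_le_iff_mem]
      exact Ideal.mem_map_of_mem _ ((hmem τ).2 hass.dvd)
  · intro c hc h
    exact (isUnit_fnGerm_iff hU hη c).1 hc ((hmem c).2 (hass.dvd.trans h))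

lemma isDomain_stalk_of_coheight_le {x : X} (hreg : IsRegularLocalRing (LocRing x))
    (h : Order.coheight x ≤ 2) : IsDomain (LocRing x) := by
  refine isDomain_of_isRegularLocalRing ?_
  rw [ringKrullDim_stalk_eq_coheight x]
  exact WithBot.coe_le_coe.2 h

/-- One of two generators of `𝔪_x` is a prime element; Krull's principal ideal theorem bounds the
height of its ideal by 1, and being nonzero in a domain it does not have height 0. -/
lemma exists_isCurveThrough_of_coheight_eq_two [IsIntegral X] {x : X}
    (hreg : IsRegularLocalRing (LocRing x)) (h : Order.coheight x = 2) :
    ∃ η, Order.coheight η = 1 ∧ IsCurveThrough η x := by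
  have hd : ringKrullDim (LocRing x) = 2 := by
    rw [ringKrullDim_stalk_eq_coheight x, h]
    rfl
  have hh : (IsLocalRing.maximalIdeal (LocRing x)).height = 2 := height_maximalIdeal_eq (n := 2) hd
  obtain ⟨s, t, hst⟩ := exists_maximalIdeal_eq_span_pair hd
  have htp := isPrime_span_singleton hst hh
  have ht0 : t ≠ 0 := by
    rintro rfl
    have h1 : (IsLocalRing.maximalIdeal (LocRing x)).height ≤ 1 := by
      have e : IsLocalRing.maximalIdeal (LocRing x) = Ideal.span {s} := by
        rw [hst, Ideal.span_pair_zero]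
      refine Ideal.height_le_one_of_isPrincipal_of_mem_minimalPrimes (Ideal.span {s}) _ ?_
      rw [← e, Ideal.minimalPrimes_eq_subsingleton_self]
      rfl
    rw [hh] at h1
    exact absurd h1 (by decide)
  obtain ⟨η, hη, hc⟩ := exists_isCurveThrough ((Ideal.span_singleton_prime ht0).1 htp)
  refine ⟨η, hη.trans (le_antisymm ?_ ?_), hc⟩
  · refine Ideal.height_le_one_of_isPrincipal_of_mem_minimalPrimes (Ideal.span {t}) _ ?_
    rw [Ideal.minimalPrimes_eq_subsingleton_self]
    rfl
  · rw [Order.one_le_iff_ne_zero, Ne, Ideal.height_eq_zero_iff]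
    intro hm
    rw [IsDomain.minimalPrimes_eq_singleton_bot] at hm
    exact ht0 (Ideal.span_singleton_eq_bot.1 hm)

/-! ### Regular surfaces over a field -/

lemma krullDim_eq_topologicalKrullDim (X : Scheme.{u}) : Order.krullDim X = topologicalKrullDim X :=
  (Order.krullDim_eq_of_orderIso (irreducibleSetEquivPoints (α := X))).symm

lemma coheight_le_of_topologicalKrullDim_eq {n : ℕ} (h : topologicalKrullDim X = n) (x : X) :
    Order.coheight x ≤ n := by
  have := Order.coheight_le_krullDim x
  rw [krullDim_eq_topologicalKrullDim, h] at this
  exact_mod_cast this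

lemma exists_coheight_eq_of_topologicalKrullDim_eq {n : ℕ} (h : topologicalKrullDim X = n) :
    ∃ x : X, Order.coheight x = n := by
  rw [← krullDim_eq_topologicalKrullDim] at h
  obtain ⟨p, hp⟩ := (Order.le_krullDim_iff (n := n)).1 h.ge
  refine ⟨p.head, le_antisymm ?_ ?_⟩
  · have := Order.coheight_le_krullDim p.head
    rw [h] at this
    exact_mod_cast this
  · have := Order.length_le_coheight_head (p := p)
    rwa [hp] at this

lemma exists_specializes_isClosed [JacobsonSpace X] (x : X) : ∃ y, x ⤳ y ∧ IsClosed {y} := by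
  obtain ⟨y, hy, hy'⟩ := nonempty_inter_closedPoints (Z := closure {x})
    (Set.singleton_nonempty x).closure isClosed_closure.isLocallyClosed
  exact ⟨y, specializes_iff_mem_closure.2 hy, hy'⟩

/-- Closed points correspond to maximal ideals of a finitely generated domain over `k`. -/
lemma exists_coheight_eq_of_isAffineOpen {k : Type u} [Field k] (f : X ⟶ Spec (.of k))
    [LocallyOfFiniteType f] [IsIntegral X] {U : X.Opens} (hU : IsAffineOpen U)
    [Nonempty U] : ∃ n : ℕ, ∀ x ∈ U, IsClosed {x} → Order.coheight x = n := by
  let φ : k →+* Γ(X, U) := (f.appLE ⊤ U le_top).hom.comp (Scheme.ΓSpecIso (.of k)).inv.hom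
  have hφ : φ.FiniteType :=
    RingHom.FiniteType.comp (f.finiteType_appLE (isAffineOpen_top _) hU le_top)
      (RingHom.FiniteType.of_surjective _
        (ConcreteCategory.bijective_of_isIso (Scheme.ΓSpecIso (.of k)).inv).2)
  let _ := φ.toAlgebra
  have : Algebra.FiniteType k Γ(X, U) := hφ
  obtain ⟨n, hn⟩ := exists_height_eq_of_isMaximal k Γ(X, U)
  refine ⟨n, fun x hx hxc => ?_⟩
  rw [coheight_eq_height_pointIdeal hU hx]
  exact hn _ (hU.primeIdealOf_isMaximal_of_isClosed ⟨x, hx⟩ hxc)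

/-- All closed points of an integral scheme of finite type over a field have the same
codimension. -/
lemma coheight_eq_of_isClosed {k : Type u} [Field k] (f : X ⟶ Spec (.of k))
    [LocallyOfFiniteType f] [IsIntegral X] {x y : X} (hx : IsClosed {x}) (hy : IsClosed {y}) :
    Order.coheight x = Order.coheight y := by
  have : JacobsonSpace X := LocallyOfFiniteType.jacobsonSpace f
  obtain ⟨U, hU, hxU, -⟩ := exists_isAffineOpen_mem_and_subset (x := x) (U := ⊤) trivial
  obtain ⟨V, hV, hyV, -⟩ := exists_isAffineOpen_mem_and_subset (x := y) (U := ⊤) trivial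
  have hne : (U ∩ V : Set X).Nonempty :=
    nonempty_preirreducible_inter U.isOpen V.isOpen ⟨x, hxU⟩ ⟨y, hyV⟩
  -- By irreducibility and the Jacobson property the two affines share a closed point, which matches
  -- their constants.
  obtain ⟨z, ⟨hzU, hzV⟩, hz⟩ := nonempty_inter_closedPoints hne
    (U.isOpen.inter V.isOpen).isLocallyClosed
  have : Nonempty U := ⟨⟨x, hxU⟩⟩
  have : Nonempty V := ⟨⟨y, hyV⟩⟩
  obtain ⟨n, hn⟩ := exists_coheight_eq_of_isAffineOpen f hU
  obtain ⟨m, hm⟩ := exists_coheight_eq_of_isAffineOpen f hV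
  rw [hn x hxU hx, ← hn z hzU hz, hm z hzV hz, hm y hyV hy]

lemma isIntegral_of_isRegularLocalRing [IrreducibleSpace X] (hdim : topologicalKrullDim X = 2)
    (hreg : ∀ x : X, IsRegularLocalRing (X.presheaf.stalk x)) : IsIntegral X := by
  have (x : X) : IsReduced (X.presheaf.stalk x) := by
    have : IsDomain (X.presheaf.stalk x) :=
      isDomain_stalk_of_coheight_le (hreg x) (coheight_le_of_topologicalKrullDim_eq hdim x)
    infer_instance
  have : IsReduced X := isReduced_of_isReduced_stalk X
  exact isIntegral_of_irreducibleSpace_of_isReduced X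

/-- Some point has codimension 2; a closed specialization of it has at least that codimension, and
all closed points share one codimension. -/
lemma coheight_eq_two_of_isClosed {k : Type u} [Field k] (f : X ⟶ Spec (.of k))
    [LocallyOfFiniteType f] [IsIntegral X] (hdim : topologicalKrullDim X = 2) {x : X}
    (hx : IsClosed {x}) : Order.coheight x = 2 := by
  have : JacobsonSpace X := LocallyOfFiniteType.jacobsonSpace f
  obtain ⟨y, hy⟩ := exists_coheight_eq_of_topologicalKrullDim_eq (n := 2) hdim
  obtain ⟨z, hyz, hz⟩ := exists_specializes_isClosed y
  rw [coheight_eq_of_isClosed f hx hz]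
  refine le_antisymm (coheight_le_of_topologicalKrullDim_eq (n := 2) hdim z) ?_
  have := Order.coheight_anti (Scheme.le_iff_specializes.2 hyz)
  rw [hy] at this
  exact this

lemma maximalIdeal_genericPoint [IsIntegral X] :
    IsLocalRing.maximalIdeal (LocRing (genericPoint X)) = ⊥ :=
  IsLocalRing.isField_iff_maximalIdeal_eq.1 (Field.toIsField X.functionField)

/-- A regular irreducible two-dimensional scheme of finite type over a field is a surface in the
sense of `IsSurface`. -/
lemma isSurface_of_isRegularLocalRing {k : Type u} [Field k] (f : X ⟶ Spec (.of k))
    [LocallyOfFiniteType f] [IsIntegral X] (hdim : topologicalKrullDim X = 2)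
    (hreg : ∀ x : X, IsRegularLocalRing (X.presheaf.stalk x)) : IsSurface X (genericPoint X) where
  specializes := genericPoint_specializes
  coheight_eq_zero x := by
    rw [Order.coheight_eq_zero]
    constructor
    · intro h
      have h1 := h (Scheme.le_iff_specializes.2 (genericPoint_specializes x))
      exact ((Scheme.le_iff_specializes.1 h1).antisymm (genericPoint_specializes x)).eq
    · rintro rfl y -
      exact Scheme.le_iff_specializes.2 (genericPoint_specializes y)
  maximalIdeal_eq_bot := maximalIdeal_genericPoint
  exists_one := by
    obtain ⟨x, hx⟩ := exists_coheight_eq_of_topologicalKrullDim_eq (n := 2) hdim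
    obtain ⟨η, hη, -⟩ := exists_isCurveThrough_of_coheight_eq_two (hreg x) hx
    exact ⟨η, hη⟩
  exists_two η hη := by
    have : JacobsonSpace X := LocallyOfFiniteType.jacobsonSpace f
    obtain ⟨z, hz, hz'⟩ := exists_specializes_isClosed η
    exact ⟨z, hz, coheight_eq_two_of_isClosed f hdim hz'⟩
  exists_curve x hx := exists_isCurveThrough_of_coheight_eq_two (hreg x) hx

end BeilinsonAdeles

end

/-! ### The theorem for flat quasi-coherent sheaves -/

theorem mainTheorem5 (k : Type u) [Field k] (X : Scheme.{u}) (f : X ⟶ Spec (.of k))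
    [LocallyOfFiniteType f] [QuasiCompact f] [IrreducibleSpace X]
    (hdim : topologicalKrullDim X = 2)
    (hreg : ∀ x : X, IsRegularLocalRing (X.presheaf.stalk x))
    (F : X.Modules) [F.IsQuasicoherent] (hF : BeilinsonAdeles.IsFlat F)
    (I J : Finset ℕ) (hIJ : I ⊆ J) (hJ : J ⊆ {0, 1, 2}) :
    Function.Injective ((BeilinsonAdeles.adelicMap X hIJ).app F) := by
  have : IsIntegral X := BeilinsonAdeles.isIntegral_of_isRegularLocalRing hdim hreg
  have : IsLocallyNoetherian X := LocallyOfFiniteType.isLocallyNoetherian f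
  have hloc := BeilinsonAdeles.IsLoc.of_isQuasicoherent F
  have hsub : (BeilinsonAdeles.increasing J).Sublist [0, 1, 2] := by
    have h := BeilinsonAdeles.increasing_sublist hJ
    have e : BeilinsonAdeles.increasing {0, 1, 2} = [0, 1, 2] := by
      have e' : ({0, 1, 2} : Finset ℕ) = [0, 1, 2].toFinset := by simp
      rw [e']
      exact (List.toFinset_sort (· ≤ ·) (by decide)).2 (by decide)
    rwa [e] at h
  exact (BeilinsonAdeles.isSurface_of_isRegularLocalRing f hdim hreg).boundary_injective
    (BeilinsonAdeles.increasing_sublist hIJ) hsub hloc (BeilinsonAdeles.IsTf.of_isFlat hloc hF)
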